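/- **Theorem 5.2.** Let $\mathsf G=(\mathsf V,\mathsf E)$ be an infinite isoradial graph whose faces cover the whole plane: a locally finite planar graph with straight edges, every face of which is a polygon inscribed in a circle of radius $1$ whose center lies in the interior of the face. For an edge $e=xy$ let $\bar\theta_e\in(0,\frac{\pi}{2})$ be the rhombus half-angle of $e$, i.e. the half-angle at $x$ of the rhombus of side length $1$ formed by $x$, $y$ and the circumcenters of the two faces adjacent to $e$ (so $|x-y|=2\cos\bar\theta_e$), and assume that there is $\varepsilon>0$ such that $\bar\theta_e\in(\varepsilon,\frac{\pi}{2}-\varepsilon)$ for every edge $e$. Let $k\in(0,1)$ and $k'=\sqrt{1-k^2}$, let $K,E$ be the complete elliptic integrals of the first and second kind of modulus $k$, let $\mathrm{sc},\mathrm{dc}$ be Jacobi's elliptic functions of modulus $k$, and let $$\mathrm A(u|k)=\frac1{k'}\Bigl(\int_0^u \mathrm{dc}^2(v|k)\,dv+\frac{E-K}{K}u\Bigr).$$ Put $\theta_e=\bar\theta_e\frac{2K}{\pi}$, and define conductances and masses by $$\rho(e)=\mathrm{sc}(\theta_e|k),\qquad m^2(x)=\sum_{y\sim x}\bigl(\mathrm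 A(\theta_{xy}|k)-\mathrm{sc}(\theta_{xy}|k)\bigr).$$ The massive Laplacian $(\Delta^{m(k)}f)(x)=\sum_{y\sim x}\rho(xy)(f(x)-f(y))+m^2(x)f(x)$ is invertible on $\ell^2(\mathsf V)$, with a unique bounded inverse; let $G^{m(k)}(x,y)=\bigl((\Delta^{m(k)})^{-1}\delta_y\bigr)(x)$ be the massive Green function. Fix an arbitrary orientation $e=(e_-,e_+)$ of the edges; the transfer impedance is, writing $G=G^{m(k)}$, $$\mathsf H^k(e,e')=\rho(e')\bigl(G(e_-,e'_-)-G(e_+,e'_-)-G(e_-,e'_+)+G(e_+,e'_+)\bigr),\qquad \mathsf H^k(e,x)=m^2(x)\bigl(G(e_-,x)-G(e_+,x)\bigr),$$ $$\mathsf H^k(x,e)=\rho(e)\bigl(G(x,e_-)-G(x,e_+)\bigr),\qquad \mathsf H^k(x,x')=m^2(x')\,G(x,x').$$ A rooted spanning forest of a graph is a spanning subgraph without cycles together with the choice of exactly one vertex, the root, in each of its connected components. The set of rooted spanning forests is viewed as a set of subsets of $\mathsf E\sqcup\mathsf V$ (edges and roots), with the product topology and $\sigma$-algebra. Then: 1.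 There is a unique measure $\mathbb P^k$ on rooted spanning forests of $\mathsf G$, and it is a probability measure, such that for all $j,l\ge 0$, all distinct edges $e_1,\dots,e_j$ and all distinct vertices $x_1,\dots,x_l$ of $\mathsf G$, $$\mathbb P^k\bigl(e_1,\dots,e_j\text{ belong to the forest and }x_1,\dots,x_l\text{ are roots}\bigr)=\det\begin{pmatrix}(\mathsf H^k(e_a,e_b))_{a,b}&(\mathsf H^k(e_a,x_b))_{a,b}\\(\mathsf H^k(x_a,e_b))_{a,b}&(\mathsf H^k(x_a,x_b))_{a,b}\end{pmatrix}.$$ 2. For every exhaustion $(\mathsf G_n)$ of $\mathsf G$, i.e. every increasing sequence of finite subgraphs of $\mathsf G$ eventually containing each vertex and each edge of $\mathsf G$, let $\mathbb P^{k,(n)}$ be the Boltzmann probability measure on rooted spanning forests of $\mathsf G_n$, under which the probability of a forest is proportional to the product of $\rho(e)$ over its edges and of $m^2(x)$ over its roots ($\rho$ and $m^2$ being those of $\mathsf G$). Viewed as probability measures on subsets of $\mathsf E\sqcup\mathsf V$, the $\mathbb P^{k,(n)}$ converge weakly to $\mathbb P^k$. 3. $\mathbb P^k$-almost surely, all connected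 components of the rooted spanning forest are finite. -/

import Mathlib

/-! ### Elliptic integrals and Jacobi elliptic functions of a real argument -/

/-- Incomplete elliptic integral of the first kind of modulus `k`. -/
noncomputable def ellipticF (k φ : ℝ) : ℝ :=
  ∫ t in (0 : ℝ)..φ, 1 / Real.sqrt (1 - k ^ 2 * Real.sin t ^ 2)

/-- Complete elliptic integral of the first kind. -/
noncomputable def ellipticK (k : ℝ) : ℝ := ellipticF k (Real.pi / 2)

/-- Complete elliptic integral of the second kind. -/
noncomputable def ellipticE (k : ℝ) : ℝ :=
  ∫ t in (0 : ℝ)..(Real.pi / 2), Real.sqrt (1 - k ^ 2 * Real.sin t ^ 2)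

/-- Jacobi's amplitude `am(u|k)`, the inverse of the increasing bijection `φ ↦ F(k, φ)` of `ℝ`
(for `0 ≤ k < 1`). -/
noncomputable def jacobiAm (k u : ℝ) : ℝ := Function.invFun (ellipticF k) u

noncomputable def jacobiSn (k u : ℝ) : ℝ := Real.sin (jacobiAm k u)

noncomputable def jacobiCn (k u : ℝ) : ℝ := Real.cos (jacobiAm k u)

noncomputable def jacobiDn (k u : ℝ) : ℝ := Real.sqrt (1 - k ^ 2 * jacobiSn k u ^ 2)

noncomputable def jacobiSc (k u : ℝ) : ℝ := jacobiSn k u / jacobiCn k u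

noncomputable def jacobiDc (k u : ℝ) : ℝ := jacobiDn k u / jacobiCn k u

/-- `A(u|k) = (1/k') (∫₀ᵘ dc²(v|k) dv + ((E - K)/K) u)`, with `k' = √(1 - k²)`. -/
noncomputable def ellipticA (k u : ℝ) : ℝ :=
  1 / Real.sqrt (1 - k ^ 2) *
    ((∫ v in (0 : ℝ)..u, jacobiDc k v ^ 2) + (ellipticE k - ellipticK k) / ellipticK k * u)

/-! ### Isoradial graphs whose faces cover the plane -/

/-- The set drawn in the plane by the graph `G` with vertices placed at `pos` and straight edges. -/
def graphDrawing {V : Type*} (G : SimpleGraph V) (pos : V → ℂ) : Set ℂ :=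
  Set.range pos ∪ {z | ∃ x y, G.Adj x y ∧ z ∈ segment ℝ (pos x) (pos y)}

/-- The face containing the point `p` of the complement of the drawing: the connected component
of `p` in the complement. -/
def drawingFace {V : Type*} (G : SimpleGraph V) (pos : V → ℂ) (p : ℂ) : Set ℂ :=
  connectedComponentIn (graphDrawing G pos)ᶜ p

/-- An isoradial embedding of `G` whose faces cover the whole plane: a proper planar straight-line
embedding such that every face is (the interior of) a polygon inscribed in a circle of radius `1`
whose center lies in the interior of the face. In particular there is no unbounded face, so the
graph is infinite. (Faces being inscribed polygons, edges are straight and there are neither loops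
nor multiple edges.) -/
structure IsoradialEmbedding {V : Type*} (G : SimpleGraph V) where
  pos : V → ℂ
  pos_injective : Function.Injective pos
  /-- A bounded region contains finitely many vertices. -/
  finite_vertices : ∀ R : ℝ, {v : V | ‖pos v‖ ≤ R}.Finite
  /-- A bounded region meets finitely many edges. -/
  finite_edges : ∀ R : ℝ, {p : V × V | G.Adj p.1 p.2 ∧
    (segment ℝ (pos p.1) (pos p.2) ∩ Metric.closedBall 0 R).Nonempty}.Finite
  /-- Edges do not pass through vertices. -/
  vertex_notMem_edge : ∀ x y v : V, G.Adj x y → pos v ∉ openSegment ℝ (pos x) (pos y)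
  /-- Distinct edges do not cross. -/
  edges_disjoint : ∀ x y x' y' : V, G.Adj x y → G.Adj x' y' → s(x, y) ≠ s(x', y') →
    Disjoint (openSegment ℝ (pos x) (pos y)) (openSegment ℝ (pos x') (pos y'))
  /-- Every face is the interior of the convex polygon spanned by its boundary vertices, which are
  on a circle of radius `1` centered at a point of the face. -/
  face_inscribed : ∀ p ∉ graphDrawing G pos, ∃ c ∈ drawingFace G pos p,
    (∀ v : V, pos v ∈ closure (drawingFace G pos p) → dist (pos v) c = 1) ∧
    drawingFace G pos p =
      interior (convexHull ℝ (Set.range pos ∩ closure (drawingFace G pos p)))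

/-- An orientation of the edges of `G`: a choice, for every edge `e`, of an
initial vertex `e₋` and a final vertex `e₊`. -/
structure EdgeOrientation {V : Type*} (G : SimpleGraph V) where
  src : G.edgeSet → V
  tgt : G.edgeSet → V
  mk_src_tgt : ∀ e, s(src e, tgt e) = (e : Sym2 V)

/-- In a rhombus of side length `1` having the segment `x y` as a diagonal and `c` as one of the
two other vertices, the half-angle at `x` is `arccos (|x - y| / 2)`. -/
theorem rhombus_halfAngle_eq (x y c : ℂ) (hx : dist c x = 1) (hy : dist c y = 1) :
    EuclideanGeometry.angle c x y = Real.arccos (dist x y / 2) := by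
  have h1 : ‖c - x‖ = 1 := by rw [← dist_eq_norm]; exact hx
  have h2 : ‖c - y‖ = 1 := by rw [← dist_eq_norm]; exact hy
  have h3 : dist x y = ‖y - x‖ := by rw [dist_comm, dist_eq_norm]
  have h4 : ‖(c - x) - (y - x)‖ = 1 := by rw [sub_sub_sub_cancel_right]; exact h2
  have h5 := norm_sub_sq_real (c - x) (y - x)
  rw [h4, h1] at h5
  unfold EuclideanGeometry.angle InnerProductGeometry.angle
  simp only [vsub_eq_sub]
  rw [h3, h1]
  congr 1
  by_cases h : ‖y - x‖ = 0
  · simp [h]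
  · field_simp
    linarith

namespace IsoradialEmbedding

variable {V : Type*} {G : SimpleGraph V}

/-- The rhombus half-angle `θ̄` of the edge `x y`: the edge is a diagonal of the rhombus with side
length `1` formed by `x`, `y` and the circumcenters of the two faces adjacent to the edge, and
`θ̄` is the half-angle of this rhombus at `x` (see `rhombus_halfAngle_eq`). -/
noncomputable def halfAngle (S : IsoradialEmbedding G) (x y : V) : ℝ :=
  Real.arccos (dist (S.pos x) (S.pos y) / 2)

/-- The rescaled half-angle `θ = θ̄ · 2K/π`. -/
noncomputable def theta (S : IsoradialEmbedding G) (k : ℝ) (x y : V) : ℝ :=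
  S.halfAngle x y * (2 * ellipticK k / Real.pi)

/-- The conductance `ρ(xy) = sc(θ|k)`. -/
noncomputable def conductance (S : IsoradialEmbedding G) (k : ℝ) (x y : V) : ℝ :=
  jacobiSc k (S.theta k x y)

/-- The conductance of an unoriented edge. -/
noncomputable def edgeConductance (S : IsoradialEmbedding G) (k : ℝ) : Sym2 V → ℝ :=
  Sym2.lift ⟨fun x y => S.conductance k x y, fun x y => by
    simp only [conductance, theta, halfAngle, dist_comm]⟩

/-- The (squared) mass `m²(x) = ∑_{y ∼ x} (A(θ|k) - sc(θ|k))`; vertices have finite degree. -/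
noncomputable def mass (S : IsoradialEmbedding G) (k : ℝ) (x : V) : ℝ :=
  ∑ᶠ y ∈ G.neighborSet x, (ellipticA k (S.theta k x y) - S.conductance k x y)

/-- The massive Laplacian
`(Δ f)(x) = ∑_{y ∼ x} ρ(xy) (f(x) - f(y)) + m²(x) f(x)`. -/
noncomputable def massiveLaplacian (S : IsoradialEmbedding G) (k : ℝ) (f : V → ℝ) (x : V) : ℝ :=
  (∑ᶠ y ∈ G.neighborSet x, S.conductance k x y * (f x - f y)) + S.mass k x * f x

/-- `T` is the inverse of the massive Laplacian acting on `ℓ²(V)`: the Laplacian maps `ℓ²(V)` to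
itself, and the bounded operator `T` is a right and left inverse of it. -/
def IsGreenOperator (S : IsoradialEmbedding G) (k : ℝ)
    (T : lp (fun _ : V => ℝ) 2 →L[ℝ] lp (fun _ : V => ℝ) 2) : Prop :=
  (∀ f : lp (fun _ : V => ℝ) 2, S.massiveLaplacian k (T f : V → ℝ) = (f : V → ℝ)) ∧
  ∀ f : lp (fun _ : V => ℝ) 2,
    ∃ h : Memℓp (S.massiveLaplacian k (f : V → ℝ)) 2,
      T (⟨S.massiveLaplacian k (f : V → ℝ), h⟩ : lp (fun _ : V => ℝ) 2) = f

/-- The massive Green operator, i.e. the inverse of the massive Laplacian on `ℓ²(V)`. -/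
noncomputable def greenOperator (S : IsoradialEmbedding G) (k : ℝ) :
    lp (fun _ : V => ℝ) 2 →L[ℝ] lp (fun _ : V => ℝ) 2 :=
  Classical.epsilon (S.IsGreenOperator k)

open Classical in
/-- The massive Green function `G(x, y) = (Δ⁻¹ δ_y)(x)`. -/
noncomputable def green (S : IsoradialEmbedding G) (k : ℝ) (x y : V) : ℝ :=
  (S.greenOperator k (lp.single 2 y (1 : ℝ)) : V → ℝ) x

/-- The transfer impedance, on edges and vertices. -/
noncomputable def transferImpedance (S : IsoradialEmbedding G) (k : ℝ) (o : EdgeOrientation G) :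
    G.edgeSet ⊕ V → G.edgeSet ⊕ V → ℝ
  | .inl e, .inl e' => S.edgeConductance k e' *
      (S.green k (o.src e) (o.src e') - S.green k (o.tgt e) (o.src e')
        - S.green k (o.src e) (o.tgt e') + S.green k (o.tgt e) (o.tgt e'))
  | .inl e, .inr x => S.mass k x * (S.green k (o.src e) x - S.green k (o.tgt e) x)
  | .inr x, .inl e => S.edgeConductance k e * (S.green k x (o.src e) - S.green k x (o.tgt e))
  | .inr x, .inr x' => S.mass k x' * S.green k x x'

end IsoradialEmbedding

/-! ### Rooted spanning forests -/

/-- A configuration on `G`: a set of edges and a set of vertices (the roots), encoded by its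
indicator function. It carries the product topology and the product σ-algebra. -/
abbrev ForestConfig {V : Type*} (G : SimpleGraph V) : Type _ := G.edgeSet ⊕ V → Bool

/-- The spanning subgraph of `G` formed by the edges of the configuration. -/
def configGraph {V : Type*} {G : SimpleGraph V} (ω : ForestConfig G) : SimpleGraph V :=
  SimpleGraph.fromEdgeSet {e | ∃ h : e ∈ G.edgeSet, ω (.inl ⟨e, h⟩) = true}

/-- `ω` is a rooted spanning forest of the subgraph `H` of `G`: it consists of edges and vertices
of `H`, it has no cycle, and every connected component (of the subgraph with vertices those of `H`
and edges those of `ω`) contains exactly one root. -/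
def IsRootedSpanningForest {V : Type*} {G : SimpleGraph V} (H : G.Subgraph)
    (ω : ForestConfig G) : Prop :=
  (∀ e : G.edgeSet, ω (.inl e) = true → (e : Sym2 V) ∈ H.edgeSet) ∧
  (∀ x : V, ω (.inr x) = true → x ∈ H.verts) ∧
  (configGraph ω).IsAcyclic ∧
  ∀ x ∈ H.verts, ∃! r : V, (configGraph ω).Reachable x r ∧ ω (.inr r) = true

/-- The set of rooted spanning forests of `G`. -/
abbrev RootedSpanningForest {V : Type*} (G : SimpleGraph V) : Type _ :=
  {ω : ForestConfig G // IsRootedSpanningForest (⊤ : G.Subgraph) ω}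

namespace IsoradialEmbedding

variable {V : Type*} {G : SimpleGraph V}

/-- The Boltzmann weight: product of the conductances of the edges and of the masses of the
roots. -/
noncomputable def forestWeight (S : IsoradialEmbedding G) (k : ℝ) (ω : ForestConfig G) : ℝ :=
  (∏ᶠ e ∈ {e : G.edgeSet | ω (.inl e) = true}, S.edgeConductance k e) *
    ∏ᶠ x ∈ {x : V | ω (.inr x) = true}, S.mass k x

/-- The partition function of rooted spanning forests of a finite subgraph `H`. -/
noncomputable def forestPartition (S : IsoradialEmbedding G) (k : ℝ) (H : G.Subgraph) : ℝ :=
  ∑ᶠ ω ∈ {ω : ForestConfig G | IsRootedSpanningForest H ω}, S.forestWeight k ω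

/-- The Boltzmann measure on rooted spanning forests of a finite subgraph `H`, with the
conductances and masses of `G`; a forest of `H` is seen as a set of edges and vertices of `G`. -/
noncomputable def forestMeasure (S : IsoradialEmbedding G) (k : ℝ) (H : G.Subgraph) :
    MeasureTheory.Measure (ForestConfig G) :=
  MeasureTheory.Measure.sum fun ω : {ω : ForestConfig G // IsRootedSpanningForest H ω} =>
    ENNReal.ofReal (S.forestWeight k ω.1 / S.forestPartition k H) •
      MeasureTheory.Measure.dirac ω.1

/-- The edge/root marginals of `P` are given by determinants of the transfer impedance: the
probability that distinct edges `e₁, …, e_j` belong to the forest and that distinct vertices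
`x₁, …, x_l` are roots is the determinant of the corresponding block matrix. -/
def HasDeterminantalMarginals (S : IsoradialEmbedding G) (k : ℝ) (o : EdgeOrientation G)
    (P : MeasureTheory.Measure (RootedSpanningForest G)) : Prop :=
  ∀ (j l : ℕ) (e : Fin j → G.edgeSet) (x : Fin l → V),
    Function.Injective e → Function.Injective x →
    P.real {ω | (∀ i, ω.1 (.inl (e i)) = true) ∧ ∀ i, ω.1 (.inr (x i)) = true} =
      (Matrix.fromBlocks
        (Matrix.of fun a b => S.transferImpedance k o (.inl (e a)) (.inl (e b)))
        (Matrix.of fun a b => S.transferImpedance k o (.inl (e a)) (.inr (x b)))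
        (Matrix.of fun a b => S.transferImpedance k o (.inr (x a)) (.inl (e b)))
        (Matrix.of fun a b => S.transferImpedance k o (.inr (x a)) (.inr (x b)))).det

end IsoradialEmbedding

/-- An exhaustion of `G` by finite graphs: an increasing sequence of finite subgraphs which
eventually contain every vertex and every edge. -/
structure IsFiniteExhaustion {V : Type*} (G : SimpleGraph V) (H : ℕ → G.Subgraph) : Prop where
  monotone : Monotone H
  finite : ∀ n, (H n).verts.Finite
  exists_mem_verts : ∀ x : V, ∃ n, x ∈ (H n).verts
  exists_adj : ∀ x y : V, G.Adj x y → ∃ n, (H n).Adj x y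

/-! On a finite graph a rooted spanning forest is the same thing as a terminating partial self-map:
each vertex steps along an edge towards its root, and roots stop. Expanding the determinant of the
massive Laplacian multilinearly over the choice of a step in each row leaves exactly the terminating
choices (`det_directed_laplacian`), so this determinant is the partition function
(`det_forestLaplacian`). Rescaling the weights of chosen edges and roots adds to the Laplacian a
matrix factored through the incidence matrix of the chosen family. Comparing the two expressions of
the perturbed partition function turns the marginals into determinants of the finite Green function
(`finsum_forest_familyIndicator`).

Passing to the infinite graph needs uniform bounds (`exists_boundedWeights`). Degrees are bounded
because each edge at a vertex owns a distinct face on its left, and that face contains a disc of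
fixed radius near the vertex (`exists_degree_bound`). Masses are bounded below because `A - sc` is,
up to a positive factor, the integral of a density that changes sign at most once and has total
integral zero (`integral_massDensity_pos`). The Laplacian is then a multiple of the identity minus a
contraction, hence invertible on `ℓ²`. The difference between the finite and infinite Green
functions is massive harmonic away from the boundary of the subgraph, so it is exponentially small
deep inside (`BoundedWeights.abs_le_of_isDeep`), and the finite marginals converge.

Configurations form a compact space on which the determinants fix the probabilities of a generating
π-system. All limit points of Boltzmann measures therefore coincide, which gives existence,
uniqueness and convergence along every exhaustion (`exists_isDeterminantal`). It remains to see that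
the limit lives on forests with finite components. Cycles, and two roots in one component, are
excluded by clopen events that are null in finite volume. A root cannot escape to infinity: cutting
the path from a vertex to its root at its `i`-th step costs a bounded factor, so the length of the
path has a uniform exponential tail (`sum_notMem_reachWithin_le`). Finally, moving the root of a
component from `x` to `y` changes the weight by a bounded factor, which bounds the expected number
of vertices in the component rooted at `x` (`sum_reachable_root_le`). Borel–Cantelli then makes
components finite. -/

/-! ### Terminating partial self-maps and the directed matrix-forest theorem. -/

section DirectedForest

/-- A partial self-map all of whose trajectories end. -/
def IsTerminating {W : Type*} (f : W → Option W) : Prop :=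
  WellFounded fun y x => f x = some y

/-- The number of points strictly downstream of `x` works: it drops along each step because
well-foundedness keeps a point out of its own downstream set. -/
theorem IsTerminating.exists_height {W : Type*} [Finite W] {f : W → Option W}
    (hf : IsTerminating f) : ∃ h : W → ℕ, ∀ x y, f x = some y → h y < h x := by
  have hw := WellFounded.transGen hf
  refine ⟨fun x => {z | Relation.TransGen (fun y x => f x = some y) z x}.ncard, fun x y hxy => ?_⟩
  refine Set.ncard_lt_ncard ⟨fun z hz => Relation.TransGen.tail hz hxy, fun h => ?_⟩ (Set.toFinite _)
  have : Relation.TransGen (fun y x => f x = some y) y y := h (Relation.TransGen.single hxy)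
  exact hw.irrefl.irrefl _ this

theorem isTerminating_of_height {W : Type*} {f : W → Option W} (h : W → ℕ)
    (hh : ∀ x y, f x = some y → h y < h x) : IsTerminating f :=
  Subrelation.wf (fun {y x} hxy => hh x y hxy) (InvImage.wf h Nat.lt_wfRel.wf)

variable {W : Type*} [Fintype W] [DecidableEq W]

/-- The row of `1 - P` corresponding to a step from `x` to `o`. -/
def stepRow (x : W) (o : Option W) (y : W) : ℝ :=
  (if x = y then 1 else 0) - if o = some y then 1 else 0

/-- Sorting the points by height makes the matrix triangular, and the blocks of equal height are
identity matrices. -/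
theorem det_stepRow_of_isTerminating {f : W → Option W} (hf : IsTerminating f) :
    (Matrix.of fun x y => stepRow x (f x) y).det = 1 := by
  obtain ⟨h, hh⟩ := hf.exists_height
  have hne : ∀ x, f x ≠ some x := fun x hx => lt_irrefl _ (hh x x hx)
  have hb : (Matrix.of fun x y => stepRow x (f x) y).BlockTriangular (OrderDual.toDual ∘ h) := by
    intro x y hxy
    have hxy' : h x < h y := hxy
    have h1 : x ≠ y := by rintro rfl; exact lt_irrefl _ hxy'
    have h2 : f x ≠ some y := fun h' => lt_asymm hxy' (hh _ _ h')
    simp [stepRow, h1, h2]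
  rw [hb.det]
  refine Finset.prod_eq_one fun a _ => ?_
  convert Matrix.det_one (n := {i // (OrderDual.toDual ∘ h) i = a})
  ext x y
  have h2 : f x.1 ≠ some y.1 := fun h' => by
    have := hh _ _ h'
    have e1 := x.2; have e2 := y.2
    simp only [Function.comp] at e1 e2
    have : h x.1 = h y.1 := OrderDual.toDual.injective (e1.trans e2.symm)
    omega
  simp [Matrix.toSquareBlock, Matrix.toSquareBlockProp, stepRow, h2, Matrix.one_apply, Subtype.ext_iff]

/-- The indicator of the points whose trajectory never ends is constant along steps and vanishes at
points that stop, so it is a nonzero vector of the kernel. -/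
theorem det_stepRow_of_not_isTerminating {f : W → Option W} (hf : ¬ IsTerminating f) :
    (Matrix.of fun x y => stepRow x (f x) y).det = 0 := by
  classical
  rw [← Matrix.exists_mulVec_eq_zero_iff]
  refine ⟨fun x => if Acc (fun y x => f x = some y) x then 0 else 1, fun h0 => hf ⟨fun x => ?_⟩, ?_⟩
  · have := congrFun h0 x
    by_contra hx
    simp [hx] at this
  · ext x
    simp only [Matrix.mulVec, dotProduct, Matrix.of_apply, stepRow, sub_mul, ite_mul, one_mul,
      zero_mul, Finset.sum_sub_distrib, Finset.sum_ite_eq, Finset.mem_univ, if_true, Pi.zero_apply]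
    rcases hx : f x with _ | y
    · have : Acc (fun y x => f x = some y) x := ⟨_, fun y hy => by simp [hx] at hy⟩
      simp [this]
    · have : Acc (fun y x => f x = some y) x ↔ Acc (fun y x => f x = some y) y :=
        ⟨fun h => h.inv hx, fun h => ⟨_, fun z hz => by
          rw [hx, Option.some.injEq] at hz; exact hz ▸ h⟩⟩
      simp [this]

open Classical in
/-- **Directed matrix-forest theorem.** -/
theorem det_directed_laplacian (a : W → Option W → ℝ) :
    (Matrix.of fun x y => (if x = y then ∑ o, a x o else 0) - a x (some y)).det =
      ∑ f : W → Option W, if IsTerminating f then ∏ x, a x (f x) else 0 := by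
  -- Each row is a combination of step rows, so multilinearity expands the determinant into a sum
  -- over all maps `f`.
  have h1 : (Matrix.of fun x y => (if x = y then ∑ o, a x o else 0) - a x (some y)) =
      fun x => ∑ o, a x o • stepRow x o := by
    ext x y
    simp only [Matrix.of_apply, Finset.sum_apply, Pi.smul_apply, smul_eq_mul, stepRow, mul_sub,
      Finset.sum_sub_distrib, mul_ite, mul_one, mul_zero, Finset.sum_ite_eq', Finset.mem_univ]
    congr 1
    split_ifs <;> simp
  have h2 := (Matrix.detRowAlternating (n := W) (R := ℝ)).toMultilinearMap.map_sum
    (g := fun x (o : Option W) => a x o • stepRow x o)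
  have h3 : ∀ M : Matrix W W ℝ, (Matrix.detRowAlternating (n := W) (R := ℝ)).toMultilinearMap M
    = M.det := fun M => rfl
  rw [h1]
  refine (h3 _).symm.trans (h2.trans (Finset.sum_congr rfl fun f _ => ?_))
  rw [MultilinearMap.map_smul_univ]
  have h4 := h3 (Matrix.of fun x y => stepRow x (f x) y)
  split_ifs with hf
  · rw [det_stepRow_of_isTerminating hf] at h4
    rw [smul_eq_mul]
    exact (congrArg _ h4).trans (mul_one _)
  · rw [det_stepRow_of_not_isTerminating hf] at h4
    rw [smul_eq_mul]
    exact (congrArg _ h4).trans (mul_zero _)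

end DirectedForest

/-! ### The bijection between forest maps and rooted spanning forests. -/

section ForestMaps

/-- At a highest vertex of a cycle both cycle edges must go down. As only one downward edge leaves a
vertex, the two neighbours on the cycle coincide, which is impossible. -/
theorem SimpleGraph.isAcyclic_of_height {V : Type*} {K : SimpleGraph V} (S : V → V → Prop)
    (h : V → ℕ) (hK : ∀ u v, K.Adj u v → S u v ∨ S v u) (hS : ∀ u v, S u v → h v < h u)
    (hfun : ∀ u v w, S u v → S u w → v = w) : K.IsAcyclic := by
  classical
  intro v c hc
  obtain ⟨u, hu, hmax⟩ := Finset.exists_max_image c.support.toFinset h ⟨v, by simp⟩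
  have hu' : u ∈ c.support := by simpa using hu
  have hc' := (SimpleGraph.Walk.isCycle_rotate hu').2 hc
  set c' := c.rotate u hu' with hcdef
  have hmax' : ∀ w ∈ c'.support, h w ≤ h u := fun w hw => hmax w (by
    rw [List.mem_toFinset]
    exact (SimpleGraph.Walk.mem_support_rotate_iff c u hu').1 hw)
  have key : ∀ w ∈ c'.support, K.Adj u w → S u w := fun w hw hadj =>
    (hK u w hadj).resolve_right fun h' => absurd (hS _ _ h') (not_lt.2 (hmax' w hw))
  have hnil := hc'.not_nil
  have h1 := key _ (c'.getVert_mem_support 1) (c'.adj_snd hnil)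
  have h2 := key _ (c'.getVert_mem_support _) (c'.adj_penultimate hnil).symm
  exact hc'.snd_ne_penultimate (hfun _ _ _ h1 h2)

variable {V : Type*} {G : SimpleGraph V} {H : G.Subgraph}

open Classical in
/-- The configuration whose edges are the steps `x — f x` and whose roots are the points where `f`
stops. -/
noncomputable def mapConfig (f : H.verts → Option H.verts) : ForestConfig G
  | .inl e => decide (∃ x y : H.verts, f x = some y ∧ (e : Sym2 V) = s((x : V), (y : V)))
  | .inr v => decide (∃ x : H.verts, (x : V) = v ∧ f x = none)

/-- Terminating partial self-maps which move along edges of `H`. -/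
def IsForestMap (f : H.verts → Option H.verts) : Prop :=
  IsTerminating f ∧ ∀ x y : H.verts, f x = some y → H.Adj x y

/-- `f` makes a step from `u` to `v`. -/
def mapStep (f : H.verts → Option H.verts) (u v : V) : Prop :=
  ∃ x y : H.verts, (x : V) = u ∧ (y : V) = v ∧ f x = some y

theorem mapStep_functional (f : H.verts → Option H.verts) (u v w : V) (h1 : mapStep f u v)
    (h2 : mapStep f u w) : v = w := by
  obtain ⟨x, y, rfl, rfl, h⟩ := h1
  obtain ⟨x', y', hx, rfl, h'⟩ := h2
  obtain rfl := Subtype.ext hx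
  rw [h, Option.some.injEq] at h'
  rw [h']

theorem mapConfig_inr (f : H.verts → Option H.verts) (x : H.verts) :
    mapConfig f (.inr (x : V)) = true ↔ f x = none := by
  simp only [mapConfig, decide_eq_true_eq]
  constructor
  · rintro ⟨x', hx, h⟩
    rwa [← Subtype.ext hx]
  · exact fun h => ⟨x, rfl, h⟩

theorem configGraph_adj {ω : ForestConfig G} {u v : V} :
    (configGraph ω).Adj u v ↔ ∃ h : G.Adj u v, ω (.inl ⟨s(u, v), h⟩) = true := by
  simp only [configGraph, SimpleGraph.fromEdgeSet_adj, Set.mem_ofPred_eq]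
  constructor
  · rintro ⟨⟨h, h'⟩, -⟩; exact ⟨h, h'⟩
  · rintro ⟨h, h'⟩; exact ⟨⟨h, h'⟩, h.ne⟩

theorem configGraph_mapConfig_adj {f : H.verts → Option H.verts} (hf : IsForestMap f) {u v : V} :
    (configGraph (mapConfig f)).Adj u v ↔ mapStep f u v ∨ mapStep f v u := by
  rw [configGraph_adj]
  simp only [mapConfig, decide_eq_true_eq, mapStep]
  constructor
  · rintro ⟨h, x, y, hxy, he⟩
    rcases Sym2.eq_iff.1 he with ⟨rfl, rfl⟩ | ⟨rfl, rfl⟩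
    · exact Or.inl ⟨x, y, rfl, rfl, hxy⟩
    · exact Or.inr ⟨x, y, rfl, rfl, hxy⟩
  · rintro (⟨x, y, rfl, rfl, hxy⟩ | ⟨x, y, rfl, rfl, hxy⟩)
    · exact ⟨(hf.2 x y hxy).adj_sub, x, y, hxy, rfl⟩
    · exact ⟨(hf.2 x y hxy).adj_sub.symm, x, y, hxy, Sym2.eq_swap⟩

theorem exists_height_mapStep [Finite H.verts] {f : H.verts → Option H.verts}
    (hf : IsTerminating f) :
    ∃ h : V → ℕ, ∀ u v, mapStep f u v → h v < h u := by
  classical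
  obtain ⟨h, hh⟩ := hf.exists_height
  refine ⟨fun v => if hv : v ∈ H.verts then h ⟨v, hv⟩ else 0, ?_⟩
  rintro _ _ ⟨x, y, rfl, rfl, hxy⟩
  simpa using hh x y hxy

theorem exists_root_reachable {f : H.verts → Option H.verts} (hf : IsForestMap f) (x : H.verts) :
    ∃ r : H.verts, (configGraph (mapConfig f)).Reachable x r ∧ f r = none := by
  induction x using hf.1.induction with
  | _ x ih =>
    rcases hx : f x with _ | y
    · exact ⟨x, SimpleGraph.Reachable.refl _, hx⟩
    · obtain ⟨r, hr, hr'⟩ := ih y hx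
      exact ⟨r, (SimpleGraph.Adj.reachable
        ((configGraph_mapConfig_adj hf).2 (Or.inl ⟨x, y, rfl, rfl, hx⟩))).trans hr, hr'⟩

theorem mapConfig_isRootedSpanningForest [Finite H.verts] {f : H.verts → Option H.verts}
    (hf : IsForestMap f) : IsRootedSpanningForest H (mapConfig f) := by
  refine ⟨?_, ?_, ?_, ?_⟩
  · intro e he
    simp only [mapConfig, decide_eq_true_eq] at he
    obtain ⟨x, y, hxy, he⟩ := he
    rw [he]
    exact hf.2 x y hxy
  · intro v hv
    simp only [mapConfig, decide_eq_true_eq] at hv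
    obtain ⟨x, rfl, -⟩ := hv
    exact x.2
  · obtain ⟨h, hh⟩ := exists_height_mapStep hf.1
    exact SimpleGraph.isAcyclic_of_height (mapStep f) h
      (fun u v huv => (configGraph_mapConfig_adj hf).1 huv) hh (mapStep_functional f)
  · intro x hx
    obtain ⟨r, hr, hr'⟩ := exists_root_reachable hf ⟨x, hx⟩
    refine ⟨r, ⟨hr, (mapConfig_inr f r).2 hr'⟩, ?_⟩
    rintro r₂ ⟨h2, h2'⟩
    have hroot : ∀ v, mapConfig f (.inr v) = true → ∀ w, ¬ mapStep f v w := by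
      rintro _ hv w ⟨x, y, rfl, rfl, hxy⟩
      rw [mapConfig_inr] at hv
      simp [hv] at hxy
    -- Uniqueness of the root: flowing to a fixed root `r₀` is preserved across every edge,
    -- whichever way the edge is stepped over. Hence it holds throughout the component, and a second
    -- root, which cannot move, must equal `r₀`.
    have key : ∀ {u v : V} (p : (configGraph (mapConfig f)).Walk u v) (r₀ : V),
        mapConfig f (.inr r₀) = true → Relation.ReflTransGen (mapStep f) u r₀ →
        Relation.ReflTransGen (mapStep f) v r₀ := by
      intro u v p
      induction p with
      | nil => exact fun _ _ h => h
      | cons hadj p ih =>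
        intro r₀ hr₀ h
        apply ih r₀ hr₀
        rcases (configGraph_mapConfig_adj hf).1 hadj with hs | hs
        · rcases Relation.ReflTransGen.cases_head h with rfl | ⟨w, hw, hw'⟩
          · exact absurd hs (hroot _ hr₀ _)
          · rwa [mapStep_functional f _ _ _ hs hw]
        · exact Relation.ReflTransGen.head hs h
    obtain ⟨p⟩ := hr.symm.trans h2
    have h3 := key p r ((mapConfig_inr f r).2 hr') Relation.ReflTransGen.refl
    rcases Relation.ReflTransGen.cases_head h3 with h | ⟨w, hw, -⟩
    · exact h
    · exact absurd hw (hroot _ h2' _)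

/-- The roots tell where the map stops. Elsewhere, by induction along `f`, the edge from `x` to `f
x` cannot be traversed backwards by `f'`, since `f` and `f'` already agree at `f x` and `f` would
have a 2-cycle. -/
theorem mapConfig_injOn : Set.InjOn mapConfig {f : H.verts → Option H.verts | IsForestMap f} := by
  intro f hf f' hf' heq
  have hroot : ∀ x, f x = none ↔ f' x = none := fun x => by
    rw [← mapConfig_inr, ← mapConfig_inr, heq]
  ext1 x
  induction x using hf.1.induction with
  | _ x ih =>
    rcases hx : f x with _ | y
    · exact ((hroot x).1 hx).symm
    · have h1 : (configGraph (mapConfig f')).Adj x y := by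
        rw [← heq]
        exact (configGraph_mapConfig_adj hf).2 (Or.inl ⟨x, y, rfl, rfl, hx⟩)
      rcases (configGraph_mapConfig_adj hf').1 h1 with ⟨a, b, ha, hb, hab⟩ | ⟨a, b, ha, hb, hab⟩
      · obtain rfl := Subtype.ext ha
        obtain rfl := Subtype.ext hb
        exact hab.symm
      · obtain rfl := Subtype.ext ha
        obtain rfl := Subtype.ext hb
        have := ih a hx
        rw [hab] at this
        exact absurd hx (fun hx => hf.1.asymmetric _ _ hx this)

/-- Let each non-root move to the next vertex of a shortest path to its root; the distance to the
root is then a height. That every edge of the forest is used comes from acyclicity. -/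
theorem exists_mapConfig_eq {ω : ForestConfig G} (hω : IsRootedSpanningForest H ω) :
    ∃ f : H.verts → Option H.verts, IsForestMap f ∧ mapConfig f = ω := by
  classical
  obtain ⟨he, hv, hac, hr⟩ := hω
  choose! r hr1 hr2 using hr
  have hadjH : ∀ u v, (configGraph ω).Adj u v → H.Adj u v := fun u v h => by
    obtain ⟨h1, h2⟩ := configGraph_adj.1 h
    exact he _ h2
  have hstep : ∀ x : H.verts, ∃ o : Option H.verts, (o = none ↔ ω (.inr (x : V)) = true) ∧
      ∀ y, o = some y → (configGraph ω).Adj x y ∧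
        (configGraph ω).dist y (r y) < (configGraph ω).dist x (r x) := by
    intro x
    by_cases hx : ω (.inr (x : V)) = true
    · exact ⟨none, by simp [hx], by simp⟩
    · have hxr : (x : V) ≠ r x := fun h => hx (h ▸ (hr1 x x.2).2)
      obtain ⟨p, hp⟩ := (hr1 x x.2).1.exists_walk_length_eq_dist
      obtain ⟨y, hadj, q, hq⟩ : ∃ y, ∃ _ : (configGraph ω).Adj x y,
          ∃ q : (configGraph ω).Walk y (r x), q.length + 1 = p.length := by
        generalize r (x : V) = r₀ at p hxr
        cases p with
        | nil => exact absurd rfl hxr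
        | @cons _ y _ hadj q => exact ⟨y, hadj, q, rfl⟩
      · 
        have hy : y ∈ H.verts := (hadjH _ _ hadj).snd_mem
        have hry : r x = r y := hr2 y hy _ ⟨⟨q⟩, (hr1 x x.2).2⟩
        refine ⟨some ⟨y, hy⟩, by simp [hx], ?_⟩
        rintro _ ⟨⟩
        refine ⟨hadj, ?_⟩
        simp only
        rw [← hry, ← hp, ← hq]
        exact Nat.lt_succ_of_le (SimpleGraph.dist_le q)
  choose f hf1 hf2 using hstep
  have hf : IsForestMap f :=
    ⟨isTerminating_of_height (fun x => (configGraph ω).dist x (r x)) fun x y h => (hf2 x y h).2,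
      fun x y h => hadjH _ _ (hf2 x y h).1⟩
  refine ⟨f, hf, funext ?_⟩
  have hle : ∀ u v, mapStep f u v → (configGraph ω).Adj u v := by
    rintro _ _ ⟨x, y, rfl, rfl, h⟩
    exact (hf2 x y h).1
  rintro (e | v)
  · rw [Bool.eq_iff_iff]
    constructor
    · intro h
      simp only [mapConfig, decide_eq_true_eq] at h
      obtain ⟨x, y, hxy, hee⟩ := h
      obtain ⟨h1, h2⟩ := configGraph_adj.1 (hf2 x y hxy).1
      rw [← h2]
      congr 2
      exact Subtype.ext hee
    · obtain ⟨e, hedge⟩ := e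
      induction e with
      | _ u v =>
        intro h
        have hadj : (configGraph ω).Adj u v := configGraph_adj.2 ⟨hedge, h⟩
        by_contra hcon
        have hnot : ¬ (configGraph (mapConfig f)).Adj u v := fun h' => hcon (configGraph_adj.1 h').2
        -- An unused edge `uv` is a bridge of the forest, yet the steps of `f` alone already join
        -- `u` and `v` to their common root.
        have hb := (SimpleGraph.isAcyclic_iff_forall_adj_isBridge.1 hac) hadj
        rw [SimpleGraph.isBridge_iff] at hb
        have hle' : configGraph (mapConfig f) ≤
            configGraph ω \ SimpleGraph.fromEdgeSet {s(u, v)} := by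
          intro a b hab
          rw [SimpleGraph.sdiff_adj, SimpleGraph.fromEdgeSet_adj]
          refine ⟨?_, ?_⟩
          · rcases (configGraph_mapConfig_adj hf).1 hab with h | h
            · exact hle _ _ h
            · exact (hle _ _ h).symm
          · rintro ⟨h, -⟩
            rcases Sym2.eq_iff.1 h with ⟨rfl, rfl⟩ | ⟨rfl, rfl⟩
            · exact hnot hab
            · exact hnot hab.symm
        have hH := hadjH _ _ hadj
        obtain ⟨r₁, h1, h1'⟩ := exists_root_reachable hf ⟨u, hH.fst_mem⟩
        obtain ⟨r₂, h2, h2'⟩ := exists_root_reachable hf ⟨v, hH.snd_mem⟩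
        have e1 : (configGraph (mapConfig f)) ≤ configGraph ω := hle'.trans sdiff_le
        have e2 : (r₁ : V) = r u := hr2 u hH.fst_mem _ ⟨h1.mono e1, (hf1 r₁).1 h1'⟩
        have e3 : (r₂ : V) = r u := hr2 u hH.fst_mem _
          ⟨hadj.reachable.trans (h2.mono e1), (hf1 r₂).1 h2'⟩
        rw [e2] at h1
        rw [e3] at h2
        exact hb ((h1.trans h2.symm).mono hle')
  · rw [Bool.eq_iff_iff]
    constructor
    · intro h
      simp only [mapConfig, decide_eq_true_eq] at h
      obtain ⟨x, rfl, hx⟩ := h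
      exact (hf1 x).1 hx
    · intro h
      exact (mapConfig_inr f ⟨v, hv v h⟩).2 ((hf1 _).2 h)

theorem mapConfig_bijOn [Finite H.verts] :
    Set.BijOn mapConfig {f : H.verts → Option H.verts | IsForestMap f}
      {ω : ForestConfig G | IsRootedSpanningForest H ω} :=
  ⟨fun _ hf => mapConfig_isRootedSpanningForest hf, mapConfig_injOn,
    fun _ hω => exists_mapConfig_eq hω⟩

end ForestMaps

/-! ### Weights of forests and the massive matrix-tree theorem. -/

section ForestWeights

variable {V : Type*} {G : SimpleGraph V}

/-- The product of the weights of the edges and of the roots of a configuration. -/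
noncomputable def configWeight (ρ : Sym2 V → ℝ) (m : V → ℝ) (ω : ForestConfig G) : ℝ :=
  (∏ᶠ e ∈ {e : G.edgeSet | ω (.inl e) = true}, ρ e) * ∏ᶠ x ∈ {x : V | ω (.inr x) = true}, m x

variable (H : G.Subgraph)

open Classical in
/-- The weight of a step from `x` to `o`, where `none` stands for stopping. -/
noncomputable def stepWeight (ρ : Sym2 V → ℝ) (m : V → ℝ) (x : H.verts) : Option H.verts → ℝ
  | none => m x
  | some y => if H.Adj x y then ρ s((x : V), (y : V)) else 0

variable {H}

theorem finite_edges_of_forest [Finite H.verts] {ω : ForestConfig G}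
    (hω : IsRootedSpanningForest H ω) : {e : G.edgeSet | ω (.inl e) = true}.Finite := by
  have h1 : (Set.range fun p : H.verts × H.verts => s((p.1 : V), (p.2 : V))).Finite :=
    Set.finite_range _
  refine (h1.preimage (f := fun e : G.edgeSet => (e : Sym2 V))
    Subtype.val_injective.injOn).subset ?_
  rintro ⟨e, he⟩ hee
  have := hω.1 _ hee
  induction e with
  | _ u v =>
    have hadj : H.Adj u v := this
    exact ⟨(⟨u, hadj.fst_mem⟩, ⟨v, hadj.snd_mem⟩), rfl⟩

theorem finite_roots_of_forest [Finite H.verts] {ω : ForestConfig G}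
    (hω : IsRootedSpanningForest H ω) : {x : V | ω (.inr x) = true}.Finite :=
  (Set.toFinite H.verts).subset fun _ hx => hω.2.1 _ hx

/-- Every edge of the configuration is stepped over exactly once: two opposite steps over one edge
would form a 2-cycle of a terminating map. Moving vertices thus index the edges, and stopping
vertices the roots. -/
theorem configWeight_mapConfig [Fintype H.verts] (ρ : Sym2 V → ℝ) (m : V → ℝ)
    {f : H.verts → Option H.verts} (hf : IsForestMap f) :
    configWeight ρ m (mapConfig f) = ∏ x, stepWeight H ρ m x (f x) := by
  classical
  have h1 : ∏ᶠ e ∈ {e : G.edgeSet | mapConfig f (.inl e) = true}, ρ e =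
      ∏ᶠ x ∈ {x : H.verts | ∃ y, f x = some y}, stepWeight H ρ m x (f x) := by
    rw [← finprod_set_coe_eq_finprod_mem, ← finprod_set_coe_eq_finprod_mem]
    symm
    refine finprod_eq_of_bijective
      (fun x : {x : H.verts | ∃ y, f x = some y} =>
        (⟨⟨s((x : V), (x.2.choose : V)), (hf.2 _ _ x.2.choose_spec).adj_sub⟩, by
          simp only [Set.mem_ofPred_eq, mapConfig, decide_eq_true_eq]
          exact ⟨_, _, x.2.choose_spec, rfl⟩⟩ :
          {e : G.edgeSet | mapConfig f (.inl e) = true})) ⟨?_, ?_⟩ ?_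
    · intro x x' hxx
      have h2 : s((x : V), (x.2.choose : V)) = s((x' : V), (x'.2.choose : V)) := by
        simpa using congrArg (fun e => ((e : G.edgeSet) : Sym2 V)) (congrArg Subtype.val hxx)
      rcases Sym2.eq_iff.1 h2 with ⟨h3, -⟩ | ⟨h3, h4⟩
      · exact Subtype.ext (Subtype.ext h3)
      · exfalso
        have h5 : f x'.1 = some x.1 := by
          rw [x'.2.choose_spec, Subtype.ext h3]
        have h6 : f x.1 = some x'.1 := by
          rw [x.2.choose_spec, Subtype.ext h4]
        exact hf.1.asymmetric _ _ h5 h6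
    · rintro ⟨⟨e, he⟩, hee⟩
      have h2 := hee
      simp only [Set.mem_ofPred_eq, mapConfig, decide_eq_true_eq] at h2
      obtain ⟨x, y, hxy, h3⟩ := h2
      have hx : ∃ y, f x = some y := ⟨y, hxy⟩
      refine ⟨⟨x, hx⟩, ?_⟩
      have h4 : hx.choose = y := by
        exact Option.some_injective _ (hx.choose_spec.symm.trans hxy)
      refine Subtype.ext (Subtype.ext ?_)
      simp only [h4, h3]
    · rintro ⟨x, hx⟩
      simp only
      conv_lhs => rw [hx.choose_spec]
      simp only [stepWeight]
      rw [if_pos (hf.2 _ _ hx.choose_spec)]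
  have h2 : ∏ᶠ x ∈ {x : V | mapConfig f (.inr x) = true}, m x =
      ∏ᶠ x ∈ {x : H.verts | ∃ y, f x = some y}ᶜ, stepWeight H ρ m x (f x) := by
    symm
    have hnone : ∀ x : H.verts, x ∈ {x : H.verts | ∃ y, f x = some y}ᶜ ↔ f x = none := fun x => by
      rcases hx : f x <;> simp [hx]
    refine finprod_mem_eq_of_bijOn (fun x : H.verts => (x : V))
      ⟨fun x hx => (mapConfig_inr f x).2 ((hnone x).1 hx), Subtype.val_injective.injOn, ?_⟩ ?_
    · intro v hv
      have h3 := hv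
      simp only [Set.mem_ofPred_eq, mapConfig, decide_eq_true_eq] at h3
      obtain ⟨x, rfl, hx⟩ := h3
      exact ⟨x, (hnone x).2 hx, rfl⟩
    · intro x hx
      rw [(hnone x).1 hx]
      rfl
  rw [configWeight, h1, h2, ← finprod_mem_union disjoint_compl_right (Set.toFinite _)
    (Set.toFinite _), Set.union_compl_self, finprod_mem_univ, finprod_eq_prod_of_fintype]

open Classical in
theorem finsum_forest [Finite H.verts] [Fintype (H.verts → Option H.verts)] (F : ForestConfig G → ℝ) :
    ∑ᶠ ω ∈ {ω : ForestConfig G | IsRootedSpanningForest H ω}, F ω =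
      ∑ f : H.verts → Option H.verts, if IsForestMap f then F (mapConfig f) else 0 := by
  rw [← finsum_mem_eq_of_bijOn mapConfig mapConfig_bijOn (fun f _ => rfl), ← Finset.sum_filter,
    ← finsum_mem_finset_eq_sum]
  simp

theorem finite_forests [Finite H.verts] :
    {ω : ForestConfig G | IsRootedSpanningForest H ω}.Finite := by
  rw [← mapConfig_bijOn.image_eq]
  exact (Set.toFinite _).image _

variable (H)

open Classical in
/-- The massive Laplacian matrix of `H`, as a linear function of the conductances and masses. -/
noncomputable def forestLaplacian [Fintype H.verts] :
    ((Sym2 V → ℝ) × (V → ℝ)) →ₗ[ℝ] Matrix H.verts H.verts ℝ where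
  toFun w := Matrix.of fun x y =>
    (if x = y then (∑ z : H.verts, if H.Adj x z then w.1 s((x : V), (z : V)) else 0) + w.2 x else 0)
      - if H.Adj x y then w.1 s((x : V), (y : V)) else 0
  map_add' w w' := by
    ext x y
    simp only [Matrix.of_apply, Matrix.add_apply, Prod.fst_add, Prod.snd_add, Pi.add_apply,
      ← Finset.sum_filter, Finset.sum_add_distrib]
    split_ifs <;> ring
  map_smul' c w := by
    ext x y
    simp only [Matrix.of_apply, Matrix.smul_apply, Prod.smul_fst, Prod.smul_snd, Pi.smul_apply,
      ← Finset.sum_filter, smul_eq_mul, ← Finset.mul_sum, RingHom.id_apply]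
    split_ifs <;> ring

/-- In the directed theorem a step between vertices not adjacent in `H` has weight zero, so among
the terminating maps only the forest maps contribute. -/
theorem det_forestLaplacian [Fintype H.verts] [DecidableEq H.verts] (ρ : Sym2 V → ℝ) (m : V → ℝ) :
    (forestLaplacian H (ρ, m)).det =
      ∑ᶠ ω ∈ {ω : ForestConfig G | IsRootedSpanningForest H ω}, configWeight ρ m ω := by
  classical
  have h1 : forestLaplacian H (ρ, m) = Matrix.of fun x y =>
      (if x = y then ∑ o, stepWeight H ρ m x o else 0) - stepWeight H ρ m x (some y) := by
    ext x y
    simp [forestLaplacian, stepWeight, Fintype.sum_option, add_comm]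
  rw [h1, det_directed_laplacian, finsum_forest]
  refine Finset.sum_congr rfl fun f _ => ?_
  by_cases hf : IsForestMap f
  · rw [if_pos hf, if_pos hf.1, configWeight_mapConfig ρ m hf]
  · rw [if_neg hf]
    split_ifs with ht
    · have : ∃ x y, f x = some y ∧ ¬ H.Adj x y := by
        by_contra hcon
        push Not at hcon
        exact hf ⟨ht, hcon⟩
      obtain ⟨x, y, hxy, hn⟩ := this
      refine Finset.prod_eq_zero (Finset.mem_univ x) ?_
      rw [hxy, stepWeight, if_neg hn]
    · rfl

theorem finprod_mem_one_add_indicator {α ι : Type*} [Fintype ι] {S : Set α} (hS : S.Finite)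
    (a : ι → α) (ha : Function.Injective a) (c : ℝ) [DecidableEq α] [DecidablePred (· ∈ S)] :
    ∏ᶠ x ∈ S, (1 + c * ∑ i, if a i = x then 1 else 0) =
      ∏ i, (1 + c * if a i ∈ S then 1 else 0) := by
  classical
  rw [finprod_mem_eq_finite_toFinset_prod _ hS]
  have h1 : ∀ x, (1 + c * ∑ i, if a i = x then (1 : ℝ) else 0) =
      if x ∈ Finset.univ.image a then 1 + c else 1 := by
    intro x
    split_ifs with hx
    · obtain ⟨i, -, rfl⟩ := Finset.mem_image.1 hx
      simp [ha.eq_iff]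
    · have : ∀ i, a i ≠ x := fun i hi => hx (Finset.mem_image.2 ⟨i, Finset.mem_univ _, hi⟩)
      simp [this]
  have h2 : ∀ i, (1 + c * if a i ∈ S then (1 : ℝ) else 0) = if a i ∈ S then 1 + c else 1 := by
    intro i; split_ifs <;> simp
  simp only [h1, h2]
  rw [← Finset.prod_filter, ← Finset.prod_filter]
  have h3 : (hS.toFinset.filter (· ∈ Finset.univ.image a)) =
      (Finset.univ.filter (fun i => a i ∈ S)).image a := by
    ext x; simp only [Finset.mem_filter, Set.Finite.mem_toFinset, Finset.mem_image,
      Finset.mem_univ, true_and]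
    constructor
    · rintro ⟨hx, i, rfl⟩; exact ⟨i, hx, rfl⟩
    · rintro ⟨i, hi, rfl⟩; exact ⟨hi, i, rfl⟩
  rw [h3, Finset.prod_image ha.injOn]

/-! ### Finite-volume marginals, by perturbing the weights. -/

section Marginals

variable {ι₁ ι₂ : Type*} [Fintype ι₁] [Fintype ι₂]
  (e : ι₁ → G.edgeSet) (x : ι₂ → V)

open Classical in
/-- The incidence matrix of a family of oriented edges and of vertices. -/
noncomputable def incidence (o : EdgeOrientation G) (a : ι₁ ⊕ ι₂) (v : V) : ℝ :=
  match a with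
  | .inl i => (if o.src (e i) = v then 1 else 0) - if o.tgt (e i) = v then 1 else 0
  | .inr i => if x i = v then 1 else 0

/-- The weights of a family of edges and of vertices. -/
def familyWeight (ρ : Sym2 V → ℝ) (m : V → ℝ) (a : ι₁ ⊕ ι₂) : ℝ :=
  match a with
  | .inl i => ρ (e i)
  | .inr i => m (x i)

open Classical in
/-- `1` if the `a`-th edge or root belongs to `ω`, and `0` otherwise. -/
noncomputable def familyIndicator (ω : ForestConfig G) (a : ι₁ ⊕ ι₂) : ℝ :=
  match a with
  | .inl i => if ω (.inl (e i)) = true then 1 else 0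
  | .inr i => if ω (.inr (x i)) = true then 1 else 0

open Classical in
/-- The weights of a family of edges are multiplied by `1 + c`. -/
noncomputable def perturbedEdge (ρ : Sym2 V → ℝ) (c : ℝ) (b : Sym2 V) : ℝ :=
  ρ b * (1 + c * ∑ i, if (e i : Sym2 V) = b then 1 else 0)

open Classical in
/-- The weights of a family of vertices are multiplied by `1 + c`. -/
noncomputable def perturbedVertex (m : V → ℝ) (c : ℝ) (v : V) : ℝ :=
  m v * (1 + c * ∑ i, if x i = v then 1 else 0)

variable {e x}

/-- The perturbed weights produce a polynomial in `c` whose top coefficient is nonzero only on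
forests containing the whole family; this is how the marginal gets extracted. -/
theorem configWeight_perturbed [Finite H.verts] (ρ : Sym2 V → ℝ) (m : V → ℝ) (c : ℝ)
    (he : Function.Injective e) (hx : Function.Injective x) {ω : ForestConfig G}
    (hω : IsRootedSpanningForest H ω) :
    configWeight (perturbedEdge e ρ c) (perturbedVertex x m c) ω =
      configWeight ρ m ω * ∏ a, (1 + c * familyIndicator e x ω a) := by
  classical
  have h1 := finprod_mem_one_add_indicator (finite_edges_of_forest hω) e he c
  have h2 := finprod_mem_one_add_indicator (finite_roots_of_forest hω) x hx c
  simp only [configWeight, perturbedEdge, perturbedVertex]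
  rw [finprod_mem_mul_distrib (finite_edges_of_forest hω),
    finprod_mem_mul_distrib (finite_roots_of_forest hω), h2]
  simp only [← Subtype.ext_iff]
  rw [h1, Fintype.prod_sum_type]
  simp only [familyIndicator, Set.mem_ofPred_eq]
  ring

/-- An edge contributes the rank-one matrix of the vector `δ_a - δ_b`. It does not change under
exchange of `a` and `b`, so an arbitrary orientation can be used. -/
theorem forestLaplacian_single_edge [Fintype H.verts] [DecidableEq V] {a b : V} (hab : H.Adj a b)
    (u v : H.verts) :
    forestLaplacian H (fun d => if s(a, b) = d then 1 else 0, 0) u v =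
      ((if a = u then 1 else 0) - if b = u then 1 else 0) *
      ((if a = v then 1 else 0) - if b = v then 1 else 0) := by
  classical
  have hne : a ≠ b := hab.ne
  have h1 : ∀ z w : H.verts, (if H.Adj z w then if s(a, b) = s((z : V), (w : V)) then (1 : ℝ) else 0
      else 0) = (if a = z then 1 else 0) * (if b = w then 1 else 0) +
        (if b = z then 1 else 0) * (if a = w then 1 else 0) := by
    intro z w
    by_cases h : s(a, b) = s((z : V), (w : V))
    · have hadj : H.Adj z w := by
        have : s(a, b) ∈ H.edgeSet := hab
        rw [h] at this
        exact this
      rw [if_pos hadj, if_pos h]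
      rcases Sym2.eq_iff.1 h with ⟨h1, h2⟩ | ⟨h1, h2⟩
      · simp [← h1, ← h2, hne, hne.symm]
      · simp [← h1, ← h2, hne, hne.symm]
    · rw [if_neg h, ite_self]
      have h2 : ¬ (a = z ∧ b = w) := fun ⟨h1, h2⟩ => h (by rw [h1, h2])
      have h3 : ¬ (b = z ∧ a = w) := fun ⟨h1, h2⟩ => h (by rw [h1, h2]; exact Sym2.eq_swap)
      rw [ite_zero_mul_ite_zero, ite_zero_mul_ite_zero, if_neg h2, if_neg h3]
      simp
  have h2 : ∀ c : V, c ∈ H.verts → (∑ w : H.verts, if c = w then (1 : ℝ) else 0) = 1 := by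
    intro c hc
    rw [Finset.sum_eq_single ⟨c, hc⟩]
    · simp
    · intro w _ hw
      rw [if_neg]
      rintro rfl
      exact hw rfl
    · simp
  simp only [forestLaplacian, LinearMap.coe_mk, AddHom.coe_mk, Matrix.of_apply, h1, Pi.zero_apply,
    add_zero, Finset.sum_add_distrib, ← Finset.mul_sum, h2 a hab.fst_mem, h2 b hab.snd_mem]
  by_cases huv : u = v
  · subst huv
    by_cases h3 : a = u
    · have : b ≠ u := fun h => hne (h3.trans h.symm)
      simp [h3, this]
    · by_cases h4 : b = u <;> simp [h3, h4]
  · have h3 : ∀ c : V, (if c = u then (1 : ℝ) else 0) * (if c = v then 1 else 0) = 0 := by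
      intro c
      rw [ite_zero_mul_ite_zero, if_neg]
      rintro ⟨h1, h2⟩
      exact huv (Subtype.ext (h1.symm.trans h2))
    rw [if_neg huv]
    linear_combination -h3 a - h3 b

theorem forestLaplacian_single_vertex [Fintype H.verts] [DecidableEq V] (a : V) (u v : H.verts) :
    forestLaplacian H (0, fun d => if a = d then 1 else 0) u v =
      (if a = u then 1 else 0) * (if a = v then 1 else 0) := by
  classical
  simp only [forestLaplacian, LinearMap.coe_mk, AddHom.coe_mk, Matrix.of_apply, Pi.zero_apply,
    ite_self, Finset.sum_const_zero, zero_add, sub_zero]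
  by_cases huv : u = v
  · subst huv; simp
  · rw [if_neg huv, ite_zero_mul_ite_zero, if_neg]
    rintro ⟨h1, h2⟩
    exact huv (Subtype.ext (h1.symm.trans h2))

theorem forestLaplacian_perturbed [DecidableEq ι₁] [DecidableEq ι₂] [Fintype H.verts] (o : EdgeOrientation G) (ρ : Sym2 V → ℝ)
    (m : V → ℝ) (c : ℝ) (heH : ∀ i, (e i : Sym2 V) ∈ H.edgeSet) :
    forestLaplacian H (perturbedEdge e ρ c, perturbedVertex x m c) =
      forestLaplacian H (ρ, m) + c • ((Matrix.of fun (a : ι₁ ⊕ ι₂) (v : H.verts) =>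
        incidence e x o a v).transpose * Matrix.diagonal (familyWeight e x ρ m) *
        (Matrix.of fun (a : ι₁ ⊕ ι₂) (v : H.verts) => incidence e x o a v)) := by
  classical
  have h1 : ((perturbedEdge e ρ c, perturbedVertex x m c) : (Sym2 V → ℝ) × (V → ℝ)) =
      (ρ, m) + c • (∑ i, ρ (e i) • ((fun d => if (e i : Sym2 V) = d then 1 else 0, 0) :
          (Sym2 V → ℝ) × (V → ℝ)) +
        ∑ i, m (x i) • ((0, fun d => if x i = d then 1 else 0) : (Sym2 V → ℝ) × (V → ℝ))) := by
    refine Prod.ext (funext fun d => ?_) (funext fun d => ?_)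
    · simp only [perturbedEdge, Prod.fst_add, Prod.smul_fst, Prod.fst_sum, smul_zero,
        Finset.sum_const_zero, add_zero, Pi.add_apply, Pi.smul_apply, Finset.sum_apply, smul_eq_mul]
      rw [mul_add, mul_one, mul_left_comm, Finset.mul_sum]
      congr 2
      refine Finset.sum_congr rfl fun i _ => ?_
      split_ifs with h <;> simp [h]
    · simp only [perturbedVertex, Prod.snd_add, Prod.smul_snd, Prod.snd_sum, smul_zero,
        Finset.sum_const_zero, zero_add, Pi.add_apply, Pi.smul_apply, Finset.sum_apply, smul_eq_mul]
      rw [mul_add, mul_one, mul_left_comm, Finset.mul_sum]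
      congr 2
      refine Finset.sum_congr rfl fun i _ => ?_
      split_ifs with h <;> simp [h]
  rw [h1, map_add, map_smul, map_add, map_sum, map_sum]
  congr 2
  ext u v
  simp only [map_smul, Matrix.add_apply, Matrix.sum_apply, Matrix.smul_apply, smul_eq_mul]
  rw [Matrix.mul_apply, Fintype.sum_sum_type]
  simp only [Matrix.mul_diagonal, Matrix.transpose_apply, Matrix.of_apply, incidence, familyWeight]
  congr 1
  · refine Finset.sum_congr rfl fun i _ => ?_
    have h2 := heH i
    rw [← o.mk_src_tgt (e i)] at h2 ⊢
    rw [forestLaplacian_single_edge H h2]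
    ring
  · refine Finset.sum_congr rfl fun i _ => ?_
    rw [forestLaplacian_single_vertex]
    ring

/-- **Transfer impedance theorem**: the weight of the forests containing given edges and roots is
a determinant. -/
theorem finsum_forest_familyIndicator [DecidableEq ι₁] [DecidableEq ι₂] [Fintype H.verts] [DecidableEq H.verts]
    (o : EdgeOrientation G) (ρ : Sym2 V → ℝ)
    (m : V → ℝ) (he : Function.Injective e) (hx : Function.Injective x)
    (heH : ∀ i, (e i : Sym2 V) ∈ H.edgeSet) (hdet : (forestLaplacian H (ρ, m)).det ≠ 0) :
    ∑ᶠ ω ∈ {ω : ForestConfig G | IsRootedSpanningForest H ω},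
        configWeight ρ m ω * ∏ a, familyIndicator e x ω a =
      (forestLaplacian H (ρ, m)).det *
        ((Matrix.of fun (a : ι₁ ⊕ ι₂) (v : H.verts) => incidence e x o a v) *
          (forestLaplacian H (ρ, m))⁻¹ *
          ((Matrix.of fun (a : ι₁ ⊕ ι₂) (v : H.verts) => incidence e x o a v).transpose *
            Matrix.diagonal (familyWeight e x ρ m))).det := by
  classical
  set L := forestLaplacian H (ρ, m) with hL
  set B : Matrix (ι₁ ⊕ ι₂) H.verts ℝ := Matrix.of fun a v => incidence e x o a v with hB
  set C := B.transpose * Matrix.diagonal (familyWeight e x ρ m) with hC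
  have hu : IsUnit L.det := isUnit_iff_ne_zero.2 hdet
  have key : ∀ s : ℝ, s ≠ 0 →
      ∑ᶠ ω ∈ {ω : ForestConfig G | IsRootedSpanningForest H ω},
        configWeight ρ m ω * ∏ a, (s + familyIndicator e x ω a) =
      L.det * (s • (1 : Matrix (ι₁ ⊕ ι₂) (ι₁ ⊕ ι₂) ℝ) + B * L⁻¹ * C).det := by
    intro s hs
    have h1 : ∀ ω ∈ {ω : ForestConfig G | IsRootedSpanningForest H ω},
        configWeight ρ m ω * ∏ a, (s + familyIndicator e x ω a) =
        s ^ Fintype.card (ι₁ ⊕ ι₂) *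
          configWeight (perturbedEdge e ρ s⁻¹) (perturbedVertex x m s⁻¹) ω := by
      intro ω hω
      rw [configWeight_perturbed H ρ m s⁻¹ he hx hω, mul_left_comm,
        show s ^ Fintype.card (ι₁ ⊕ ι₂) = ∏ _a : ι₁ ⊕ ι₂, s by simp [Finset.prod_const],
        ← Finset.prod_mul_distrib]
      congr 1
      refine Finset.prod_congr rfl fun a _ => ?_
      field_simp
    rw [finsum_mem_congr rfl h1, ← mul_finsum_mem' _ _ finite_forests, ← det_forestLaplacian,
      forestLaplacian_perturbed H o ρ m s⁻¹ heH, ← hL, ← hB, ← hC]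
    have h2 : L + s⁻¹ • (C * B) = L * (1 + (L⁻¹ * C) * (s⁻¹ • B)) := by
      rw [mul_add, mul_one, ← Matrix.mul_assoc, ← Matrix.mul_assoc, Matrix.mul_nonsing_inv _ hu,
        Matrix.one_mul, Matrix.mul_smul]
    rw [h2, Matrix.det_mul, Matrix.det_one_add_mul_comm, mul_left_comm, ← Matrix.det_smul]
    congr 2
    rw [smul_add, Matrix.smul_mul, smul_smul, mul_inv_cancel₀ hs, one_smul, Matrix.mul_assoc]
  -- Both sides are continuous in `s`. At `s = 0` the left one keeps only the forests containing the
  -- whole family.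
  have hl : Filter.Tendsto (fun s : ℝ => ∑ᶠ ω ∈ {ω : ForestConfig G | IsRootedSpanningForest H ω},
        configWeight ρ m ω * ∏ a, (s + familyIndicator e x ω a)) (nhdsWithin 0 {0}ᶜ)
        (nhds (∑ᶠ ω ∈ {ω : ForestConfig G | IsRootedSpanningForest H ω},
        configWeight ρ m ω * ∏ a, (0 + familyIndicator e x ω a))) := by
    have : Continuous (fun s : ℝ => ∑ᶠ ω ∈ {ω : ForestConfig G | IsRootedSpanningForest H ω},
        configWeight ρ m ω * ∏ a, (s + familyIndicator e x ω a)) := by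
      simp only [finsum_mem_eq_finite_toFinset_sum _ (finite_forests (H := H))]
      fun_prop
    exact (this.tendsto 0).mono_left nhdsWithin_le_nhds
  have hr : Filter.Tendsto (fun s : ℝ =>
      L.det * (s • (1 : Matrix (ι₁ ⊕ ι₂) (ι₁ ⊕ ι₂) ℝ) + B * L⁻¹ * C).det) (nhdsWithin 0 {0}ᶜ)
      (nhds (L.det * ((0 : ℝ) • (1 : Matrix (ι₁ ⊕ ι₂) (ι₁ ⊕ ι₂) ℝ) + B * L⁻¹ * C).det)) := by
    have : Continuous (fun s : ℝ =>
        L.det * (s • (1 : Matrix (ι₁ ⊕ ι₂) (ι₁ ⊕ ι₂) ℝ) + B * L⁻¹ * C).det) :=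
      continuous_const.mul (Continuous.matrix_det (by fun_prop))
    exact (this.tendsto 0).mono_left nhdsWithin_le_nhds
  have := tendsto_nhds_unique (hl.congr' (eventually_nhdsWithin_of_forall (s := {(0 : ℝ)}ᶜ) fun s hs => key s hs)) hr
  simpa using this

end Marginals

end ForestWeights

/-! ### Positivity and bounds for the conductances and masses. -/

section Elliptic

variable {k : ℝ}

/-- The function `Δ(t) = √(1 - k² sin² t)`. -/
noncomputable def ellipticDelta (k t : ℝ) : ℝ := Real.sqrt (1 - k ^ 2 * Real.sin t ^ 2)

theorem complementary_modulus_pos (hk : k ∈ Set.Ioo (0 : ℝ) 1) : 0 < Real.sqrt (1 - k ^ 2) :=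
  Real.sqrt_pos.2 (by nlinarith [hk.1, hk.2])

theorem one_sub_sq_mul_sin_sq_pos (hk : k ∈ Set.Ioo (0 : ℝ) 1) (t : ℝ) :
    0 < 1 - k ^ 2 * Real.sin t ^ 2 := by
  have h1 : k ^ 2 < 1 := by nlinarith [hk.1, hk.2]
  nlinarith [Real.sin_sq_le_one t, sq_nonneg k, sq_nonneg (Real.sin t)]

theorem ellipticDelta_pos (hk : k ∈ Set.Ioo (0 : ℝ) 1) (t : ℝ) : 0 < ellipticDelta k t :=
  Real.sqrt_pos.2 (one_sub_sq_mul_sin_sq_pos hk t)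

theorem ellipticDelta_sq (hk : k ∈ Set.Ioo (0 : ℝ) 1) (t : ℝ) :
    ellipticDelta k t ^ 2 = 1 - k ^ 2 * Real.sin t ^ 2 :=
  Real.sq_sqrt (one_sub_sq_mul_sin_sq_pos hk t).le

@[fun_prop]
theorem continuous_ellipticDelta : Continuous (ellipticDelta k) := by
  unfold ellipticDelta; fun_prop

theorem hasDerivAt_ellipticDelta (hk : k ∈ Set.Ioo (0 : ℝ) 1) (t : ℝ) :
    HasDerivAt (ellipticDelta k) (-(k ^ 2 * Real.sin t * Real.cos t) / ellipticDelta k t) t := by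
  have h1 : HasDerivAt (fun t => 1 - k ^ 2 * Real.sin t ^ 2)
      (-(k ^ 2 * (2 * Real.sin t * Real.cos t))) t := by
    refine ((((Real.hasDerivAt_sin t).pow 2).const_mul (k ^ 2)).const_sub 1).congr_deriv ?_
    norm_num
  refine (h1.sqrt (one_sub_sq_mul_sin_sq_pos hk t).ne').congr_deriv ?_
  have := (ellipticDelta_pos hk t).ne'
  rw [show √(1 - k ^ 2 * Real.sin t ^ 2) = ellipticDelta k t from rfl]
  field_simp

theorem ellipticDelta_strictAntiOn (hk : k ∈ Set.Ioo (0 : ℝ) 1) :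
    StrictAntiOn (ellipticDelta k) (Set.Icc 0 (Real.pi / 2)) := by
  intro a ha b hb hab
  refine Real.sqrt_lt_sqrt (one_sub_sq_mul_sin_sq_pos hk b).le ?_
  have h1 : Real.sin a < Real.sin b :=
    Real.sin_lt_sin_of_lt_of_le_pi_div_two (by linarith [ha.1, Real.pi_pos]) hb.2 hab
  have h2 : 0 ≤ Real.sin a := Real.sin_nonneg_of_nonneg_of_le_pi ha.1 (by linarith [ha.2, Real.pi_pos])
  have h3 : Real.sin a ^ 2 < Real.sin b ^ 2 := by nlinarith
  have h4 : 0 < k ^ 2 := by have := hk.1; positivity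
  nlinarith

theorem continuous_inv_ellipticDelta (hk : k ∈ Set.Ioo (0 : ℝ) 1) :
    Continuous fun t => 1 / ellipticDelta k t :=
  continuous_const.div continuous_ellipticDelta fun t => (ellipticDelta_pos hk t).ne'

theorem ellipticF_eq (φ : ℝ) : ellipticF k φ = ∫ t in (0 : ℝ)..φ, 1 / ellipticDelta k t := rfl

theorem hasDerivAt_ellipticF (hk : k ∈ Set.Ioo (0 : ℝ) 1) (φ : ℝ) :
    HasDerivAt (ellipticF k) (1 / ellipticDelta k φ) φ :=
  (continuous_inv_ellipticDelta hk).integral_hasStrictDerivAt 0 φ |>.hasDerivAt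

theorem ellipticF_strictMono (hk : k ∈ Set.Ioo (0 : ℝ) 1) : StrictMono (ellipticF k) :=
  strictMono_of_hasDerivAt_pos (fun x => hasDerivAt_ellipticF hk x)
    fun x => one_div_pos.2 (ellipticDelta_pos hk x)

theorem continuous_ellipticF (hk : k ∈ Set.Ioo (0 : ℝ) 1) : Continuous (ellipticF k) :=
  continuous_iff_continuousAt.2 fun x => (hasDerivAt_ellipticF hk x).continuousAt

theorem ellipticF_zero : ellipticF k 0 = 0 := by simp [ellipticF]

theorem ellipticK_pos (hk : k ∈ Set.Ioo (0 : ℝ) 1) : 0 < ellipticK k := by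
  have := ellipticF_strictMono hk (show (0 : ℝ) < Real.pi / 2 by positivity)
  rwa [ellipticF_zero] at this

theorem jacobiAm_ellipticF (hk : k ∈ Set.Ioo (0 : ℝ) 1) (φ : ℝ) :
    jacobiAm k (ellipticF k φ) = φ :=
  Function.leftInverse_invFun (ellipticF_strictMono hk).injective φ

theorem jacobiSc_ellipticF (hk : k ∈ Set.Ioo (0 : ℝ) 1) (φ : ℝ) :
    jacobiSc k (ellipticF k φ) = Real.tan φ := by
  rw [jacobiSc, jacobiSn, jacobiCn, jacobiAm_ellipticF hk, Real.tan_eq_sin_div_cos]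

theorem jacobiDc_ellipticF (hk : k ∈ Set.Ioo (0 : ℝ) 1) (φ : ℝ) :
    jacobiDc k (ellipticF k φ) = ellipticDelta k φ / Real.cos φ := by
  rw [jacobiDc, jacobiDn, jacobiSn, jacobiCn, jacobiAm_ellipticF hk, ellipticDelta]

/-- Substitute `v = F(t)`, `dv = dt/Δ(t)`. The change of variables for injective maps is used on the
closed interval, so no continuity of `dc` is needed. -/
theorem integral_jacobiDc_sq (hk : k ∈ Set.Ioo (0 : ℝ) 1) {φ : ℝ} (h0 : 0 ≤ φ) :
    ∫ v in (0 : ℝ)..ellipticF k φ, jacobiDc k v ^ 2 =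
      ∫ t in (0 : ℝ)..φ, ellipticDelta k t / Real.cos t ^ 2 := by
  have hF0 : 0 ≤ ellipticF k φ := by
    rw [← ellipticF_zero (k := k)]; exact (ellipticF_strictMono hk).monotone h0
  have himg : ellipticF k '' Set.Icc 0 φ = Set.Icc 0 (ellipticF k φ) := by
    conv_rhs => rw [← ellipticF_zero (k := k)]
    exact (continuous_ellipticF hk).continuousOn.image_Icc_of_monotoneOn h0
      ((ellipticF_strictMono hk).monotone.monotoneOn _)
  rw [intervalIntegral.integral_of_le hF0, intervalIntegral.integral_of_le h0,
    ← MeasureTheory.integral_Icc_eq_integral_Ioc, ← MeasureTheory.integral_Icc_eq_integral_Ioc,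
    ← himg, MeasureTheory.integral_image_eq_integral_abs_deriv_smul measurableSet_Icc
      (fun x _ => (hasDerivAt_ellipticF hk x).hasDerivWithinAt)
      (ellipticF_strictMono hk).injective.injOn]
  refine MeasureTheory.setIntegral_congr_fun measurableSet_Icc fun t _ => ?_
  have := ellipticDelta_pos hk t
  simp only [jacobiDc_ellipticF hk, smul_eq_mul, abs_of_pos (one_div_pos.2 this)]
  field_simp

/-- The integrand in the formula for `A - sc`. -/
noncomputable def massDensity (k t : ℝ) : ℝ :=
  k ^ 2 / (ellipticDelta k t + Real.sqrt (1 - k ^ 2)) -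
    (1 - ellipticE k / ellipticK k) * (1 / ellipticDelta k t)

theorem continuous_massDensity_left (hk : k ∈ Set.Ioo (0 : ℝ) 1) :
    Continuous fun t => k ^ 2 / (ellipticDelta k t + Real.sqrt (1 - k ^ 2)) :=
  continuous_const.div (by fun_prop) fun t =>
    (add_pos (ellipticDelta_pos hk t) (complementary_modulus_pos hk)).ne'

theorem continuous_massDensity (hk : k ∈ Set.Ioo (0 : ℝ) 1) : Continuous (massDensity k) :=
  (continuous_massDensity_left hk).sub (continuous_const.mul (continuous_inv_ellipticDelta hk))

theorem ellipticDelta_sub_div (hk : k ∈ Set.Ioo (0 : ℝ) 1) {t : ℝ} (ht : Real.cos t ≠ 0) :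
    (ellipticDelta k t - Real.sqrt (1 - k ^ 2)) / Real.cos t ^ 2 =
      k ^ 2 / (ellipticDelta k t + Real.sqrt (1 - k ^ 2)) := by
  have h1 := ellipticDelta_sq hk t
  have h2 : Real.sqrt (1 - k ^ 2) ^ 2 = 1 - k ^ 2 :=
    Real.sq_sqrt (by nlinarith [hk.1, hk.2])
  have h3 := (add_pos (ellipticDelta_pos hk t) (complementary_modulus_pos hk)).ne'
  rw [div_eq_div_iff (pow_ne_zero 2 ht) h3]
  have h4 := Real.sin_sq_add_cos_sq t
  linear_combination h1 - h2 - k ^ 2 * h4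

/-- In the amplitude variable `sc` is `tan`, and `k' tan φ` is the integral of `k'/cos²`.
Subtracting it from the integral of `Δ/cos²` removes the singularity at `π/2`
(`ellipticDelta_sub_div`), leaving a density continuous on the whole line. -/
theorem ellipticA_sub_jacobiSc (hk : k ∈ Set.Ioo (0 : ℝ) 1) {φ : ℝ}
    (hφ : φ ∈ Set.Ico 0 (Real.pi / 2)) :
    ellipticA k (ellipticF k φ) - jacobiSc k (ellipticF k φ) =
      1 / Real.sqrt (1 - k ^ 2) * ∫ t in (0 : ℝ)..φ, massDensity k t := by
  have hcos : ∀ t ∈ Set.uIcc 0 φ, Real.cos t ≠ 0 := by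
    intro t ht
    rw [Set.uIcc_of_le hφ.1] at ht
    exact (Real.cos_pos_of_mem_Ioo ⟨by linarith [ht.1, Real.pi_pos], ht.2.trans_lt hφ.2⟩).ne'
  have hkp := complementary_modulus_pos hk
  set kp := Real.sqrt (1 - k ^ 2) with hkpdef
  have htan : ∫ t in (0 : ℝ)..φ, 1 / Real.cos t ^ 2 = Real.tan φ := by
    rw [intervalIntegral.integral_eq_sub_of_hasDerivAt (f := Real.tan)]
    · simp
    · exact fun t ht => Real.hasDerivAt_tan (hcos t ht)
    · exact (continuousOn_const.div (by fun_prop)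
        fun t ht => pow_ne_zero 2 (hcos t ht)).intervalIntegrable
  have i1 : IntervalIntegrable (fun t => 1 / Real.cos t ^ 2) MeasureTheory.volume 0 φ :=
    (continuousOn_const.div (by fun_prop) fun t ht => pow_ne_zero 2 (hcos t ht)).intervalIntegrable
  have i2 : IntervalIntegrable (fun t => k ^ 2 / (ellipticDelta k t + kp)) MeasureTheory.volume 0 φ :=
    (continuous_massDensity_left hk).intervalIntegrable _ _
  have i3 : IntervalIntegrable (fun t => 1 / ellipticDelta k t) MeasureTheory.volume 0 φ :=
    (continuous_inv_ellipticDelta hk).intervalIntegrable _ _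
  have h1 : ∫ t in (0 : ℝ)..φ, ellipticDelta k t / Real.cos t ^ 2 =
      (∫ t in (0 : ℝ)..φ, k ^ 2 / (ellipticDelta k t + kp)) + kp * Real.tan φ := by
    rw [← htan, ← intervalIntegral.integral_const_mul, ← intervalIntegral.integral_add i2
      (i1.const_mul kp)]
    refine intervalIntegral.integral_congr fun t ht => ?_
    rw [← ellipticDelta_sub_div hk (hcos t ht)]
    ring
  have h2 : ∫ t in (0 : ℝ)..φ, massDensity k t =
      (∫ t in (0 : ℝ)..φ, k ^ 2 / (ellipticDelta k t + kp)) -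
        (1 - ellipticE k / ellipticK k) * ellipticF k φ := by
    rw [ellipticF_eq, ← intervalIntegral.integral_const_mul, ← intervalIntegral.integral_sub i2
      (i3.const_mul _)]
    rfl
  have hK := (ellipticK_pos hk).ne'
  rw [ellipticA, integral_jacobiDc_sq hk hφ.1, h1, h2, jacobiSc_ellipticF hk, ← hkpdef]
  field_simp
  ring

/-- The function `k² sin cos / (Δ + k')` vanishes at `0` and `π/2`, and its derivative is `k²/(Δ +
k') - (1/Δ - Δ)`. Hence the first term of the density integrates to `K - E`, exactly what the second
one subtracts. -/
theorem integral_massDensity_eq_zero (hk : k ∈ Set.Ioo (0 : ℝ) 1) :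
    ∫ t in (0 : ℝ)..(Real.pi / 2), massDensity k t = 0 := by
  have hkp := complementary_modulus_pos hk
  have hkp2 : Real.sqrt (1 - k ^ 2) ^ 2 = 1 - k ^ 2 :=
    Real.sq_sqrt (by nlinarith [hk.1, hk.2])
  have h1 : ∫ t in (0 : ℝ)..(Real.pi / 2), (k ^ 2 / (ellipticDelta k t + Real.sqrt (1 - k ^ 2)) -
      (1 / ellipticDelta k t - ellipticDelta k t)) = 0 := by
    rw [intervalIntegral.integral_eq_sub_of_hasDerivAt
      (f := fun t => k ^ 2 * (Real.sin t * Real.cos t) /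
        (ellipticDelta k t + Real.sqrt (1 - k ^ 2)))]
    · simp
    · intro t _
      have hD := ellipticDelta_pos hk t
      have hs := (add_pos hD hkp).ne'
      have h2 := ((((Real.hasDerivAt_sin t).mul (Real.hasDerivAt_cos t)).const_mul (k ^ 2)).div
        ((hasDerivAt_ellipticDelta hk t).add_const (Real.sqrt (1 - k ^ 2))) hs)
      refine h2.congr_deriv ?_
      symm
      have h3 := ellipticDelta_sq hk t
      have h4 := Real.sin_sq_add_cos_sq t
      set D := ellipticDelta k t
      set p := Real.sqrt (1 - k ^ 2)
      set s := Real.sin t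
      set c := Real.cos t
      have hc : c ^ 2 = 1 - s ^ 2 := by linarith
      have hk2 : k ^ 2 = 1 - p ^ 2 := by linarith
      have h5 : k ^ 2 * s ^ 2 = 1 - D ^ 2 := by linarith
      have h6 : k ^ 2 * c ^ 2 = D ^ 2 - p ^ 2 := by rw [hc]; linarith
      have h7 : k ^ 2 * s * c * (k ^ 2 * s * c) = (1 - D ^ 2) * (D ^ 2 - p ^ 2) := by
        rw [← h5, ← h6]; ring
      rw [eq_div_iff (pow_ne_zero 2 hs)]
      have e1 : k ^ 2 * (s * c) * (-(k ^ 2 * s * c) / D) = -((1 - D ^ 2) * (D ^ 2 - p ^ 2)) / D := by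
        rw [← h7]; ring
      rw [show (Real.sin * Real.cos) t = s * c from rfl, e1]
      have e2 : k ^ 2 * (c * c + s * -s) = D ^ 2 - p ^ 2 - (1 - D ^ 2) := by
        rw [← h5, ← h6]; ring
      rw [e2, hk2]
      field_simp
      ring
    · exact ((continuous_massDensity_left hk).sub ((continuous_inv_ellipticDelta hk).sub
        continuous_ellipticDelta)).intervalIntegrable _ _
  have i2 := (continuous_massDensity_left hk).intervalIntegrable
    (μ := MeasureTheory.volume) 0 (Real.pi / 2)
  have i3 := (continuous_inv_ellipticDelta hk).intervalIntegrable
    (μ := MeasureTheory.volume) 0 (Real.pi / 2)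
  have i4 := (continuous_ellipticDelta (k := k)).intervalIntegrable
    (μ := MeasureTheory.volume) 0 (Real.pi / 2)
  rw [intervalIntegral.integral_sub i2 (i3.sub i4), intervalIntegral.integral_sub i3 i4] at h1
  have hK : ∫ t in (0 : ℝ)..(Real.pi / 2), 1 / ellipticDelta k t = ellipticK k := rfl
  have hE : ∫ t in (0 : ℝ)..(Real.pi / 2), ellipticDelta k t = ellipticE k := rfl
  have hK0 := (ellipticK_pos hk).ne'
  unfold massDensity
  rw [intervalIntegral.integral_sub i2 (i3.const_mul _), intervalIntegral.integral_const_mul, hK]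
  rw [hK, hE] at h1
  field_simp
  linarith

/-- The density is a strictly decreasing function `b` divided by the positive `Δ`, so it can only
pass from positive to negative. -/
theorem integral_massDensity_pos (hk : k ∈ Set.Ioo (0 : ℝ) 1) {φ : ℝ}
    (hφ : φ ∈ Set.Ioo 0 (Real.pi / 2)) : 0 < ∫ t in (0 : ℝ)..φ, massDensity k t := by
  have hkp := complementary_modulus_pos hk
  have hk2 : 0 < k ^ 2 := by have := hk.1; positivity
  set b : ℝ → ℝ := fun t => k ^ 2 * (1 - Real.sqrt (1 - k ^ 2) /
    (ellipticDelta k t + Real.sqrt (1 - k ^ 2))) - (1 - ellipticE k / ellipticK k) with hb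
  have hq : ∀ t, massDensity k t = b t / ellipticDelta k t := by
    intro t
    have hD := ellipticDelta_pos hk t
    have hs := (add_pos hD hkp).ne'
    simp only [massDensity, hb]
    generalize 1 - ellipticE k / ellipticK k = C
    field_simp
    ring
  have hanti : StrictAntiOn b (Set.Icc 0 (Real.pi / 2)) := by
    intro x hx y hy hxy
    have h1 := ellipticDelta_strictAntiOn hk hx hy hxy
    have h2 := ellipticDelta_pos hk y
    have h3 : Real.sqrt (1 - k ^ 2) / (ellipticDelta k x + Real.sqrt (1 - k ^ 2)) <
        Real.sqrt (1 - k ^ 2) / (ellipticDelta k y + Real.sqrt (1 - k ^ 2)) :=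
      div_lt_div_of_pos_left hkp (by linarith) (by linarith)
    simp only [hb]
    nlinarith
  have hcont := continuous_massDensity hk
  have hφm : φ ∈ Set.Icc 0 (Real.pi / 2) := ⟨hφ.1.le, hφ.2.le⟩
  -- Either the density is positive before `φ`, or it is negative after `φ`; in the second case the
  -- zero total integral makes the part before `φ` positive.
  rcases le_or_gt 0 (b φ) with h | h
  · refine intervalIntegral.intervalIntegral_pos_of_pos_on (hcont.intervalIntegrable _ _) ?_ hφ.1
    intro t ht
    rw [hq]
    exact div_pos (h.trans_lt (hanti ⟨ht.1.le, (ht.2.trans hφ.2).le⟩ hφm ht.2))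
      (ellipticDelta_pos hk t)
  · have h1 := intervalIntegral.integral_add_adjacent_intervals
      (hcont.intervalIntegrable (μ := MeasureTheory.volume) 0 φ)
      (hcont.intervalIntegrable φ (Real.pi / 2))
    rw [integral_massDensity_eq_zero hk] at h1
    have h2 : 0 < ∫ t in φ..(Real.pi / 2), -massDensity k t := by
      refine intervalIntegral.intervalIntegral_pos_of_pos_on
        (hcont.neg.intervalIntegrable _ _) ?_ hφ.2
      intro t ht
      rw [hq, ← neg_div]
      refine div_pos ?_ (ellipticDelta_pos hk t)
      linarith [hanti hφm ⟨(hφ.1.trans ht.1).le, ht.2.le⟩ ht.1]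
    rw [intervalIntegral.integral_neg] at h2
    linarith

/-- Uniform bounds for `sc` and `A - sc` on compact subintervals of `(0, K)`. -/
theorem exists_elliptic_bounds (hk : k ∈ Set.Ioo (0 : ℝ) 1) {a b : ℝ} (ha : 0 < a) (hab : a ≤ b)
    (hb : b < ellipticK k) :
    ∃ r m₀ m₁ : ℝ, 0 < m₀ ∧ ∀ u ∈ Set.Icc a b, 0 < jacobiSc k u ∧ jacobiSc k u ≤ r ∧
      m₀ ≤ ellipticA k u - jacobiSc k u ∧ ellipticA k u - jacobiSc k u ≤ m₁ := by
  have hmono := ellipticF_strictMono hk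
  have hex : ∀ u ∈ Set.Icc a b, ∃ φ ∈ Set.Ioo 0 (Real.pi / 2), ellipticF k φ = u := by
    intro u hu
    have h1 : u ∈ Set.Icc (ellipticF k 0) (ellipticF k (Real.pi / 2)) := by
      rw [ellipticF_zero]
      exact ⟨ha.le.trans hu.1, hu.2.trans hb.le⟩
    obtain ⟨φ, hφ, rfl⟩ := intermediate_value_Icc (by positivity)
      (continuous_ellipticF hk).continuousOn h1
    refine ⟨φ, ⟨hmono.lt_iff_lt.1 ?_, hmono.lt_iff_lt.1 (hu.2.trans_lt hb)⟩, rfl⟩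
    rw [ellipticF_zero]
    exact ha.trans_le hu.1
  obtain ⟨φ₁, h1, hF1⟩ := hex a ⟨le_rfl, hab⟩
  obtain ⟨φ₂, h2, hF2⟩ := hex b ⟨hab, le_rfl⟩
  have hsub : ∀ φ ∈ Set.Icc φ₁ φ₂, φ ∈ Set.Ioo 0 (Real.pi / 2) := fun φ hφ =>
    ⟨h1.1.trans_le hφ.1, hφ.2.trans_lt h2.2⟩
  have hne : (Set.Icc φ₁ φ₂).Nonempty :=
    ⟨φ₁, le_rfl, hmono.le_iff_le.1 (by rw [hF1, hF2]; exact hab)⟩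
  set g : ℝ → ℝ := fun φ => 1 / Real.sqrt (1 - k ^ 2) * ∫ t in (0 : ℝ)..φ, massDensity k t with hg
  have hgc : Continuous g := continuous_const.mul
    (intervalIntegral.continuous_primitive
      (fun a b => (continuous_massDensity hk).intervalIntegrable a b) 0)
  have htc : ContinuousOn Real.tan (Set.Icc φ₁ φ₂) := fun φ hφ =>
    (Real.continuousAt_tan.2 (Real.cos_pos_of_mem_Ioo
      ⟨by linarith [(hsub φ hφ).1, Real.pi_pos], (hsub φ hφ).2⟩).ne').continuousWithinAt
  obtain ⟨p, hp, hpmin⟩ := isCompact_Icc.exists_isMinOn hne hgc.continuousOn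
  obtain ⟨q, hq, hqmax⟩ := isCompact_Icc.exists_isMaxOn hne hgc.continuousOn
  obtain ⟨r, hr, hrmax⟩ := isCompact_Icc.exists_isMaxOn hne htc
  refine ⟨Real.tan r, g p, g q, ?_, fun u hu => ?_⟩
  · exact mul_pos (one_div_pos.2 (complementary_modulus_pos hk))
      (integral_massDensity_pos hk (hsub p hp))
  · obtain ⟨φ, hφ, rfl⟩ := hex u hu
    have hφI : φ ∈ Set.Icc φ₁ φ₂ :=
      ⟨hmono.le_iff_le.1 (by rw [hF1]; exact hu.1), hmono.le_iff_le.1 (by rw [hF2]; exact hu.2)⟩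
    rw [ellipticA_sub_jacobiSc hk ⟨hφ.1.le, hφ.2⟩, jacobiSc_ellipticF hk]
    exact ⟨Real.tan_pos_of_pos_of_lt_pi_div_two hφ.1 hφ.2, hrmax hφI, hpmin hφI, hqmax hφI⟩

end Elliptic

/-! ### Faces of the embedding and the bound on degrees. -/

section Geometry

open Complex

theorem isCompact_segment_complex (a b : ℂ) : IsCompact (segment ℝ a b) := by
  rw [segment_eq_image]
  exact isCompact_Icc.image (by fun_prop)

/-- If `x` and `x + u` lie on a unit circle, the points of the line through them which are inside
the circle lie between them. -/
theorem dist_sq_line {x c u : ℂ} (h0 : dist x c = 1) (h1 : dist (x + u) c = 1) (t : ℝ) :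
    dist (x + t * u) c ^ 2 = 1 + t * (t - 1) * ‖u‖ ^ 2 := by
  have e : ∀ z : ℂ, dist z c ^ 2 = (z.re - c.re) ^ 2 + (z.im - c.im) ^ 2 := fun z => by
    rw [Complex.dist_eq, Complex.sq_norm, Complex.normSq_apply]; simp; ring
  have h0' := e x
  have h1' := e (x + u)
  rw [h0] at h0'
  rw [h1] at h1'
  rw [e, Complex.sq_norm, Complex.normSq_apply]
  simp only [add_re, add_im, mul_re, mul_im, ofReal_re, ofReal_im, zero_mul, sub_zero,
    add_zero] at *
  linear_combination (-1 + t) * h0' - t * h1'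

/-- A triangle with vertices `0`, `1` and `1/2 + iη` contains a ball around `1/4 + (1/2 + iη)/2`. -/
theorem mem_convexHull_of_near {A : Set ℂ} (hA : Convex ℝ A) {x c u : ℂ} {η l η₀ : ℝ} (hl : 0 < l)
    (hu : l ≤ ‖u‖) (hη₀ : 0 < η₀) (hη : η₀ ≤ η) (hx : x ∈ A) (hxu : x + u ∈ A) (hc : c ∈ A)
    (hcu : c = x + (1 / 2 + η * I) * u) {z : ℂ}
    (hz : dist z (x + (1 / 2 + η / 2 * I) * u) < l * min (1 / 8) (η₀ / 8)) : z ∈ A := by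
  have hu0 : u ≠ 0 := norm_pos_iff.1 (hl.trans_le hu)
  set v := (z - (x + (1 / 2 + η / 2 * I) * u)) / u with hv
  have hvn : ‖v‖ < min (1 / 8) (η₀ / 8) := by
    rw [hv, norm_div, div_lt_iff₀ (hl.trans_le hu), ← Complex.dist_eq]
    refine hz.trans_le ?_
    rw [mul_comm]
    gcongr
  have hre : |v.re| < 1 / 8 := (Complex.abs_re_le_norm v).trans_lt (hvn.trans_le (min_le_left _ _))
  have him : |v.im| < η₀ / 8 :=
    (Complex.abs_im_le_norm v).trans_lt (hvn.trans_le (min_le_right _ _))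
  have hη' : 0 < η := hη₀.trans_le hη
  have hb : |v.im / η| < 1 / 8 := by
    rw [abs_div, abs_of_pos hη', div_lt_iff₀ hη']
    linarith
  have hre' := abs_lt.1 hre
  have hb' := abs_lt.1 hb
  set β := v.im / η with hβ
  -- Barycentric coordinates of `z` in the triangle `x`, `x + u`, `c`. They are `1/4, 1/4, 1/2` at
  -- the centre of the ball, and deviations below `1/8` in `v.re` and `β` keep them nonnegative.
  have hz' : z = (1 / 4 - v.re - β / 2) • x + (1 / 4 + v.re - β / 2) • (x + u) +
      (1 / 2 + β) • c := by
    have h1 : z = x + (1 / 2 + η / 2 * I) * u + v * u := by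
      rw [hv, div_mul_cancel₀ _ hu0]; ring
    have h2 : v = v.re + (β * η : ℝ) * I := by
      rw [hβ, div_mul_cancel₀ _ hη'.ne']
      exact (Complex.re_add_im v).symm
    rw [h1, hcu]
    conv_lhs => rw [h2]
    simp only [Complex.real_smul]
    push_cast
    ring
  have h3 := hA.sum_mem (t := (Finset.univ : Finset (Fin 3)))
    (w := ![1 / 4 - v.re - β / 2, 1 / 4 + v.re - β / 2, 1 / 2 + β])
    (z := ![x, x + u, c])
    (by intro i _; fin_cases i <;> simp <;> linarith)
    (by simp [Fin.sum_univ_three]; ring)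
    (by intro i _; fin_cases i <;> simp [hx, hxu, hc])
  simp only [Fin.sum_univ_three, Matrix.cons_val_zero, Matrix.cons_val_one,
    Matrix.cons_val_two, Matrix.head_cons, Matrix.tail_cons] at h3
  rw [hz']
  exact h3

variable {V : Type*} {G : SimpleGraph V}

namespace IsoradialEmbedding

variable (S : IsoradialEmbedding G)

theorem countable_vertices (S : IsoradialEmbedding G) : Countable V := by
  have h : (Set.univ : Set V) = ⋃ n : ℕ, {v : V | ‖S.pos v‖ ≤ n} := by
    ext v
    simpa using exists_nat_ge ‖S.pos v‖
  rw [← Set.countable_univ_iff, h]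
  exact Set.countable_iUnion fun n => (S.finite_vertices n).countable

theorem isClosed_image_pos (A : Set V) : IsClosed (S.pos '' A) := by
  have h1 : S.pos '' A = ⋃ v : A, {S.pos v} := by
    ext z; simp [eq_comm]
  rw [h1]
  refine LocallyFinite.isClosed_iUnion (fun z => ⟨Metric.ball 0 (‖z‖ + 1),
    Metric.isOpen_ball.mem_nhds (by simp), ?_⟩) fun _ => isClosed_singleton
  refine ((S.finite_vertices (‖z‖ + 1)).preimage
    (Subtype.val_injective (p := (· ∈ A))).injOn).subset ?_
  rintro v ⟨w, hw, hw'⟩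
  obtain rfl : w = S.pos v := hw
  simpa using (mem_ball_zero_iff.1 hw').le

theorem isClosed_iUnion_segment (A : Set (V × V)) (hA : ∀ p ∈ A, G.Adj p.1 p.2) :
    IsClosed (⋃ p : A, segment ℝ (S.pos p.1.1) (S.pos p.1.2)) := by
  refine LocallyFinite.isClosed_iUnion (fun z => ⟨Metric.ball 0 (‖z‖ + 1),
    Metric.isOpen_ball.mem_nhds (by simp), ?_⟩) fun _ => (isCompact_segment_complex _ _).isClosed
  refine ((S.finite_edges (‖z‖ + 1)).preimage
    (Subtype.val_injective (p := (· ∈ A))).injOn).subset ?_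
  rintro p ⟨w, hw, hw'⟩
  exact ⟨hA p p.2, w, hw, Metric.ball_subset_closedBall hw'⟩

/-- The vertices in `A` and the closed edges in `B`. -/
theorem isClosed_partial_drawing (A : Set V) (B : Set (V × V)) (hB : ∀ p ∈ B, G.Adj p.1 p.2) :
    IsClosed (S.pos '' A ∪ ⋃ p : B, segment ℝ (S.pos p.1.1) (S.pos p.1.2)) :=
  (S.isClosed_image_pos A).union (S.isClosed_iUnion_segment B hB)

theorem pos_mem_drawing (v : V) : S.pos v ∈ graphDrawing G S.pos := Or.inl ⟨v, rfl⟩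

theorem segment_subset_drawing {x y : V} (h : G.Adj x y) :
    segment ℝ (S.pos x) (S.pos y) ⊆ graphDrawing G S.pos := fun _ hz => Or.inr ⟨x, y, h, hz⟩

theorem convex_face {p : ℂ} (hp : p ∉ graphDrawing G S.pos) :
    Convex ℝ (drawingFace G S.pos p) := by
  obtain ⟨c, -, -, h⟩ := S.face_inscribed p hp
  rw [h]
  exact (convex_convexHull ℝ _).interior

theorem isOpen_face {p : ℂ} (hp : p ∉ graphDrawing G S.pos) :
    IsOpen (drawingFace G S.pos p) := by
  obtain ⟨c, -, -, h⟩ := S.face_inscribed p hp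
  rw [h]
  exact isOpen_interior

theorem convex_subset_face {A : Set ℂ} (hA : Convex ℝ A) {p q : ℂ}
    (hAd : Disjoint A (graphDrawing G S.pos)) (hq : q ∈ A) (hqp : q ∈ drawingFace G S.pos p) :
    A ⊆ drawingFace G S.pos p := by
  have h1 := hA.isPreconnected.subset_connectedComponentIn hq
    (Set.subset_compl_iff_disjoint_right.2 hAd)
  unfold drawingFace at *
  rwa [connectedComponentIn_eq hqp]

theorem face_eq_of_mem {p q z : ℂ} (hp : z ∈ drawingFace G S.pos p)
    (hq : z ∈ drawingFace G S.pos q) : drawingFace G S.pos p = drawingFace G S.pos q :=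
  (connectedComponentIn_eq hp).trans (connectedComponentIn_eq hq).symm

theorem notMem_drawing_of_mem_face {p z : ℂ} (hz : z ∈ drawingFace G S.pos p) :
    z ∉ graphDrawing G S.pos := connectedComponentIn_subset _ _ hz

/-- Around an isolated vertex a punctured disc would lie in a single face. Faces are convex, so that
face would contain the midpoint of two opposite points of the disc, which is the vertex itself. -/
theorem exists_adj (S : IsoradialEmbedding G) (x : V) : ∃ y, G.Adj x y := by
  by_contra! hx
  set B : Set (V × V) := {p | G.Adj p.1 p.2}
  set C := S.pos '' {x}ᶜ ∪ ⋃ p : B, segment ℝ (S.pos p.1.1) (S.pos p.1.2) with hC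
  have hclosed : IsClosed C := S.isClosed_partial_drawing _ B fun p hp => hp
  have hsub : graphDrawing G S.pos ⊆ insert (S.pos x) C := by
    rintro z (⟨v, rfl⟩ | ⟨a, b, hab, hz⟩)
    · by_cases hv : v = x
      · rw [hv]; exact Set.mem_insert _ _
      · exact Or.inr (Or.inl ⟨v, hv, rfl⟩)
    · exact Or.inr (Or.inr (Set.mem_iUnion.2 ⟨⟨(a, b), hab⟩, hz⟩))
  have hxC : S.pos x ∉ C := by
    rintro (⟨v, hv, hvx⟩ | h)
    · exact hv (S.pos_injective hvx)
    · obtain ⟨⟨⟨a, b⟩, hab⟩, hz⟩ := Set.mem_iUnion.1 h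
      have hab' : G.Adj a b := hab
      simp only at hz
      rw [← insert_endpoints_openSegment] at hz
      rcases hz with h | h | h
      · obtain rfl := S.pos_injective h
        exact hx _ hab'
      · obtain rfl := S.pos_injective h
        exact hx _ hab'.symm
      · exact S.vertex_notMem_edge a b x hab' h
  obtain ⟨r, hr, hball⟩ := Metric.isOpen_iff.1 hclosed.isOpen_compl _ hxC
  have hdisj : ∀ z : ℂ, z ≠ 0 → ‖z‖ < r → S.pos x + z ∉ graphDrawing G S.pos := by
    intro z hz hzr hmem
    rcases hsub hmem with h | h
    · exact hz (by simpa using h)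
    · exact hball (by simpa [Metric.mem_ball, Complex.dist_eq] using hzr) h
  have hseg : ∀ a b : ℂ, ‖a‖ < r → ‖b‖ < r → 0 ∉ segment ℝ a b →
      S.pos x + b ∈ drawingFace G S.pos (S.pos x + a) := by
    intro a b ha hb h0
    have ha0 : a ≠ 0 := fun h => h0 (h ▸ left_mem_segment ℝ a b)
    refine S.convex_subset_face (A := (fun z => S.pos x + z) '' segment ℝ a b) ?_ ?_
      ⟨a, left_mem_segment _ _ _, rfl⟩ (mem_connectedComponentIn (hdisj a ha0 ha))
      ⟨b, right_mem_segment _ _ _, rfl⟩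
    · exact (convex_segment a b).translate (S.pos x)
    · rw [Set.disjoint_left]
      rintro _ ⟨z, hz, rfl⟩
      refine hdisj z (fun h => h0 (h ▸ hz)) ?_
      have := (convex_ball (0 : ℂ) r).segment_subset (mem_ball_zero_iff.2 ha)
        (mem_ball_zero_iff.2 hb) hz
      simpa using this
  set s : ℝ := r / 2 with hs
  have hs0 : 0 < s := by positivity
  have hsr : |s| < r := by rw [abs_of_pos hs0]; linarith
  have h1 := hseg (s : ℂ) (s * I) (by simpa using hsr) (by simpa using hsr) (by
    rintro ⟨a, b, ha, hb, hab, h⟩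
    have h2 := congrArg Complex.re h
    have h3 := congrArg Complex.im h
    simp at h2 h3
    rcases h2 with h2 | h2 <;> rcases h3 with h3 | h3 <;> linarith)
  have h2 := hseg (s * I) (-s : ℂ) (by simpa using hsr) (by simpa using hsr) (by
    rintro ⟨a, b, ha, hb, hab, h⟩
    have h2 := congrArg Complex.re h
    have h3 := congrArg Complex.im h
    simp at h2 h3
    rcases h2 with h2 | h2 <;> rcases h3 with h3 | h3 <;> linarith)
  have hp : S.pos x + (s : ℂ) ∉ graphDrawing G S.pos :=
    hdisj _ (by exact_mod_cast hs0.ne') (by simpa using hsr)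
  have h3 : S.pos x + (-s : ℂ) ∈ drawingFace G S.pos (S.pos x + s) := by
    have := connectedComponentIn_eq h1
    unfold drawingFace at *
    rw [this]; exact h2
  have h4 : S.pos x + (s : ℂ) ∈ drawingFace G S.pos (S.pos x + s) := mem_connectedComponentIn hp
  have h5 := S.convex_face hp h4 h3 (show (0 : ℝ) ≤ 1 / 2 by norm_num)
    (show (0 : ℝ) ≤ 1 / 2 by norm_num) (by norm_num)
  have h6 : (1 / 2 : ℝ) • (S.pos x + (s : ℂ)) + (1 / 2 : ℝ) • (S.pos x + (-s : ℂ)) = S.pos x := by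
    simp only [Complex.real_smul]; push_cast; ring
  rw [h6] at h5
  exact S.notMem_drawing_of_mem_face h5 (S.pos_mem_drawing x)

/-- Thin strips on the left of an edge, away from its ends, are disjoint from the drawing. -/
theorem exists_strip {x y : V} (h : G.Adj x y) {a : ℝ} (ha : 0 < a) :
    ∃ δ > (0 : ℝ), ∀ t ∈ Set.Icc a (1 - a), ∀ s ∈ Set.Ioo 0 δ,
      S.pos x + (t + s * I) * (S.pos y - S.pos x) ∉ graphDrawing G S.pos := by
  set u := S.pos y - S.pos x with hu
  have hu0 : u ≠ 0 := sub_ne_zero.2 fun h' => h.ne (S.pos_injective h').symm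
  set B : Set (V × V) := {p | G.Adj p.1 p.2 ∧ s(p.1, p.2) ≠ s(x, y)}
  -- All vertices and all other edges form a closed set missing the compact middle part of the edge,
  -- hence they stay at a positive distance from it.
  set C := S.pos '' Set.univ ∪ ⋃ p : B, segment ℝ (S.pos p.1.1) (S.pos p.1.2) with hC
  have hclosed : IsClosed C := S.isClosed_partial_drawing _ B fun p hp => hp.1
  set K := (fun t : ℝ => S.pos x + t * u) '' Set.Icc a (1 - a) with hK
  have hKc : IsCompact K := isCompact_Icc.image (by fun_prop)
  have hKseg : K ⊆ openSegment ℝ (S.pos x) (S.pos y) := by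
    rintro _ ⟨t, ht, rfl⟩
    rw [openSegment_eq_image']
    exact ⟨t, ⟨by linarith [ht.1], by linarith [ht.2]⟩, by simp [hu]⟩
  have hKC : K ⊆ Cᶜ := by
    rintro z hz (⟨v, -, rfl⟩ | hz')
    · exact S.vertex_notMem_edge x y v h (hKseg hz)
    · obtain ⟨⟨⟨p, q⟩, hpq, hne⟩, hzpq⟩ := Set.mem_iUnion.1 hz'
      simp only at hzpq hpq hne
      rw [← insert_endpoints_openSegment] at hzpq
      rcases hzpq with rfl | h' | h'
      · exact S.vertex_notMem_edge x y p h (hKseg hz)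
      · rw [Set.mem_singleton_iff.1 h'] at hz
        exact S.vertex_notMem_edge x y q h (hKseg hz)
      · exact Set.disjoint_left.1 (S.edges_disjoint p q x y hpq h hne) h' (hKseg hz)
  obtain ⟨δ, hδ, hthick⟩ := hKc.exists_thickening_subset_open hclosed.isOpen_compl hKC
  have hun : 0 < ‖u‖ := norm_pos_iff.2 hu0
  refine ⟨δ / ‖u‖, by positivity, fun t ht s hs hmem => ?_⟩
  have hz : S.pos x + (t + s * I) * u ∉ C := hthick (Metric.mem_thickening_iff.2
    ⟨S.pos x + t * u, ⟨t, ht, rfl⟩, by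
      rw [Complex.dist_eq, show S.pos x + (t + s * I) * u - (S.pos x + t * u) = s * I * u by ring,
        norm_mul, norm_mul, Complex.norm_I, mul_one, Complex.norm_real, Real.norm_eq_abs,
        abs_of_pos hs.1]
      exact (lt_div_iff₀ hun).1 hs.2⟩)
  have hline : S.pos x + (t + s * I) * u ∉ segment ℝ (S.pos x) (S.pos y) := by
    rw [segment_eq_image']
    rintro ⟨r, -, hr⟩
    have h1 : ((r : ℂ) - (t + s * I)) * u = 0 := by
      simp only [Complex.real_smul, ← hu] at hr
      linear_combination hr
    have h2 := (mul_eq_zero.1 h1).resolve_right hu0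
    have h3 := congrArg Complex.im h2
    simp at h3
    exact hs.1.ne' h3
  rcases hmem with ⟨v, hv⟩ | ⟨p, q, hpq, hzpq⟩
  · exact hz (Or.inl ⟨v, trivial, hv⟩)
  · by_cases hne : s(p, q) = s(x, y)
    · rcases Sym2.eq_iff.1 hne with ⟨rfl, rfl⟩ | ⟨rfl, rfl⟩
      · exact hline hzpq
      · rw [segment_symm] at hzpq
        exact hline hzpq
    · exact hz (Or.inr (Set.mem_iUnion.2 ⟨⟨(p, q), hpq, hne⟩, hzpq⟩))

/-- `p` represents the face on the left of the oriented edge `x y`. -/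
def IsLeftFace (x y : V) (p : ℂ) : Prop :=
  p ∉ graphDrawing G S.pos ∧ ∀ t ∈ Set.Ioo (0 : ℝ) 1, ∃ δ > (0 : ℝ), ∀ s ∈ Set.Ioo 0 δ,
    S.pos x + (t + s * I) * (S.pos y - S.pos x) ∈ drawingFace G S.pos p

theorem convex_strip (x u : ℂ) (a b δ : ℝ) :
    Convex ℝ {z : ℂ | ∃ t ∈ Set.Icc a b, ∃ s ∈ Set.Ioo 0 δ, z = x + ((t : ℂ) + (s : ℂ) * I) * u} := by
  rintro _ ⟨t, ht, s, hs, rfl⟩ _ ⟨t', ht', s', hs', rfl⟩ α β hα hβ hαβ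
  refine ⟨α * t + β * t', convex_Icc a b ht ht' hα hβ hαβ, α * s + β * s',
    convex_Ioo 0 δ hs hs' hα hβ hαβ, ?_⟩
  have : (α : ℂ) + β = 1 := by exact_mod_cast hαβ
  simp only [Complex.real_smul]
  push_cast
  linear_combination x * this

/-- A thin strip along the edge is convex and avoids the drawing, so it lies in one face. Strips
reaching closer to the ends are thinner, but they all overlap near the midpoint of the edge. -/
theorem exists_isLeftFace {x y : V} (h : G.Adj x y) : ∃ p, S.IsLeftFace x y p := by
  set u := S.pos y - S.pos x with hu
  obtain ⟨δ₀, hδ₀, h0⟩ := S.exists_strip h (show (0 : ℝ) < 1 / 4 by norm_num)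
  set p : ℂ := S.pos x + (((1 / 2 : ℝ) : ℂ) + ((δ₀ / 2 : ℝ) : ℂ) * I) * u with hp
  have hpd : p ∉ graphDrawing G S.pos :=
    h0 _ ⟨by norm_num, by norm_num⟩ _ ⟨by linarith, by linarith⟩
  refine ⟨p, hpd, fun t ht => ?_⟩
  have strip : ∀ {a : ℝ} {δ : ℝ}, (∀ t ∈ Set.Icc a (1 - a), ∀ s ∈ Set.Ioo 0 δ,
      S.pos x + (t + s * I) * u ∉ graphDrawing G S.pos) →
      ∀ t ∈ Set.Icc a (1 - a), ∀ s ∈ Set.Ioo 0 δ, ∀ t' ∈ Set.Icc a (1 - a), ∀ s' ∈ Set.Ioo 0 δ,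
      S.pos x + (t + s * I) * u ∈ drawingFace G S.pos p →
      S.pos x + (t' + s' * I) * u ∈ drawingFace G S.pos p := by
    intro a δ hs t ht s hs1 t' ht' s' hs' hmem
    refine S.convex_subset_face (convex_strip (S.pos x) u a (1 - a) δ) ?_ ⟨t, ht, s, hs1, rfl⟩ hmem
      ⟨t', ht', s', hs', rfl⟩
    rw [Set.disjoint_left]
    rintro _ ⟨t, ht, s, hs1, rfl⟩
    exact hs t ht s hs1
  obtain ⟨δ₁, hδ₁, h1⟩ := S.exists_strip h (a := min t (1 - t))
    (lt_min ht.1 (by linarith [ht.2]))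
  refine ⟨δ₁, hδ₁, fun s hs => ?_⟩
  have hm1 := min_le_left t (1 - t)
  have hm2 := min_le_right t (1 - t)
  set s₀ := min δ₀ δ₁ / 2 with hs₀
  have hs₀pos : 0 < s₀ := by have := lt_min hδ₀ hδ₁; positivity
  have hs₀0 : s₀ < δ₀ := by have := min_le_left δ₀ δ₁; linarith
  have hs₀1 : s₀ < δ₁ := by have := min_le_right δ₀ δ₁; linarith
  have e1 := strip h0 (1 / 2) ⟨by norm_num, by norm_num⟩ (δ₀ / 2) ⟨by linarith, by linarith⟩
    (1 / 2) ⟨by norm_num, by norm_num⟩ s₀ ⟨hs₀pos, hs₀0⟩ (mem_connectedComponentIn hpd)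
  exact strip h1 (1 / 2) ⟨by linarith, by linarith⟩ s₀ ⟨hs₀pos, hs₀1⟩
    t ⟨hm1, by linarith⟩ s hs e1

theorem IsLeftFace.mem_closure {S : IsoradialEmbedding G} {x y : V} {p : ℂ}
    (hp : S.IsLeftFace x y p) {t : ℝ} (ht : t ∈ Set.Icc (0 : ℝ) 1) :
    S.pos x + t * (S.pos y - S.pos x) ∈ closure (drawingFace G S.pos p) := by
  have h1 : Set.MapsTo (fun t : ℝ => S.pos x + t * (S.pos y - S.pos x)) (Set.Ioo 0 1)
      (closure (drawingFace G S.pos p)) := by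
    intro t ht
    obtain ⟨δ, hδ, h⟩ := hp.2 t ht
    have h2 : Set.MapsTo (fun s : ℝ => S.pos x + (t + s * I) * (S.pos y - S.pos x)) (Set.Ioo 0 δ)
      (drawingFace G S.pos p) := h
    have h3 := h2.closure (by fun_prop)
    rw [closure_Ioo hδ.ne] at h3
    simpa using h3 ⟨le_rfl, hδ.le⟩
  have h3 := h1.closure (by fun_prop)
  rw [closure_Ioo (by norm_num), closure_closure] at h3
  exact h3 ht

theorem IsLeftFace.left_mem_closure {S : IsoradialEmbedding G} {x y : V} {p : ℂ}
    (hp : S.IsLeftFace x y p) : S.pos x ∈ closure (drawingFace G S.pos p) := by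
  simpa using hp.mem_closure (t := 0) (by simp)

theorem IsLeftFace.right_mem_closure {S : IsoradialEmbedding G} {x y : V} {p : ℂ}
    (hp : S.IsLeftFace x y p) : S.pos y ∈ closure (drawingFace G S.pos p) := by
  simpa using hp.mem_closure (t := 1) (by simp)

theorem face_subset_ball {p c : ℂ} (hp : p ∉ graphDrawing G S.pos)
    (hc : ∀ v : V, S.pos v ∈ closure (drawingFace G S.pos p) → dist (S.pos v) c = 1)
    (hF : drawingFace G S.pos p =
      interior (convexHull ℝ (Set.range S.pos ∩ closure (drawingFace G S.pos p)))) :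
    drawingFace G S.pos p ⊆ Metric.ball c 1 := by
  have h1 : drawingFace G S.pos p ⊆ Metric.closedBall c 1 := by
    rw [hF]
    refine interior_subset.trans (convexHull_min ?_ (convex_closedBall c 1))
    rintro _ ⟨⟨v, rfl⟩, hv⟩
    exact (hc v hv).le
  rw [← interior_closedBall c one_ne_zero]
  exact (S.isOpen_face hp).subset_interior_iff.2 h1

/-- A face lies on one side of each of its edges. -/
theorem IsLeftFace.im_pos {S : IsoradialEmbedding G} {x y : V} (h : G.Adj x y) {p : ℂ}
    (hp : S.IsLeftFace x y p) {z : ℂ} (hz : z ∈ drawingFace G S.pos p) :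
    0 < ((z - S.pos x) / (S.pos y - S.pos x)).im := by
  obtain ⟨c, -, hc, hF⟩ := S.face_inscribed p hp.1
  have hball := S.face_subset_ball hp.1 hc hF
  have hx := hc x hp.left_mem_closure
  have hy := hc y hp.right_mem_closure
  set u := S.pos y - S.pos x with hu
  have hu0 : u ≠ 0 := sub_ne_zero.2 fun h' => h.ne (S.pos_injective h').symm
  have hxu : S.pos x + u = S.pos y := by rw [hu]; ring
  by_contra! hle
  obtain ⟨δ, hδ, hs⟩ := hp.2 (1 / 2) ⟨by norm_num, by norm_num⟩
  have hq := hs (δ / 2) ⟨by linarith, by linarith⟩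
  set q := S.pos x + (((1 / 2 : ℝ) : ℂ) + ((δ / 2 : ℝ) : ℂ) * I) * u with hqdef
  have hqim : ((q - S.pos x) / u).im = δ / 2 := by
    rw [hqdef, add_sub_cancel_left, mul_div_cancel_right₀ _ hu0]
    simp
  set α := ((z - S.pos x) / u).im with hα
  -- The parameter at which the segment from `z` to `q` meets the line through `x` and `y`. The
  -- crossing point is in the face, hence in the open unit disc, hence strictly between `x` and `y`:
  -- it would be on the edge.
  set b : ℝ := -α / (δ / 2 - α) with hb
  have hden : 0 < δ / 2 - α := by linarith
  have hb0 : 0 ≤ b := div_nonneg (by linarith) hden.le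
  have hb1 : b ≤ 1 := (div_le_one hden).2 (by linarith)
  have hw := S.convex_face hp.1 hz hq (sub_nonneg.2 hb1) hb0 (by ring)
  set w := (1 - b) • z + b • q with hwdef
  have hwim : ((w - S.pos x) / u).im = 0 := by
    have e1 : (w - S.pos x) / u = (1 - b : ℝ) * ((z - S.pos x) / u) + (b : ℝ) * ((q - S.pos x) / u) := by
      rw [hwdef]; simp only [Complex.real_smul]; push_cast; field_simp; ring
    rw [e1, Complex.add_im, Complex.im_ofReal_mul, Complex.im_ofReal_mul, hqim, ← hα]
    have : b * (δ / 2 - α) = -α := div_mul_cancel₀ _ hden.ne'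
    linarith
  set t := ((w - S.pos x) / u).re with ht
  have hwt : w = S.pos x + t * u := by
    have : (w - S.pos x) / u = t := Complex.ext (by simp [ht]) (by simp [hwim])
    rw [← this, div_mul_cancel₀ _ hu0]; ring
  have h1 := dist_sq_line hx (by rwa [hxu]) t
  rw [← hwt] at h1
  have h2 : dist w c < 1 := hball hw
  have h3 : dist w c ^ 2 < 1 := by nlinarith [dist_nonneg (x := w) (y := c)]
  have hun : 0 < ‖u‖ ^ 2 := by have := norm_pos_iff.2 hu0; positivity
  have h4 : t * (t - 1) < 0 := by
    by_contra! h5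
    nlinarith [mul_nonneg h5 hun.le]
  have ht0 : 0 < t := by nlinarith
  have ht1 : t < 1 := by nlinarith
  refine S.notMem_drawing_of_mem_face hw (S.segment_subset_drawing h (openSegment_subset_segment _ _ _ ?_))
  rw [openSegment_eq_image']
  exact ⟨t, ⟨ht0, ht1⟩, by simp [hwt, hu]⟩

/-- A common left face puts each of `y`, `y'` weakly to the left of the line from `x` to the other,
so `x`, `y`, `y'` are collinear. They are also on one circle, which a line meets at most twice. -/
theorem IsLeftFace.eq_of_face_eq {S : IsoradialEmbedding G} {x y y' : V} (h : G.Adj x y)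
    (h' : G.Adj x y') {p p' : ℂ} (hp : S.IsLeftFace x y p) (hp' : S.IsLeftFace x y' p')
    (heq : drawingFace G S.pos p = drawingFace G S.pos p') : y = y' := by
  obtain ⟨c, -, hc, -⟩ := S.face_inscribed p hp.1
  have hx := hc x hp.left_mem_closure
  have hy := hc y hp.right_mem_closure
  have hy' := hc y' (heq ▸ hp'.right_mem_closure)
  have hnonneg : ∀ {y y' : V} {p : ℂ}, G.Adj x y → S.IsLeftFace x y p →
      S.pos y' ∈ closure (drawingFace G S.pos p) →
      0 ≤ ((S.pos y' - S.pos x) / (S.pos y - S.pos x)).im := by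
    intro y y' p h hp hy'
    have hclosed : IsClosed {z : ℂ | 0 ≤ ((z - S.pos x) / (S.pos y - S.pos x)).im} :=
      isClosed_le continuous_const (by fun_prop)
    exact closure_minimal (fun z hz => (hp.im_pos h hz).le) hclosed hy'
  have h1 := hnonneg h hp (heq ▸ hp'.right_mem_closure)
  have h2 := hnonneg h' hp' (heq ▸ hp.right_mem_closure)
  have hu0 : S.pos y - S.pos x ≠ 0 := sub_ne_zero.2 fun h' => h.ne (S.pos_injective h').symm
  have hu0' : S.pos y' - S.pos x ≠ 0 :=
    sub_ne_zero.2 fun h'' => h'.ne (S.pos_injective h'').symm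
  set u := S.pos y - S.pos x with hu
  set u' := S.pos y' - S.pos x with hu'
  have him : (u' / u).im = 0 := by
    refine le_antisymm ?_ h1
    rw [← inv_div, Complex.inv_im] at h2
    by_contra! h3
    have h4 : 0 < Complex.normSq (u' / u) := Complex.normSq_pos.2 (div_ne_zero hu0' hu0)
    have := div_neg_of_neg_of_pos (neg_lt_zero.2 h3) h4
    linarith
  set t := (u' / u).re with ht
  have hut : u' = t * u := by
    have : u' / u = t := Complex.ext (by simp [ht]) (by simp [him])
    rw [← this, div_mul_cancel₀ _ hu0]
  have h3 := dist_sq_line hx (u := u) (by rw [hu]; simpa using hy) t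
  rw [← hut, show S.pos x + u' = S.pos y' by rw [hu']; ring, hy'] at h3
  have hun : ‖u‖ ^ 2 ≠ 0 := pow_ne_zero 2 (norm_ne_zero_iff.2 hu0)
  have h4 : t * (t - 1) = 0 := by
    refine (mul_eq_zero.1 ?_).resolve_right hun
    linarith
  rcases mul_eq_zero.1 h4 with h5 | h5
  · rw [h5] at hut
    exact absurd (by simpa using hut) hu0'
  · have h6 : t = 1 := by linarith
    rw [h6, Complex.ofReal_one, one_mul] at hut
    exact S.pos_injective (sub_left_injective hut).symm

/-- The left face of an edge contains a ball of controlled radius close to the edge. -/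
theorem IsLeftFace.exists_ball_subset {S : IsoradialEmbedding G} {x y : V} (h : G.Adj x y)
    {p : ℂ} (hp : S.IsLeftFace x y p) {l L : ℝ} (hl : 0 < l) (hL : L < 2)
    (hlu : l ≤ dist (S.pos x) (S.pos y)) (huL : dist (S.pos x) (S.pos y) ≤ L) :
    ∃ b : ℂ, dist b (S.pos x) ≤ 1 ∧
      Metric.ball b (l * min (1 / 8) (Real.sqrt (1 / L ^ 2 - 1 / 4) / 8)) ⊆
        drawingFace G S.pos p := by
  obtain ⟨c, hcF, hc, hF⟩ := S.face_inscribed p hp.1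
  have hx := hc x hp.left_mem_closure
  have hy := hc y hp.right_mem_closure
  have hu0 : S.pos y - S.pos x ≠ 0 := sub_ne_zero.2 fun h' => h.ne (S.pos_injective h').symm
  have him := hp.im_pos h hcF
  rw [dist_comm, Complex.dist_eq] at hlu huL
  set u := S.pos y - S.pos x with hu
  have hun := norm_pos_iff.2 hu0
  have hxu : S.pos x + u = S.pos y := by rw [hu]; ring
  set ζ := (c - S.pos x) / u with hζ
  have hcζ : c = S.pos x + ζ * u := by rw [hζ, div_mul_cancel₀ _ hu0]; ring
  have n1 : ‖ζ‖ ^ 2 = 1 / ‖u‖ ^ 2 := by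
    rw [hζ, norm_div, div_pow, ← Complex.dist_eq, dist_comm, hx, one_pow]
  have n2 : ‖ζ - 1‖ ^ 2 = 1 / ‖u‖ ^ 2 := by
    have : ζ - 1 = (c - S.pos y) / u := by
      rw [hζ, ← hxu]; field_simp; ring
    rw [this, norm_div, div_pow, ← Complex.dist_eq, dist_comm, hy, one_pow]
  have n3 := n1
  rw [Complex.sq_norm, Complex.normSq_apply] at n1 n2
  simp only [sub_re, sub_im, one_re, one_im, sub_zero] at n2
  -- In the frame of the edge the centre `c` is equidistant from `0` and `1`. The length bound `L <
  -- 2` then keeps its height away from `0`.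
  have hre : ζ.re = 1 / 2 := by linarith
  rw [hre] at n1
  have hLpos : 0 < L := hun.trans_le huL
  have hL4 : 1 / L ^ 2 ≤ 1 / ‖u‖ ^ 2 := by gcongr
  have hLpos' : 0 < 1 / L ^ 2 - 1 / 4 := by
    have : (1 : ℝ) / 4 < 1 / L ^ 2 := by
      apply one_div_lt_one_div_of_lt (by positivity)
      nlinarith
    linarith
  have hη : Real.sqrt (1 / L ^ 2 - 1 / 4) ≤ ζ.im := Real.sqrt_le_iff.2 ⟨him.le, by nlinarith⟩
  have hcζ' : c = S.pos x + (1 / 2 + ζ.im * I) * u := by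
    have : ζ = 1 / 2 + ζ.im * I := Complex.ext (by simp [hre]) (by simp)
    rw [← this]; exact hcζ
  refine ⟨S.pos x + (1 / 2 + ζ.im / 2 * I) * u, ?_, ?_⟩
  · have e1 : S.pos x + (1 / 2 + ζ.im / 2 * I) * u - S.pos x = (c - S.pos x) / 2 + u / 4 := by
      rw [hcζ']; ring
    have e2 : ‖c - S.pos x‖ = 1 := by rw [← Complex.dist_eq, dist_comm]; exact hx
    rw [Complex.dist_eq, e1]
    refine (norm_add_le _ _).trans ?_
    rw [norm_div, norm_div, e2]
    norm_num
    linarith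
  · have hconv := S.convex_face hp.1
    have hopen := S.isOpen_face hp.1
    have hint : interior (drawingFace G S.pos p) = drawingFace G S.pos p := hopen.interior_eq
    -- The ends of the edge belong only to the closure of the face, so the ball is first found in
    -- the closure. An open convex set is the interior of its closure.
    have h1 := hconv.interior_closure_eq_interior_of_nonempty_interior
      (hint.symm ▸ ⟨c, hcF⟩)
    rw [← hint, ← h1]
    refine Metric.isOpen_ball.subset_interior_iff.2 fun z hz => ?_
    exact mem_convexHull_of_near hconv.closure hl hlu (Real.sqrt_pos.2 hLpos') hη
      hp.left_mem_closure (by rw [hxu]; exact hp.right_mem_closure) (subset_closure hcF) hcζ' hz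

/-- A packing argument: distinct neighbours give distinct left faces, hence disjoint balls of the
same radius `r` centred within distance `1` of `x`. The bound is the size of an `r/2`-net of the
unit disc. -/
theorem exists_degree_bound {l L : ℝ} (hl : 0 < l) (hL0 : 0 < L) (hL : L < 2)
    (hS : ∀ x y, G.Adj x y → l ≤ dist (S.pos x) (S.pos y) ∧ dist (S.pos x) (S.pos y) ≤ L) :
    ∃ D : ℕ, ∀ x, (G.neighborSet x).Finite ∧ (G.neighborSet x).ncard ≤ D := by
  set r := l * min (1 / 8) (Real.sqrt (1 / L ^ 2 - 1 / 4) / 8) with hr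
  have hr0 : 0 < r := by
    have : 0 < 1 / L ^ 2 - 1 / 4 := by
      have : (1 : ℝ) / 4 < 1 / L ^ 2 := by
        apply one_div_lt_one_div_of_lt (by positivity)
        nlinarith
      linarith
    have := Real.sqrt_pos.2 this
    have : 0 < min (1 / 8) (Real.sqrt (1 / L ^ 2 - 1 / 4) / 8) := lt_min (by norm_num) (by positivity)
    positivity
  obtain ⟨T, hT, hcover⟩ := Metric.totallyBounded_iff.1
    (isCompact_closedBall (0 : ℂ) 1).totallyBounded (r / 2) (by positivity)
  refine ⟨T.ncard, fun x => ?_⟩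
  have h1 : ∀ y ∈ G.neighborSet x, ∃ p b : ℂ, S.IsLeftFace x y p ∧ dist b (S.pos x) ≤ 1 ∧
      Metric.ball b r ⊆ drawingFace G S.pos p := by
    intro y hy
    obtain ⟨p, hp⟩ := S.exists_isLeftFace hy
    obtain ⟨b, hb1, hb2⟩ := hp.exists_ball_subset hy hl hL (hS x y hy).1 (hS x y hy).2
    exact ⟨p, b, hp, hb1, hb2⟩
  choose! p b hp hb1 hb2 using h1
  have h2 : ∀ y ∈ G.neighborSet x, ∃ τ ∈ T, dist (b y - S.pos x) τ < r / 2 := by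
    intro y hy
    have : b y - S.pos x ∈ Metric.closedBall (0 : ℂ) 1 := by
      rw [mem_closedBall_zero_iff, ← Complex.dist_eq]; exact hb1 y hy
    simpa using hcover this
  choose! τ hτ1 hτ2 using h2
  have hinj : Set.InjOn τ (G.neighborSet x) := by
    intro y hy y' hy' hyy
    have h3 := hτ2 y hy
    have h4 := hτ2 y' hy'
    rw [← hyy] at h4
    have h5 : dist (b y') (b y) < r := by
      have := dist_triangle_right (b y' - S.pos x) (b y - S.pos x) (τ y)
      rw [dist_sub_right] at this
      linarith
    have h6 : b y' ∈ drawingFace G S.pos (p y) := hb2 y hy h5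
    have h7 : b y' ∈ drawingFace G S.pos (p y') := hb2 y' hy' (Metric.mem_ball_self hr0)
    exact (hp y hy).eq_of_face_eq hy hy' (hp y' hy') (S.face_eq_of_mem h6 h7)
  exact ⟨Set.Finite.of_finite_image (hT.subset (Set.image_subset_iff.2 hτ1)) hinj,
    Set.ncard_le_ncard_of_injOn τ hτ1 hinj hT⟩

end IsoradialEmbedding

end Geometry

/-! ### The massive Laplacian on `ℓ²` and the Green function. -/

section Operator

/-- **Schur test** for a symmetric matrix with nonnegative entries. -/
theorem exists_schur_operator {V : Type*} (Q : V → V → ℝ) (N : V → Finset V) (q : ℝ)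
    (hQ : ∀ x y, 0 ≤ Q x y) (hN : ∀ x y, Q x y ≠ 0 → y ∈ N x) (hsymm : ∀ x y, Q x y = Q y x)
    (hrow : ∀ x, ∑ y ∈ N x, Q x y ≤ q) (hq : 0 ≤ q) :
    ∃ T : lp (fun _ : V => ℝ) 2 →L[ℝ] lp (fun _ : V => ℝ) 2, ‖T‖ ≤ q ∧
      ∀ f x, (T f : V → ℝ) x = ∑ y ∈ N x, Q x y * f y := by
  classical
  have h2 : (2 : ENNReal).toReal = 2 := by simp
  have hcol : ∀ (s : Finset V) (y : V), ∑ x ∈ s, Q x y ≤ q := by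
    intro s y
    refine le_trans ?_ (hrow y)
    rw [← Finset.sum_filter_ne_zero]
    simp only [fun x => hsymm x y]
    refine Finset.sum_le_sum_of_subset_of_nonneg (fun x hx => ?_) fun x _ _ => hQ y x
    exact hN y x (Finset.mem_filter.1 hx).2
  have hbound : ∀ (f : lp (fun _ : V => ℝ) 2) (s : Finset V),
      ∑ x ∈ s, ‖∑ y ∈ N x, Q x y * f y‖ ^ (2 : ENNReal).toReal ≤
        (q * ‖f‖) ^ (2 : ENNReal).toReal := by
    intro f s
    rw [h2]
    norm_cast
    -- Cauchy–Schwarz with weights `Q x y`, one factor being the row sum. By symmetry the column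
    -- sums supply the second factor `q`.
    have h3 : ∀ x, ‖∑ y ∈ N x, Q x y * f y‖ ^ 2 ≤ q * ∑ y ∈ N x, Q x y * (f y) ^ 2 := by
      intro x
      rw [Real.norm_eq_abs, sq_abs]
      refine (Finset.sum_sq_le_sum_mul_sum_of_sq_le_mul (N x) (f := fun y => Q x y)
        (g := fun y => Q x y * (f y) ^ 2) (fun y _ => hQ x y)
        (fun y _ => mul_nonneg (hQ x y) (sq_nonneg _)) (fun y _ => le_of_eq (by ring))).trans ?_
      exact mul_le_mul_of_nonneg_right (hrow x)
        (Finset.sum_nonneg fun y _ => mul_nonneg (hQ x y) (sq_nonneg _))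
    set s' := s.biUnion N with hs'
    have h4 : ∀ x ∈ s, ∑ y ∈ N x, Q x y * (f y) ^ 2 = ∑ y ∈ s', Q x y * (f y) ^ 2 := by
      intro x hx
      refine Finset.sum_subset (Finset.subset_biUnion_of_mem N hx) fun y _ hy => ?_
      have : Q x y = 0 := by
        by_contra h
        exact hy (hN x y h)
      rw [this, zero_mul]
    calc ∑ x ∈ s, ‖∑ y ∈ N x, Q x y * f y‖ ^ 2
        ≤ ∑ x ∈ s, q * ∑ y ∈ N x, Q x y * (f y) ^ 2 := Finset.sum_le_sum fun x _ => h3 x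
      _ = q * ∑ y ∈ s', (∑ x ∈ s, Q x y) * (f y) ^ 2 := by
          rw [← Finset.mul_sum, Finset.sum_congr rfl h4, Finset.sum_comm]
          simp only [Finset.sum_mul]
      _ ≤ q * ∑ y ∈ s', q * (f y) ^ 2 := by
          gcongr with y _
          exact hcol s y
      _ = q * (q * ∑ y ∈ s', (f y) ^ 2) := by rw [← Finset.mul_sum]
      _ ≤ q * (q * ‖f‖ ^ 2) := by
          gcongr
          have := lp.sum_rpow_le_norm_rpow (p := 2) (by simp) f s'
          rw [h2] at this
          norm_cast at this
          simpa using this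
      _ = (q * ‖f‖) ^ 2 := by ring
  refine ⟨LinearMap.mkContinuous
    { toFun := fun f => ⟨fun x => ∑ y ∈ N x, Q x y * f y, memℓp_gen' (hbound f)⟩
      map_add' := fun f g => by
        ext x
        simp [mul_add, Finset.sum_add_distrib]
        rfl
      map_smul' := fun a f => by
        ext x
        simp [Finset.mul_sum, mul_left_comm] } q fun f => ?_,
    LinearMap.mkContinuous_norm_le _ hq _, fun f x => rfl⟩
  exact lp.norm_le_of_forall_sum_le (by simp) (by positivity) (hbound f)

variable {V : Type*} (G : SimpleGraph V)

/-- The massive Laplacian with conductances `c` and masses `m`. -/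
noncomputable def weightedLaplacian (c : V → V → ℝ) (m : V → ℝ) (f : V → ℝ) (x : V) : ℝ :=
  (∑ᶠ y ∈ G.neighborSet x, c x y * (f x - f y)) + m x * f x

/-- Uniformly bounded weights on a graph with bounded degrees. -/
structure BoundedWeights (c : V → V → ℝ) (m : V → ℝ) (r m₀ m₁ : ℝ) (D : ℕ) : Prop where
  symm : ∀ x y, c x y = c y x
  pos : ∀ x y, G.Adj x y → 0 < c x y
  le : ∀ x y, G.Adj x y → c x y ≤ r
  r_nonneg : 0 ≤ r
  m₀_pos : 0 < m₀
  le_mass : ∀ x, m₀ ≤ m x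
  mass_le : ∀ x, m x ≤ m₁
  finite : ∀ x, (G.neighborSet x).Finite
  ncard_le : ∀ x, (G.neighborSet x).ncard ≤ D

variable {G} {c : V → V → ℝ} {m : V → ℝ} {r m₀ m₁ : ℝ} {D : ℕ}

namespace BoundedWeights

theorem card_neighbors_le (h : BoundedWeights G c m r m₀ m₁ D) (x : V) :
    (h.finite x).toFinset.card ≤ D := by
  rw [← Set.ncard_eq_toFinset_card _ (h.finite x)]; exact h.ncard_le x

theorem sum_le (h : BoundedWeights G c m r m₀ m₁ D) (x : V) :
    ∑ y ∈ (h.finite x).toFinset, c x y ≤ D * r := by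
  refine (Finset.sum_le_card_nsmul _ _ r fun y hy => h.le x y (by simpa using hy)).trans ?_
  rw [nsmul_eq_mul]
  exact mul_le_mul_of_nonneg_right (by exact_mod_cast h.card_neighbors_le x) h.r_nonneg

theorem sum_nonneg (h : BoundedWeights G c m r m₀ m₁ D) (x : V) :
    0 ≤ ∑ y ∈ (h.finite x).toFinset, c x y :=
  Finset.sum_nonneg fun y hy => (h.pos x y (by simpa using hy)).le

theorem laplacian_eq (h : BoundedWeights G c m r m₀ m₁ D) (f : V → ℝ) (x : V) :
    weightedLaplacian G c m f x =
      (∑ y ∈ (h.finite x).toFinset, c x y + m x) * f x -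
        ∑ y ∈ (h.finite x).toFinset, c x y * f y := by
  rw [weightedLaplacian, finsum_mem_eq_finite_toFinset_sum _ (h.finite x)]
  simp only [mul_sub, Finset.sum_sub_distrib, ← Finset.sum_mul]
  ring

/-- The massive Laplacian is invertible on `ℓ²`. -/
theorem exists_inverse (h : BoundedWeights G c m r m₀ m₁ D) :
    ∃ T : lp (fun _ : V => ℝ) 2 →L[ℝ] lp (fun _ : V => ℝ) 2,
      (∀ f, weightedLaplacian G c m (T f : V → ℝ) = (f : V → ℝ)) ∧
      ∀ f : lp (fun _ : V => ℝ) 2, ∃ hf : Memℓp (weightedLaplacian G c m (f : V → ℝ)) 2,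
        T (⟨weightedLaplacian G c m (f : V → ℝ), hf⟩ : lp (fun _ : V => ℝ) 2) = f := by
  classical
  rcases isEmpty_or_nonempty V with hV | ⟨⟨x₀⟩⟩
  · refine ⟨0, fun f => Subsingleton.elim _ _, fun f => ⟨?_, ?_⟩⟩
    · have : weightedLaplacian G c m (f : V → ℝ) = f := Subsingleton.elim _ _
      rw [this]
      exact lp.memℓp f
    · ext x; exact hV.elim x
  have hm1 : 0 < m₁ := h.m₀_pos.trans_le ((h.le_mass x₀).trans (h.mass_le x₀))
  -- With this `lam` the matrix `Q = 1 - Δ/lam` has nonnegative entries and row sums `1 - m(x)/lam ≤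
  -- 1 - m₀/lam`. The Schur test makes it a strict contraction, and a Neumann series inverts `Δ =
  -- lam (1 - Q)`.
  set lam : ℝ := D * r + m₁ with hlam
  have hlam0 : 0 < lam := by have := h.r_nonneg; positivity
  have hm0lam : m₀ / lam ≤ 1 := (div_le_one hlam0).2 (by
    have := (h.le_mass x₀).trans (h.mass_le x₀)
    have : 0 ≤ D * r := mul_nonneg (by positivity) h.r_nonneg
    linarith)
  set Q : V → V → ℝ := fun x y =>
    if x = y then 1 - (∑ z ∈ (h.finite x).toFinset, c x z + m x) / lam
    else if G.Adj x y then c x y / lam else 0 with hQdef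
  have hnot : ∀ x, x ∉ (h.finite x).toFinset := fun x hx => by simp at hx
  have hsum : ∀ x (g : V → ℝ), ∑ y ∈ insert x (h.finite x).toFinset, Q x y * g y =
      g x - weightedLaplacian G c m g x / lam := by
    intro x g
    rw [Finset.sum_insert (hnot x), h.laplacian_eq]
    have h1 : ∑ y ∈ (h.finite x).toFinset, Q x y * g y =
        (∑ y ∈ (h.finite x).toFinset, c x y * g y) / lam := by
      rw [Finset.sum_div]
      refine Finset.sum_congr rfl fun y hy => ?_
      have hadj : G.Adj x y := by simpa using hy
      simp only [hQdef, if_neg hadj.ne, if_pos hadj]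
      ring
    rw [h1]
    simp only [hQdef, if_true]
    ring
  obtain ⟨A, hA, hAf⟩ := exists_schur_operator Q (fun x => insert x (h.finite x).toFinset)
    (1 - m₀ / lam)
    (by
      intro x y
      simp only [hQdef]
      split_ifs with h1 h2
      · rw [sub_nonneg, div_le_one hlam0]
        exact add_le_add (h.sum_le x) (h.mass_le x)
      · exact div_nonneg (h.pos x y h2).le hlam0.le
      · exact le_rfl)
    (by
      intro x y hxy
      by_cases h1 : x = y
      · rw [h1]; exact Finset.mem_insert_self _ _
      · by_cases h2 : G.Adj x y
        · exact Finset.mem_insert_of_mem (by simpa using h2)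
        · simp [hQdef, h1, h2] at hxy)
    (by
      intro x y
      simp only [hQdef]
      by_cases h1 : x = y
      · subst h1; rfl
      · rw [if_neg h1, if_neg (Ne.symm h1)]
        simp only [G.adj_comm x y, h.symm x y])
    (by
      intro x
      have h1 := hsum x (fun _ => 1)
      simp only [mul_one] at h1
      rw [h1, h.laplacian_eq]
      have := h.le_mass x
      have : m₀ / lam ≤ m x / lam := by gcongr
      simp only [mul_one, add_sub_cancel_left]
      linarith)
    (by linarith)
  have hA1 : ‖A‖ < 1 := hA.trans_lt (by have := div_pos h.m₀_pos hlam0; linarith)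
  set U := Units.oneSub A hA1 with hU
  have hUval : (U : lp (fun _ : V => ℝ) 2 →L[ℝ] lp (fun _ : V => ℝ) 2) = 1 - A := rfl
  have hlap : ∀ f : lp (fun _ : V => ℝ) 2, weightedLaplacian G c m (f : V → ℝ) =
      ((lam • (U : lp (fun _ : V => ℝ) 2 →L[ℝ] lp (fun _ : V => ℝ) 2) f :
        lp (fun _ : V => ℝ) 2) : V → ℝ) := by
    intro f
    ext x
    have h1 : (A f : V → ℝ) x = f x - weightedLaplacian G c m f x / lam := by
      rw [hAf, hsum]
    have h2 : ((lam • (U : lp (fun _ : V => ℝ) 2 →L[ℝ] lp (fun _ : V => ℝ) 2) f :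
        lp (fun _ : V => ℝ) 2) : V → ℝ) x = lam * (f x - (A f : V → ℝ) x) := by
      rw [hUval]; rfl
    rw [h2, h1]
    field_simp
    ring
  set Ui : lp (fun _ : V => ℝ) 2 →L[ℝ] lp (fun _ : V => ℝ) 2 := ↑U⁻¹ with hUi
  have hr : ∀ f, (U : lp (fun _ : V => ℝ) 2 →L[ℝ] lp (fun _ : V => ℝ) 2) (Ui f) = f := fun f => by
    have := congrArg (fun B : lp (fun _ : V => ℝ) 2 →L[ℝ] lp (fun _ : V => ℝ) 2 => B f) U.mul_inv
    exact this
  have hl : ∀ f, Ui ((U : lp (fun _ : V => ℝ) 2 →L[ℝ] lp (fun _ : V => ℝ) 2) f) = f := fun f => by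
    have := congrArg (fun B : lp (fun _ : V => ℝ) 2 →L[ℝ] lp (fun _ : V => ℝ) 2 => B f) U.inv_mul
    exact this
  refine ⟨lam⁻¹ • Ui, fun f => ?_, fun f => ?_⟩
  · rw [hlap]
    congr 1
    rw [_root_.smul_apply, map_smul, hr, smul_smul, mul_inv_cancel₀ hlam0.ne',
      one_smul]
  · have hmem : Memℓp (weightedLaplacian G c m (f : V → ℝ)) 2 := by
      rw [hlap]; exact lp.memℓp _
    refine ⟨hmem, ?_⟩
    have : (⟨weightedLaplacian G c m (f : V → ℝ), hmem⟩ : lp (fun _ : V => ℝ) 2) =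
        lam • (U : lp (fun _ : V => ℝ) 2 →L[ℝ] lp (fun _ : V => ℝ) 2) f := Subtype.ext (hlap f)
    rw [this, _root_.smul_apply, map_smul, hl, smul_smul, inv_mul_cancel₀ hlam0.ne',
      one_smul]

end BoundedWeights

namespace IsoradialEmbedding

/-- The angle condition keeps edge lengths between `2 sin ε` and `2 cos ε < 2`, which bounds
degrees, and keeps `θ` in a compact part of `(0, K)`, which bounds `sc` and `A - sc`. A vertex has a
neighbour, so its mass is at least one such term. -/
theorem exists_boundedWeights (S : IsoradialEmbedding G)
    (hS : ∃ ε > 0, ∀ x y : V, G.Adj x y → S.halfAngle x y ∈ Set.Ioo ε (Real.pi / 2 - ε))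
    {k : ℝ} (hk : k ∈ Set.Ioo (0 : ℝ) 1) :
    ∃ r m₀ m₁ D, BoundedWeights G (S.conductance k) (S.mass k) r m₀ m₁ D := by
  obtain ⟨ε, hε, hS⟩ := hS
  have hsymm : ∀ x y, S.conductance k x y = S.conductance k y x := fun x y => by
    simp only [conductance, theta, halfAngle, dist_comm]
  rcases isEmpty_or_nonempty V with hV | ⟨⟨x₀⟩⟩
  · exact ⟨0, 1, 0, 0, ⟨fun x => hV.elim x, fun x => hV.elim x, fun x => hV.elim x, le_rfl, one_pos,
      fun x => hV.elim x, fun x => hV.elim x, fun x => hV.elim x, fun x => hV.elim x⟩⟩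
  obtain ⟨y₀, hxy₀⟩ := S.exists_adj x₀
  have hε2 : ε < Real.pi / 2 - ε := (hS x₀ y₀ hxy₀).1.trans (hS x₀ y₀ hxy₀).2
  have hlen : ∀ x y, G.Adj x y → 2 * Real.sin ε ≤ dist (S.pos x) (S.pos y) ∧
      dist (S.pos x) (S.pos y) ≤ 2 * Real.cos ε := by
    intro x y hxy
    obtain ⟨h1, h2⟩ := hS x y hxy
    set d := dist (S.pos x) (S.pos y) with hd
    have hd0 : 0 ≤ d := dist_nonneg
    -- `Real.arccos` is `0` beyond `1`, which the lower bound on the half-angle forbids.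
    have hd1 : d / 2 ≤ 1 := by
      by_contra! hlt
      rw [halfAngle, Real.arccos_eq_zero.2 hlt.le] at h1
      linarith
    have hcos : Real.cos (S.halfAngle x y) = d / 2 := Real.cos_arccos (by linarith) hd1
    have h0 : 0 ≤ S.halfAngle x y := Real.arccos_nonneg _
    have h3 : Real.cos (S.halfAngle x y) ≤ Real.cos ε :=
      Real.cos_le_cos_of_nonneg_of_le_pi hε.le (Real.arccos_le_pi _) h1.le
    have h4 : Real.cos (Real.pi / 2 - ε) ≤ Real.cos (S.halfAngle x y) :=
      Real.cos_le_cos_of_nonneg_of_le_pi h0 (by linarith [Real.pi_pos]) h2.le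
    rw [Real.cos_pi_div_two_sub] at h4
    constructor <;> linarith
  have hsin : 0 < Real.sin ε := Real.sin_pos_of_pos_of_lt_pi hε (by linarith [Real.pi_pos])
  have hcos0 : 0 < Real.cos ε :=
    Real.cos_pos_of_mem_Ioo ⟨by linarith [Real.pi_pos], by linarith⟩
  have hcos1 : Real.cos ε < 1 := by
    nlinarith [Real.sin_sq_add_cos_sq ε]
  obtain ⟨D, hD⟩ := S.exists_degree_bound (l := 2 * Real.sin ε) (L := 2 * Real.cos ε)
    (by positivity) (by positivity) (by linarith) hlen
  have hK := ellipticK_pos hk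
  have hπ := Real.pi_pos
  obtain ⟨r, μ₀, μ₁, hμ₀, hb⟩ := exists_elliptic_bounds hk
    (a := ε * (2 * ellipticK k / Real.pi)) (b := (Real.pi / 2 - ε) * (2 * ellipticK k / Real.pi))
    (by positivity) (by gcongr) (by
      have : Real.pi / 2 * (2 * ellipticK k / Real.pi) = ellipticK k := by field_simp
      have : 0 < ε * (2 * ellipticK k / Real.pi) := by positivity
      linarith)
  have hb' : ∀ x y, G.Adj x y → _ := fun x y hxy => hb (S.theta k x y)
    ⟨by rw [theta]; exact mul_le_mul_of_nonneg_right (hS x y hxy).1.le (by positivity),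
      by rw [theta]; exact mul_le_mul_of_nonneg_right (hS x y hxy).2.le (by positivity)⟩
  have hmass : ∀ x, S.mass k x = ∑ y ∈ (hD x).1.toFinset,
      (ellipticA k (S.theta k x y) - S.conductance k x y) := fun x =>
    finsum_mem_eq_finite_toFinset_sum _ (hD x).1
  have hμ₁ : 0 ≤ μ₁ := by
    obtain ⟨-, -, h3, h4⟩ := hb' x₀ y₀ hxy₀
    linarith
  refine ⟨r, μ₀, D * μ₁, D, ⟨hsymm, fun x y hxy => (hb' x y hxy).1,
    fun x y hxy => (hb' x y hxy).2.1, ?_, hμ₀, fun x => ?_, fun x => ?_, fun x => (hD x).1,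
    fun x => (hD x).2⟩⟩
  · obtain ⟨h1, h2, -⟩ := hb' x₀ y₀ hxy₀
    exact h1.le.trans h2
  · rw [hmass]
    obtain ⟨y, hy⟩ := S.exists_adj x
    refine (hb' x y hy).2.2.1.trans (Finset.single_le_sum
      (f := fun y => ellipticA k (S.theta k x y) - S.conductance k x y) (fun z hz => ?_)
      (by simpa using hy))
    exact hμ₀.le.trans (hb' x z (by simpa using hz)).2.2.1
  · rw [hmass]
    refine (Finset.sum_le_card_nsmul _ _ μ₁
      fun y hy => (hb' x y (by simpa using hy)).2.2.2).trans ?_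
    rw [nsmul_eq_mul, ← Set.ncard_eq_toFinset_card _ (hD x).1]
    exact mul_le_mul_of_nonneg_right (by exact_mod_cast (hD x).2) hμ₁

theorem existsUnique_isGreenOperator (S : IsoradialEmbedding G) {k : ℝ}
    (h : BoundedWeights G (S.conductance k) (S.mass k) r m₀ m₁ D) :
    ∃! T, S.IsGreenOperator k T := by
  obtain ⟨T, h1, h2⟩ := h.exists_inverse
  refine ⟨T, ⟨h1, h2⟩, fun T' hT' => ?_⟩
  ext1 f
  obtain ⟨hm, h3⟩ := hT'.2 (T f)
  have : (⟨S.massiveLaplacian k (T f : V → ℝ), hm⟩ : lp (fun _ : V => ℝ) 2) = f :=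
    Subtype.ext (h1 f)
  rw [← h3, this]

-- Together with the boundedness of `x ↦ G(x, y)`, this equation is all that the limiting argument
-- needs to know about the inverse on `ℓ²`.
open Classical in
theorem laplacian_green (S : IsoradialEmbedding G) {k : ℝ}
    (h : BoundedWeights G (S.conductance k) (S.mass k) r m₀ m₁ D) (x y : V) :
    weightedLaplacian G (S.conductance k) (S.mass k) (fun z => S.green k z y) x =
      if x = y then 1 else 0 := by
  have h1 : S.IsGreenOperator k (S.greenOperator k) :=
    Classical.epsilon_spec (S.existsUnique_isGreenOperator h).exists
  have h2 := congrFun (h1.1 (lp.single 2 y (1 : ℝ))) x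
  have h3 : weightedLaplacian G (S.conductance k) (S.mass k) (fun z => S.green k z y) x =
    (lp.single 2 y (1 : ℝ) : V → ℝ) x := h2
  rw [h3, lp.single_apply, Pi.single_apply]

theorem exists_green_bound (S : IsoradialEmbedding G) (k : ℝ) (y : V) :
    ∃ M, ∀ x, |S.green k x y| ≤ M := by
  classical
  refine ⟨‖S.greenOperator k (lp.single 2 y (1 : ℝ))‖, fun x => ?_⟩
  rw [← Real.norm_eq_abs]
  exact lp.norm_apply_le_norm two_ne_zero _ x

end IsoradialEmbedding

end Operator

/-! ### Convergence of the finite Green functions. -/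

section FiniteGreen

variable {V : Type*} {G : SimpleGraph V}

theorem configWeight_pos {H : G.Subgraph} [Finite H.verts] {ρ : Sym2 V → ℝ} {m : V → ℝ}
    (hρ : ∀ x y, G.Adj x y → 0 < ρ s(x, y)) (hm : ∀ x, 0 < m x) {ω : ForestConfig G}
    (hω : IsRootedSpanningForest H ω) : 0 < configWeight ρ m ω := by
  have := Fintype.ofFinite H.verts
  obtain ⟨f, hf, rfl⟩ := exists_mapConfig_eq hω
  rw [configWeight_mapConfig ρ m hf]
  refine Finset.prod_pos fun x _ => ?_
  rcases hx : f x with _ | y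
  · exact hm x
  · rw [stepWeight, if_pos (hf.2 x y hx)]
    exact hρ _ _ (hf.2 x y hx).adj_sub

theorem exists_rootedSpanningForest (H : G.Subgraph) [Finite H.verts] :
    ∃ ω : ForestConfig G, IsRootedSpanningForest H ω :=
  ⟨_, mapConfig_isRootedSpanningForest (f := fun _ => none)
    ⟨isTerminating_of_height (fun _ => 0) fun _ _ h => by simp at h, fun _ _ h => by simp at h⟩⟩

theorem finsum_configWeight_pos (H : G.Subgraph) [Finite H.verts] {ρ : Sym2 V → ℝ} {m : V → ℝ}
    (hρ : ∀ x y, G.Adj x y → 0 < ρ s(x, y)) (hm : ∀ x, 0 < m x) :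
    0 < ∑ᶠ ω ∈ {ω : ForestConfig G | IsRootedSpanningForest H ω}, configWeight ρ m ω := by
  rw [finsum_mem_eq_finite_toFinset_sum _ finite_forests]
  obtain ⟨ω, hω⟩ := exists_rootedSpanningForest H
  exact Finset.sum_pos (fun ω hω => configWeight_pos hρ hm (by simpa using hω))
    ⟨ω, by simpa using hω⟩

open Classical in
/-- The Green function of the massive Laplacian of `H`, extended by `0`. -/
noncomputable def finiteGreen (H : G.Subgraph) [Fintype H.verts] (ρ : Sym2 V → ℝ) (m : V → ℝ)
    (x y : V) : ℝ :=
  if h : x ∈ H.verts ∧ y ∈ H.verts then (forestLaplacian H (ρ, m))⁻¹ ⟨x, h.1⟩ ⟨y, h.2⟩ else 0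

variable {ρ : Sym2 V → ℝ} {m : V → ℝ} {r m₀ m₁ : ℝ} {D : ℕ}

theorem finiteGreen_coe (H : G.Subgraph) [Fintype H.verts] [DecidableEq H.verts] (x y : H.verts) :
    finiteGreen H ρ m x y = (forestLaplacian H (ρ, m))⁻¹ x y := by
  rw [finiteGreen, dif_pos ⟨x.2, y.2⟩]
  congr!

theorem det_forestLaplacian_pos (h : BoundedWeights G (fun x y => ρ s(x, y)) m r m₀ m₁ D)
    (H : G.Subgraph) [Fintype H.verts] [DecidableEq H.verts] :
    0 < (forestLaplacian H (ρ, m)).det := by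
  rw [det_forestLaplacian]
  exact finsum_configWeight_pos H h.pos fun x => h.m₀_pos.trans_le (h.le_mass x)

open Classical in
theorem finiteGreen_equation (h : BoundedWeights G (fun x y => ρ s(x, y)) m r m₀ m₁ D)
    (H : G.Subgraph) [Fintype H.verts] (x y : H.verts) :
    ((∑ z : H.verts, if H.Adj x z then ρ s((x : V), (z : V)) else 0) + m x) * finiteGreen H ρ m x y
      - (∑ z : H.verts, if H.Adj x z then ρ s((x : V), (z : V)) * finiteGreen H ρ m z y else 0) =
      if x = y then 1 else 0 := by
  have h1 := Matrix.mul_nonsing_inv _ (isUnit_iff_ne_zero.2 (det_forestLaplacian_pos h H).ne')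
  have h2 := congrFun (congrFun h1 x) y
  rw [Matrix.mul_apply, Matrix.one_apply] at h2
  rw [← h2]
  simp only [← finiteGreen_coe]
  simp only [forestLaplacian, LinearMap.coe_mk, AddHom.coe_mk, Matrix.of_apply, sub_mul,
    Finset.sum_sub_distrib, ite_mul, zero_mul, Finset.sum_ite_eq, Finset.mem_univ, if_true]

/-- Maximum principle: where `|G(·, y)|` is largest, the neighbours can balance the conductance
term, and the mass term alone is bounded by `1`. -/
theorem abs_finiteGreen_le (h : BoundedWeights G (fun x y => ρ s(x, y)) m r m₀ m₁ D)
    (H : G.Subgraph) [Fintype H.verts] (x y : V) : |finiteGreen H ρ m x y| ≤ 1 / m₀ := by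
  classical
  have hm0 := h.m₀_pos
  by_cases hxy : x ∈ H.verts ∧ y ∈ H.verts
  · have : Nonempty H.verts := ⟨⟨x, hxy.1⟩⟩
    obtain ⟨u, -, hu⟩ := Finset.exists_max_image Finset.univ
      (fun u : H.verts => |finiteGreen H ρ m u y|) Finset.univ_nonempty
    have h1 := finiteGreen_equation h H u ⟨y, hxy.2⟩
    simp only [← Finset.sum_filter] at h1
    set s := Finset.univ.filter fun z : H.verts => H.Adj u z with hs
    have hpos : ∀ z ∈ s, 0 ≤ ρ s((u : V), (z : V)) := fun z hz =>
      (h.pos _ _ (Finset.mem_filter.1 hz).2.adj_sub).le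
    have hS : 0 ≤ ∑ z ∈ s, ρ s((u : V), (z : V)) := Finset.sum_nonneg hpos
    have h2 : |∑ z ∈ s, ρ s((u : V), (z : V)) * finiteGreen H ρ m z y| ≤
        (∑ z ∈ s, ρ s((u : V), (z : V))) * |finiteGreen H ρ m u y| := by
      refine (Finset.abs_sum_le_sum_abs _ _).trans ?_
      rw [Finset.sum_mul]
      refine Finset.sum_le_sum fun z hz => ?_
      rw [abs_mul, abs_of_nonneg (hpos z hz)]
      exact mul_le_mul_of_nonneg_left (hu z (Finset.mem_univ _)) (hpos z hz)
    have hmu := h.le_mass u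
    have h3 : (∑ z ∈ s, ρ s((u : V), (z : V)) + m u) * |finiteGreen H ρ m u y| ≤
        1 + (∑ z ∈ s, ρ s((u : V), (z : V))) * |finiteGreen H ρ m u y| := by
      rw [← abs_of_nonneg (show 0 ≤ ∑ z ∈ s, ρ s((u : V), (z : V)) + m u by linarith), ← abs_mul,
        sub_eq_iff_eq_add.1 h1]
      refine (abs_add_le _ _).trans (add_le_add ?_ h2)
      split_ifs <;> simp
    have h4 : m₀ * |finiteGreen H ρ m u y| ≤ 1 := by
      have := mul_le_mul_of_nonneg_right hmu (abs_nonneg (finiteGreen H ρ m u y))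
      linarith
    refine (hu ⟨x, hxy.1⟩ (Finset.mem_univ _)).trans ?_
    rw [le_div_iff₀ hm0]
    linarith
  · rw [finiteGreen, dif_neg hxy, abs_zero]
    positivity

open Classical in
theorem sum_subgraph_neighbors {H : G.Subgraph} [Fintype H.verts] {x : V}
    (hfin : (G.neighborSet x).Finite) (hx : ∀ z, G.Adj x z → H.Adj x z) (F : V → ℝ) :
    (∑ z : H.verts, if H.Adj x z then F z else 0) = ∑ z ∈ hfin.toFinset, F z := by
  rw [← Finset.sum_filter]
  have : hfin.toFinset = (Finset.univ.filter fun z : H.verts => H.Adj x z).map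
      (Function.Embedding.subtype _) := by
    ext z
    simp only [Set.Finite.mem_toFinset, SimpleGraph.mem_neighborSet, Finset.mem_map,
      Finset.mem_filter, Finset.mem_univ, true_and, Function.Embedding.subtype_apply]
    constructor
    · intro hz
      exact ⟨⟨z, (hx z hz).snd_mem⟩, hx z hz, rfl⟩
    · rintro ⟨z, hz, rfl⟩
      exact hz.adj_sub
  rw [this, Finset.sum_map]
  rfl

open Classical in
theorem laplacian_finiteGreen (h : BoundedWeights G (fun x y => ρ s(x, y)) m r m₀ m₁ D)
    (H : G.Subgraph) [Fintype H.verts] {x y : V} (hx : x ∈ H.verts) (hy : y ∈ H.verts)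
    (hadj : ∀ z, G.Adj x z → H.Adj x z) :
    weightedLaplacian G (fun x y => ρ s(x, y)) m (fun z => finiteGreen H ρ m z y) x =
      if x = y then 1 else 0 := by
  have h1 := finiteGreen_equation h H ⟨x, hx⟩ ⟨y, hy⟩
  simp only at h1
  rw [sum_subgraph_neighbors (h.finite x) hadj (fun z => ρ s(x, z)),
    sum_subgraph_neighbors (h.finite x) hadj (fun z => ρ s(x, z) * finiteGreen H ρ m z y)] at h1
  rw [h.laplacian_eq, h1]
  simp only [Subtype.mk.injEq]

/-- All the edges at distance less than `R` from `x` belong to `H`. -/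
def IsDeep (H : G.Subgraph) : ℕ → V → Prop
  | 0, _ => True
  | R + 1, x => x ∈ H.verts ∧ ∀ z, G.Adj x z → H.Adj x z ∧ IsDeep H R z

/-- Massive harmonic functions decay exponentially inside a region. -/
theorem BoundedWeights.abs_le_of_isDeep {c : V → V → ℝ} (h : BoundedWeights G c m r m₀ m₁ D)
    {H : G.Subgraph}
    {f : V → ℝ} {M : ℝ} (hM : ∀ x, |f x| ≤ M)
    (hf : ∀ x, x ∈ H.verts → (∀ z, G.Adj x z → H.Adj x z) → weightedLaplacian G c m f x = 0)
    (R : ℕ) (x : V) (hx : IsDeep H R x) : |f x| ≤ (D * r / (D * r + m₀)) ^ R * M := by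
  have hm0 := h.m₀_pos
  have hDr : 0 ≤ D * r := mul_nonneg (by positivity) h.r_nonneg
  have hM0 : 0 ≤ M := (abs_nonneg _).trans (hM x)
  induction R generalizing x with
  | zero => simpa using hM x
  | succ R ih =>
    have h1 := hf x hx.1 fun z hz => (hx.2 z hz).1
    rw [h.laplacian_eq, sub_eq_zero] at h1
    set A := (D * r / (D * r + m₀)) ^ R * M with hA
    have hA0 : 0 ≤ A := by positivity
    have hS0 := h.sum_nonneg x
    have hS1 := h.sum_le x
    set σ := ∑ y ∈ (h.finite x).toFinset, c x y with hσ
    have h2 : |∑ y ∈ (h.finite x).toFinset, c x y * f y| ≤ σ * A := by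
      refine (Finset.abs_sum_le_sum_abs _ _).trans ?_
      rw [hσ, Finset.sum_mul]
      refine Finset.sum_le_sum fun z hz => ?_
      have hadj : G.Adj x z := by simpa using hz
      rw [abs_mul, abs_of_pos (h.pos x z hadj)]
      exact mul_le_mul_of_nonneg_left (ih z (hx.2 z hadj).2) (h.pos x z hadj).le
    have hmx := h.le_mass x
    rw [← h1, abs_mul, abs_of_nonneg (by linarith : 0 ≤ σ + m x)] at h2
    have h3 : (σ + m₀) * |f x| ≤ σ * A := by
      refine le_trans ?_ h2
      gcongr
    -- This allows the local conductance sum `σ` to be replaced by its bound `D r`: adding `(D r -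
    -- σ)|f x| ≤ (D r - σ) A` gives a ratio independent of `x`.
    have h4 : |f x| ≤ A := by
      by_contra! hlt
      nlinarith
    rw [pow_succ, mul_assoc, mul_comm (D * r / (D * r + m₀)) M, ← mul_assoc, ← hA, mul_div_assoc',
      le_div_iff₀ (by positivity)]
    nlinarith [abs_nonneg (f x)]

theorem eventually_isDeep {H : ℕ → G.Subgraph} (hH : IsFiniteExhaustion G H)
    (hfin : ∀ x, (G.neighborSet x).Finite) (R : ℕ) (x : V) :
    ∀ᶠ n in Filter.atTop, IsDeep (H n) R x := by
  induction R generalizing x with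
  | zero => exact Filter.Eventually.of_forall fun _ => trivial
  | succ R ih =>
    have h1 : ∀ᶠ n in Filter.atTop, x ∈ (H n).verts := by
      obtain ⟨n, hn⟩ := hH.exists_mem_verts x
      filter_upwards [Filter.eventually_ge_atTop n] with k hk
      exact (hH.monotone hk).1 hn
    have h2 : ∀ᶠ n in Filter.atTop, ∀ z ∈ G.neighborSet x, (H n).Adj x z ∧ IsDeep (H n) R z := by
      rw [(hfin x).eventually_all]
      intro z hz
      obtain ⟨n, hn⟩ := hH.exists_adj x z hz
      filter_upwards [Filter.eventually_ge_atTop n, ih z] with k hk hk'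
      exact ⟨(hH.monotone hk).2 hn, hk'⟩
    filter_upwards [h1, h2] with n h1 h2
    exact ⟨h1, h2⟩

/-- The two Green functions satisfy the same equation wherever all edges at a vertex belong to `H
n`. Their difference is bounded by `1/m₀ + M` uniformly in `n`, and is massive harmonic there, so it
decays exponentially in the depth of `x`. -/
theorem IsoradialEmbedding.tendsto_finiteGreen (S : IsoradialEmbedding G) {k : ℝ}
    (h : BoundedWeights G (S.conductance k) (S.mass k) r m₀ m₁ D) {H : ℕ → G.Subgraph}
    (hH : IsFiniteExhaustion G H) [∀ n, Fintype (H n).verts] (x y : V) :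
    Filter.Tendsto (fun n => finiteGreen (H n) (S.edgeConductance k) (S.mass k) x y) Filter.atTop
      (nhds (S.green k x y)) := by
  classical
  have h' : BoundedWeights G (fun x y => S.edgeConductance k s(x, y)) (S.mass k) r m₀ m₁ D := h
  obtain ⟨M, hM⟩ := S.exists_green_bound k y
  set q : ℝ := D * r / (D * r + m₀) with hq
  have hm0 := h.m₀_pos
  have hDr : 0 ≤ D * r := mul_nonneg (by positivity) h.r_nonneg
  have hq0 : 0 ≤ q := by positivity
  have hq1 : q < 1 := (div_lt_one (by positivity)).2 (by linarith)
  rw [Metric.tendsto_atTop']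
  intro ε hε
  have hlim : Filter.Tendsto (fun R : ℕ => q ^ R * (1 / m₀ + M)) Filter.atTop (nhds 0) := by
    simpa using (tendsto_pow_atTop_nhds_zero_of_lt_one hq0 hq1).mul_const (1 / m₀ + M)
  obtain ⟨R, hR⟩ := (hlim.eventually (gt_mem_nhds hε)).exists
  have hy : ∀ᶠ n in Filter.atTop, y ∈ (H n).verts := by
    obtain ⟨n, hn⟩ := hH.exists_mem_verts y
    filter_upwards [Filter.eventually_ge_atTop n] with k hk
    exact (hH.monotone hk).1 hn
  obtain ⟨n₀, hn₀⟩ := Filter.eventually_atTop.1 ((eventually_isDeep hH h.finite R x).and hy)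
  refine ⟨n₀, fun n hn => ?_⟩
  obtain ⟨hdeep, hyn⟩ := hn₀ n hn.le
  rw [Real.dist_eq]
  refine lt_of_le_of_lt ?_ hR
  refine h.abs_le_of_isDeep
    (f := fun z => finiteGreen (H n) (S.edgeConductance k) (S.mass k) z y - S.green k z y)
    (fun z => ?_) (fun z hz hz' => ?_) R x hdeep
  · refine (abs_sub _ _).trans (add_le_add (abs_finiteGreen_le h' (H n) z y) (hM z))
  · have h1 := laplacian_finiteGreen h' (H n) hz hyn hz'
    have h2 := S.laplacian_green h z y
    rw [h'.laplacian_eq] at h1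
    rw [h.laplacian_eq] at h2
    rw [h.laplacian_eq]
    simp only [mul_sub, Finset.sum_sub_distrib]
    have h3 : ∀ a b, S.edgeConductance k s(a, b) = S.conductance k a b := fun _ _ => rfl
    simp only [h3] at h1
    linarith

end FiniteGreen

/-! ### Trajectories of partial self-maps. -/

section Trajectory

variable {W : Type*}

/-- The trajectory of `y` under a partial self-map. -/
def trajectory (f : W → Option W) (y : W) : ℕ → Option W
  | 0 => some y
  | n + 1 => (trajectory f y n).bind f

theorem trajectory_succ' (f : W → Option W) (y : W) (n : ℕ) :
    trajectory f y (n + 1) = (f y).bind fun z => trajectory f z n := by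
  induction n with
  | zero => simp [trajectory]
  | succ n ih =>
    rw [trajectory, ih]
    cases f y <;> simp [trajectory]

theorem trajectory_height {f : W → Option W} {h : W → ℕ} (hh : ∀ x y, f x = some y → h y < h x)
    (y : W) {i j : ℕ} (hij : j < i) {b : W} (hb : trajectory f y i = some b) :
    ∃ a, trajectory f y j = some a ∧ h b < h a := by
  induction i generalizing b with
  | zero => omega
  | succ i ih =>
    rw [trajectory, Option.bind_eq_some_iff] at hb
    obtain ⟨c, hc, hcb⟩ := hb
    rcases Nat.lt_succ_iff_lt_or_eq.1 hij with h1 | rfl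
    · obtain ⟨a, ha, hlt⟩ := ih h1 hc
      exact ⟨a, ha, (hh _ _ hcb).trans hlt⟩
    · exact ⟨c, hc, hh _ _ hcb⟩

/-- Heights strictly decrease, so `u` is not visited before time `i`, and stopping the map at `u`
leaves the earlier trajectory unchanged. -/
theorem trajectory_update [DecidableEq W] [Finite W] {f : W → Option W} (hf : IsTerminating f)
    {y u : W} {i : ℕ} (hu : trajectory f y i = some u) :
    ∀ j ≤ i, trajectory (Function.update f u none) y j = trajectory f y j := by
  obtain ⟨h, hh⟩ := hf.exists_height
  intro j
  induction j with
  | zero => exact fun _ => rfl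
  | succ j ih =>
    intro hj
    obtain ⟨a, ha, hlt⟩ := trajectory_height hh y hj hu
    have hau : a ≠ u := by rintro rfl; exact lt_irrefl _ hlt
    rw [trajectory, trajectory, ih (by omega), ha, Option.bind_some, Option.bind_some,
      Function.update_of_ne hau]

end Trajectory

/-! ### Exponential tail for the distance to the root. -/

section Tail

variable {V : Type*} {G : SimpleGraph V}

/-- The configurations in which a vertex `z` satisfying `base z` can be reached from `y` by
following at most `L` edges. -/
def reachWithin (base : V → Set (ForestConfig G)) : ℕ → V → Set (ForestConfig G)
  | 0, y => base y
  | L + 1, y => base y ∪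
    {ω | ∃ z, ∃ h : G.Adj y z, ω (.inl ⟨s(y, z), h⟩) = true ∧ ω ∈ reachWithin base L z}

variable {ρ : Sym2 V → ℝ} {m : V → ℝ} {r m₀ m₁ : ℝ} {D : ℕ}

theorem mapConfig_mem_reachWithin {H : G.Subgraph} {f : H.verts → Option H.verts}
    (hf : IsForestMap f) (L : ℕ) (y : H.verts) (hy : trajectory f y (L + 1) = none) :
    mapConfig f ∈ reachWithin (fun z => {ω | ω (.inr z) = true}) L (y : V) := by
  induction L generalizing y with
  | zero => exact (mapConfig_inr f y).2 hy
  | succ L ih =>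
    rcases hz : f y with _ | z
    · exact Or.inl ((mapConfig_inr f y).2 hz)
    · rw [trajectory_succ', hz, Option.bind_some] at hy
      obtain ⟨h1, h2⟩ := configGraph_adj.1
        ((configGraph_mapConfig_adj hf).2 (Or.inl ⟨y, z, rfl, rfl, hz⟩))
      exact Or.inr ⟨z, h1, h2, ih z hy⟩

-- Cut the trajectory after `i` steps by turning its current point into a root. This trades a
-- conductance at most `r` for a mass at least `m₀`, and at most `D` forests are cut to the same
-- one.
open Classical in
theorem sum_trajectory_step (h : BoundedWeights G (fun x y => ρ s(x, y)) m r m₀ m₁ D)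
    (H : G.Subgraph) [Fintype H.verts] (y : H.verts) (i : ℕ) :
    ∑ f : H.verts → Option H.verts with IsForestMap f ∧ trajectory f y (i + 1) ≠ none,
        configWeight ρ m (mapConfig f) ≤
      D * r / m₀ * ∑ f : H.verts → Option H.verts with IsForestMap f ∧ trajectory f y i ≠ none ∧
        trajectory f y (i + 1) = none, configWeight ρ m (mapConfig f) := by
  have hm0 := h.m₀_pos
  set T := Finset.univ.filter fun f : H.verts → Option H.verts =>
    IsForestMap f ∧ trajectory f y (i + 1) ≠ none with hT
  set A := Finset.univ.filter fun f : H.verts → Option H.verts =>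
    IsForestMap f ∧ trajectory f y i ≠ none ∧ trajectory f y (i + 1) = none with hA
  have hex : ∀ f ∈ T, ∃ u z, trajectory f y i = some u ∧ f u = some z := by
    intro f hf
    obtain ⟨-, -, h1⟩ := Finset.mem_filter.1 hf
    obtain ⟨b, hb⟩ := Option.ne_none_iff_exists'.1 h1
    rw [trajectory, Option.bind_eq_some_iff] at hb
    obtain ⟨u, hu, hub⟩ := hb
    exact ⟨u, b, hu, hub⟩
  have : Nonempty H.verts := ⟨y⟩
  choose! u z hu hz using hex
  set φ : (H.verts → Option H.verts) → H.verts → Option H.verts :=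
    fun f => Function.update f (u f) none with hφ
  have htraj : ∀ f ∈ T, trajectory (φ f) y i = some (u f) := fun f hf => by
    rw [hφ, trajectory_update (Finset.mem_filter.1 hf).2.1.1 (hu f hf) i le_rfl, hu f hf]
  have hφf : ∀ f ∈ T, IsForestMap (φ f) := by
    intro f hf
    obtain ⟨-, ⟨h1, h2⟩, -⟩ := Finset.mem_filter.1 hf
    obtain ⟨ht, hht⟩ := h1.exists_height
    have hsub : ∀ x y, φ f x = some y → f x = some y := by
      intro x y hxy
      by_cases hx : x = u f
      · subst hx; simp [hφ] at hxy
      · rwa [show φ f x = f x from Function.update_of_ne hx _ _] at hxy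
    exact ⟨isTerminating_of_height ht fun x y hxy => hht x y (hsub x y hxy),
      fun x y hxy => h2 x y (hsub x y hxy)⟩
  have hφA : ∀ f ∈ T, φ f ∈ A := by
    intro f hf
    refine Finset.mem_filter.2 ⟨Finset.mem_univ _, hφf f hf, ?_, ?_⟩
    · rw [htraj f hf]; simp
    · rw [trajectory, htraj f hf]
      simp [hφ]
  have hpos : ∀ f ∈ A, 0 ≤ configWeight ρ m (mapConfig f) := fun f hf =>
    (configWeight_pos h.pos (fun x => h.m₀_pos.trans_le (h.le_mass x))
      (mapConfig_isRootedSpanningForest (Finset.mem_filter.1 hf).2.1)).le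
  have hw : ∀ f ∈ T, configWeight ρ m (mapConfig f) ≤
      r / m₀ * configWeight ρ m (mapConfig (φ f)) := by
    intro f hf
    have hff := (Finset.mem_filter.1 hf).2.1
    have hAdj := hff.2 _ _ (hz f hf)
    have hP : 0 ≤ configWeight ρ m (mapConfig (φ f)) := hpos _ (hφA f hf)
    rw [configWeight_mapConfig ρ m hff]
    rw [configWeight_mapConfig ρ m (hφf f hf)] at hP ⊢
    rw [← Finset.mul_prod_erase _ _ (Finset.mem_univ (u f))] at hP ⊢
    rw [← Finset.mul_prod_erase _ _ (Finset.mem_univ (u f))]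
    have heq : ∏ x ∈ Finset.univ.erase (u f), stepWeight H ρ m x (φ f x) =
        ∏ x ∈ Finset.univ.erase (u f), stepWeight H ρ m x (f x) :=
      Finset.prod_congr rfl fun x hx => by
        rw [show φ f x = f x from Function.update_of_ne (Finset.ne_of_mem_erase hx) _ _]
    have h1 : φ f (u f) = none := by simp [hφ]
    rw [heq, h1] at hP ⊢
    rw [hz f hf]
    simp only [stepWeight, if_pos hAdj] at hP ⊢
    have h2 := h.le _ _ hAdj.adj_sub
    have h3 := h.le_mass (u f)
    have h4 : 0 ≤ ∏ x ∈ Finset.univ.erase (u f), stepWeight H ρ m x (f x) :=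
      nonneg_of_mul_nonneg_right hP (hm0.trans_le h3)
    rw [← mul_assoc]
    refine mul_le_mul_of_nonneg_right ?_ h4
    calc ρ s((u f : V), (z f : V)) ≤ r := h2
      _ = r / m₀ * m₀ := by field_simp
      _ ≤ r / m₀ * m (u f) := mul_le_mul_of_nonneg_left h3 (div_nonneg h.r_nonneg hm0.le)
  -- The cut point is where `g` stops at time `i`; a preimage is recovered from the neighbour
  -- towards which the deleted step pointed.
  have hfiber : ∀ g ∈ A, (T.filter fun f => φ f = g).card ≤ D := by
    intro g hg
    obtain ⟨v, hv⟩ := Option.ne_none_iff_exists'.1 (Finset.mem_filter.1 hg).2.2.1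
    refine le_trans ?_ (h.card_neighbors_le v)
    refine Finset.card_le_card_of_injOn (fun f => (z f : V)) ?_ ?_
    · intro f hf
      obtain ⟨hfT, hfg⟩ := Finset.mem_filter.1 hf
      have huv : u f = v := by
        have := htraj f hfT
        rw [hfg, hv, Option.some.injEq] at this
        exact this.symm
      have := ((Finset.mem_filter.1 hfT).2.1.2 _ _ (hz f hfT)).adj_sub
      rw [huv] at this
      simpa using this
    · intro f hf f' hf' hzz
      obtain ⟨hfT, hfg⟩ := Finset.mem_filter.1 hf
      obtain ⟨hfT', hfg'⟩ := Finset.mem_filter.1 hf'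
      have huv : ∀ f ∈ T, φ f = g → u f = v := fun f hfT hfg => by
        have := htraj f hfT
        rw [hfg, hv, Option.some.injEq] at this
        exact this.symm
      have e1 := huv f hfT hfg
      have e2 := huv f' hfT' hfg'
      have hzz' : z f = z f' := Subtype.ext hzz
      ext1 x
      by_cases hx : x = v
      · rw [hx, ← e1, hz f hfT, e1, ← e2, hz f' hfT', hzz']
      · have e3 := congrFun hfg x
        have e4 := congrFun hfg' x
        rw [hφ] at e3 e4
        simp only at e3 e4
        rw [e1, Function.update_of_ne hx] at e3
        rw [e2, Function.update_of_ne hx] at e4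
        rw [e3, e4]
  calc ∑ f ∈ T, configWeight ρ m (mapConfig f)
      ≤ ∑ f ∈ T, r / m₀ * configWeight ρ m (mapConfig (φ f)) := Finset.sum_le_sum hw
    _ = r / m₀ * ∑ f ∈ T, configWeight ρ m (mapConfig (φ f)) := by rw [Finset.mul_sum]
    _ = r / m₀ * ∑ g ∈ A, ∑ f ∈ T with φ f = g, configWeight ρ m (mapConfig (φ f)) := by
        rw [Finset.sum_fiberwise_of_maps_to hφA]
    _ ≤ r / m₀ * ∑ g ∈ A, D * configWeight ρ m (mapConfig g) := by
        refine mul_le_mul_of_nonneg_left (Finset.sum_le_sum fun g hg => ?_)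
          (div_nonneg h.r_nonneg hm0.le)
        rw [Finset.sum_congr rfl (g := fun _ => configWeight ρ m (mapConfig g))
          (fun f hf => by rw [(Finset.mem_filter.1 hf).2]), Finset.sum_const, nsmul_eq_mul]
        exact mul_le_mul_of_nonneg_right (by exact_mod_cast hfiber g hg) (hpos g hg)
    _ = D * r / m₀ * ∑ g ∈ A, configWeight ρ m (mapConfig g) := by
        rw [← Finset.mul_sum]; ring

open Classical in
/-- The path from a given vertex to its root has an exponential tail. -/
theorem sum_notMem_reachWithin_le (h : BoundedWeights G (fun x y => ρ s(x, y)) m r m₀ m₁ D)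
    (H : G.Subgraph) [Finite H.verts] {y : V} (hy : y ∈ H.verts) (L : ℕ) :
    ∑ᶠ ω ∈ {ω : ForestConfig G | IsRootedSpanningForest H ω}, configWeight ρ m ω *
        (if ω ∈ reachWithin (fun z => {ω | ω (.inr z) = true}) L y then 0 else 1) ≤
      (D * r / (D * r + m₀)) ^ (L + 1) *
        ∑ᶠ ω ∈ {ω : ForestConfig G | IsRootedSpanningForest H ω}, configWeight ρ m ω := by
  have := Fintype.ofFinite H.verts
  have hm0 := h.m₀_pos
  have hDr : 0 ≤ D * r := mul_nonneg (by positivity) h.r_nonneg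
  set y' : H.verts := ⟨y, hy⟩ with hy'
  have hpos : ∀ f : H.verts → Option H.verts, IsForestMap f →
      0 ≤ configWeight ρ m (mapConfig f) := fun f hf =>
    (configWeight_pos h.pos (fun x => h.m₀_pos.trans_le (h.le_mass x))
      (mapConfig_isRootedSpanningForest hf)).le
  set a : ℕ → ℝ := fun i => ∑ f : H.verts → Option H.verts with
    IsForestMap f ∧ trajectory f y' i ≠ none, configWeight ρ m (mapConfig f) with ha
  -- Forests that stop exactly at time `i` weigh `a i - a (i + 1)`, so the cutting inequality reads
  -- `m₀ a (i + 1) ≤ D r (a i - a (i + 1))`.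
  have hstep : ∀ i, a (i + 1) ≤ D * r / (D * r + m₀) * a i := by
    intro i
    have h1 := sum_trajectory_step h H y' i
    have h2 : ∑ f : H.verts → Option H.verts with IsForestMap f ∧ trajectory f y' i ≠ none ∧
        trajectory f y' (i + 1) = none, configWeight ρ m (mapConfig f) = a i - a (i + 1) := by
      rw [eq_sub_iff_add_eq, ha, ← Finset.sum_union]
      · refine Finset.sum_congr ?_ fun _ _ => rfl
        ext f
        simp only [Finset.mem_union, Finset.mem_filter, Finset.mem_univ, true_and]
        have h3 : trajectory f y' i = none → trajectory f y' (i + 1) = none := fun h => by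
          rw [trajectory, h, Option.bind_none]
        tauto
      · rw [Finset.disjoint_left]
        intro f hf hf'
        exact (Finset.mem_filter.1 hf').2.2 (Finset.mem_filter.1 hf).2.2.2
    rw [h2] at h1
    change a (i + 1) ≤ _ at h1
    rw [div_mul_eq_mul_div, le_div_iff₀ hm0] at h1
    rw [div_mul_eq_mul_div, le_div_iff₀ (by positivity)]
    linarith
  have hpow : ∀ i, a i ≤ (D * r / (D * r + m₀)) ^ i * a 0 := by
    intro i
    induction i with
    | zero => simp
    | succ i ih =>
      refine (hstep i).trans ?_
      rw [pow_succ', mul_assoc]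
      exact mul_le_mul_of_nonneg_left ih (by positivity)
  rw [finsum_forest, finsum_forest, ← Finset.sum_filter, ← Finset.sum_filter]
  have h0 : a 0 = ∑ f : H.verts → Option H.verts with IsForestMap f,
      configWeight ρ m (mapConfig f) := by
    simp [ha, trajectory]
  rw [← h0]
  -- If no root is reached within `L` edges, the trajectory is still defined at time `L + 1`.
  refine le_trans ?_ (hpow (L + 1))
  rw [ha]
  simp only [mul_ite, mul_zero, mul_one]
  rw [Finset.sum_ite, Finset.sum_const_zero, zero_add, Finset.filter_filter]
  refine Finset.sum_le_sum_of_subset_of_nonneg (fun f hf => ?_) fun f hf _ =>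
    hpos f (Finset.mem_filter.1 hf).2.1
  obtain ⟨-, h1, h2⟩ := Finset.mem_filter.1 hf
  exact Finset.mem_filter.2 ⟨Finset.mem_univ _, h1, fun h3 => h2
    (mapConfig_mem_reachWithin h1 L y' h3)⟩

end Tail

/-! ### Moving a root inside its component. -/

section Rerooting

variable {V : Type*} {G : SimpleGraph V} {ρ : Sym2 V → ℝ} {m : V → ℝ} {r m₀ m₁ : ℝ} {D : ℕ}

open Classical in
/-- Replace the root `x` by the root `y`. -/
noncomputable def reroot (x y : V) (ω : ForestConfig G) : ForestConfig G
  | .inl e => ω (.inl e)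
  | .inr v => if v = y then true else if v = x then false else ω (.inr v)

theorem configGraph_reroot (x y : V) (ω : ForestConfig G) :
    configGraph (reroot x y ω) = configGraph ω := rfl

theorem reroot_isRootedSpanningForest {H : G.Subgraph} {x y : V} {ω : ForestConfig G}
    (hω : IsRootedSpanningForest H ω) (hx : ω (.inr x) = true) (hy : y ∈ H.verts)
    (hxy : (configGraph ω).Reachable x y) : IsRootedSpanningForest H (reroot x y ω) := by
  refine ⟨hω.1, fun v hv => ?_, hω.2.2.1, fun v hv => ?_⟩
  · by_cases h1 : v = y
    · rw [h1]; exact hy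
    · by_cases h2 : v = x
      · simp [reroot, h2, show x ≠ y from h2 ▸ h1] at hv
      · simp only [reroot, if_neg h1, if_neg h2] at hv
        exact hω.2.1 v hv
  · rw [configGraph_reroot]
    obtain ⟨s, ⟨hs1, hs2⟩, hs3⟩ := hω.2.2.2 v hv
    by_cases hsx : s = x
    · subst hsx
      refine ⟨y, ⟨hs1.trans hxy, by simp [reroot]⟩, ?_⟩
      rintro t ⟨ht1, ht2⟩
      by_contra hty
      simp only [reroot, if_neg hty] at ht2
      by_cases hts : t = s
      · simp [hts] at ht2
      · rw [if_neg hts] at ht2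
        exact hts (hs3 t ⟨ht1, ht2⟩)
    · refine ⟨s, ⟨hs1, by simp [reroot, hsx, hs2]⟩, ?_⟩
      rintro t ⟨ht1, ht2⟩
      by_cases hty : t = y
      · subst hty
        exact absurd (hs3 x ⟨ht1.trans hxy.symm, hx⟩).symm hsx
      · simp only [reroot, if_neg hty] at ht2
        by_cases htx : t = x
        · simp [htx] at ht2
        · rw [if_neg htx] at ht2
          exact hs3 t ⟨ht1, ht2⟩

theorem configWeight_reroot {H : G.Subgraph} [Finite H.verts] {x y : V} {ω : ForestConfig G}
    (hω : IsRootedSpanningForest H ω) (hx : ω (.inr x) = true)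
    (hxy : (configGraph ω).Reachable x y) :
    m x * configWeight ρ m (reroot x y ω) = m y * configWeight ρ m ω := by
  have hfin := finite_roots_of_forest hω
  set R := {v : V | ω (.inr v) = true} \ {x} with hR
  have hRfin : R.Finite := hfin.subset Set.sdiff_subset
  have h1 : {v : V | ω (.inr v) = true} = insert x R := by
    rw [hR, Set.insert_sdiff_singleton]
    exact (Set.insert_eq_of_mem (show x ∈ {v : V | ω (.inr v) = true} from hx)).symm
  have h2 : {v : V | reroot x y ω (.inr v) = true} = insert y R := by
    ext v
    simp only [hR, reroot, Set.mem_ofPred_eq, Set.mem_insert_iff, Set.mem_sdiff,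
      Set.mem_singleton_iff]
    by_cases h1 : v = y
    · simp [h1]
    · by_cases h2 : v = x <;> simp [h1, h2]
  have hy : y ∉ R := by
    rintro ⟨h3, h4⟩
    obtain ⟨s, -, hs⟩ := hω.2.2.2 x (hω.2.1 x hx)
    exact h4 ((hs y ⟨hxy, h3⟩).trans (hs x ⟨SimpleGraph.Reachable.refl _, hx⟩).symm)
  have hx' : x ∉ R := fun h => h.2 rfl
  have e1 : configWeight ρ m ω = (∏ᶠ e ∈ {e : G.edgeSet | ω (.inl e) = true}, ρ e) *
      (m x * ∏ᶠ v ∈ R, m v) := by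
    rw [← finprod_mem_insert _ hx' hRfin, ← h1, configWeight]
  have e2 : configWeight ρ m (reroot x y ω) =
      (∏ᶠ e ∈ {e : G.edgeSet | ω (.inl e) = true}, ρ e) * (m y * ∏ᶠ v ∈ R, m v) := by
    rw [← finprod_mem_insert _ hy hRfin, ← h2, configWeight]
    rfl
  rw [e1, e2]
  ring

open Classical in
/-- The expected number of vertices of `Y` in the component rooted at `x` is bounded. -/
theorem sum_reachable_root_le (h : BoundedWeights G (fun x y => ρ s(x, y)) m r m₀ m₁ D)
    (H : G.Subgraph) [Finite H.verts] (x : V) (Y : Finset V) :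
    ∑ y ∈ Y, ∑ᶠ ω ∈ {ω : ForestConfig G | IsRootedSpanningForest H ω}, configWeight ρ m ω *
        (if ω (.inr x) = true ∧ y ∈ H.verts ∧ (configGraph ω).Reachable x y then 1 else 0) ≤
      m₁ / m₀ * ∑ᶠ ω ∈ {ω : ForestConfig G | IsRootedSpanningForest H ω}, configWeight ρ m ω := by
  have hm0 := h.m₀_pos
  have hmx : ∀ x, 0 < m x := fun x => h.m₀_pos.trans_le (h.le_mass x)
  have hm1 : 0 ≤ m₁ / m₀ := div_nonneg (hm0.le.trans ((h.le_mass x).trans (h.mass_le x))) hm0.le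
  simp only [finsum_mem_eq_finite_toFinset_sum _ (finite_forests (H := H))]
  set Φ := (finite_forests (H := H)).toFinset with hΦ
  have hmem : ∀ ω, ω ∈ Φ ↔ IsRootedSpanningForest H ω := fun ω => by simp [hΦ]
  have hpos : ∀ ω ∈ Φ, 0 ≤ configWeight ρ m ω := fun ω hω =>
    (configWeight_pos h.pos hmx ((hmem ω).1 hω)).le
  -- Rerooting from `x` to `y` keeps the edges and multiplies the weight by `m y / m x`. It sends
  -- forests where `x` is the root of `y` injectively to forests where `y` is the root of `x`.
  have hstep : ∀ y, ∑ ω ∈ Φ, configWeight ρ m ω *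
        (if ω (.inr x) = true ∧ y ∈ H.verts ∧ (configGraph ω).Reachable x y then 1 else 0) ≤
      m₁ / m₀ * ∑ ω ∈ Φ, configWeight ρ m ω *
        (if ω (.inr y) = true ∧ x ∈ H.verts ∧ (configGraph ω).Reachable x y then 1 else 0) := by
    intro y
    simp only [mul_ite, mul_one, mul_zero, ← Finset.sum_filter]
    rw [Finset.mul_sum]
    refine le_trans (Finset.sum_le_sum
      (g := fun ω => m₁ / m₀ * configWeight ρ m (reroot x y ω)) fun ω hω => ?_) ?_
    · obtain ⟨h1, h2, h3, h4⟩ := Finset.mem_filter.1 hω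
      have h5 := configWeight_reroot (ρ := ρ) (m := m) ((hmem ω).1 h1) h2 h4
      have h6 := (configWeight_pos h.pos hmx
        (reroot_isRootedSpanningForest ((hmem ω).1 h1) h2 h3 h4)).le
      rw [div_mul_eq_mul_div, le_div_iff₀ hm0]
      have h7 := mul_le_mul_of_nonneg_right (h.mass_le x) h6
      have h8 := mul_le_mul_of_nonneg_right (h.le_mass y) (hpos ω h1)
      linarith
    · refine le_of_eq_of_le (Finset.sum_image (f := fun ω => m₁ / m₀ * configWeight ρ m ω)
        (g := reroot x y) ?_).symm ?_
      · intro ω hω ω' hω' heq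
        obtain ⟨h1, h2, h3, h4⟩ := Finset.mem_filter.1 hω
        obtain ⟨h1', h2', h3', h4'⟩ := Finset.mem_filter.1 hω'
        have hcg : configGraph ω = configGraph ω' := by
          rw [← configGraph_reroot x y ω, ← configGraph_reroot x y ω', heq]
        have hroot : ∀ ω, IsRootedSpanningForest H ω → ω (.inr x) = true →
            (configGraph ω).Reachable x y → y ≠ x → ω (.inr y) = false := by
          intro ω h1 h2 h4 hyx
          by_contra h5
          obtain ⟨s, -, hs⟩ := h1.2.2.2 x (h1.2.1 x h2)
          exact hyx ((hs y ⟨h4, by simpa using h5⟩).trans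
            (hs x ⟨SimpleGraph.Reachable.refl _, h2⟩).symm)
        funext a
        rcases a with e | v
        · exact congrFun heq (.inl e)
        · have h5 := congrFun heq (.inr v)
          by_cases hvx : v = x
          · rw [hvx, h2, h2']
          · by_cases hvy : v = y
            · subst hvy
              rw [hroot ω ((hmem ω).1 h1) h2 h4 hvx, hroot ω' ((hmem ω').1 h1') h2' h4' hvx]
            · simpa [reroot, hvx, hvy] using h5
      · refine Finset.sum_le_sum_of_subset_of_nonneg (fun ω' hω' => ?_) fun ω hω _ =>
          mul_nonneg hm1 (hpos ω (Finset.mem_filter.1 hω).1)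
        obtain ⟨ω, hω, rfl⟩ := Finset.mem_image.1 hω'
        obtain ⟨h1, h2, h3, h4⟩ := Finset.mem_filter.1 hω
        refine Finset.mem_filter.2 ⟨(hmem _).2
          (reroot_isRootedSpanningForest ((hmem ω).1 h1) h2 h3 h4), ?_, ?_, h4⟩
        · simp [reroot]
        · exact ((hmem ω).1 h1).2.1 x h2
  calc _ ≤ ∑ y ∈ Y, m₁ / m₀ * ∑ ω ∈ Φ, configWeight ρ m ω *
        (if ω (.inr y) = true ∧ x ∈ H.verts ∧ (configGraph ω).Reachable x y then 1 else 0) :=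
        Finset.sum_le_sum fun y _ => hstep y
    _ = m₁ / m₀ * ∑ ω ∈ Φ, configWeight ρ m ω * ∑ y ∈ Y,
        (if ω (.inr y) = true ∧ x ∈ H.verts ∧ (configGraph ω).Reachable x y then 1 else 0) := by
        rw [← Finset.mul_sum, Finset.sum_comm]
        simp only [Finset.mul_sum]
    _ ≤ m₁ / m₀ * ∑ ω ∈ Φ, configWeight ρ m ω := by
        refine mul_le_mul_of_nonneg_left (Finset.sum_le_sum fun ω hω => ?_) hm1
        refine mul_le_of_le_one_right (hpos ω hω) ?_
        rw [Finset.sum_boole]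
        -- After the exchange, the sum over `y` counts the roots in the component of `x`.
        have : (Y.filter fun y => ω (.inr y) = true ∧ x ∈ H.verts ∧
            (configGraph ω).Reachable x y).card ≤ 1 := by
          rw [Finset.card_le_one]
          intro a ha b hb
          obtain ⟨-, ha1, ha2, ha3⟩ := Finset.mem_filter.1 ha
          obtain ⟨-, hb1, hb2, hb3⟩ := Finset.mem_filter.1 hb
          obtain ⟨s, -, hs⟩ := ((hmem ω).1 hω).2.2.2 x ha2
          exact (hs a ⟨ha3, ha1⟩).trans (hs b ⟨hb3, hb1⟩).symm
        exact_mod_cast this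

end Rerooting

/-! ### Boltzmann measures: determinantal marginals and their limits. -/

section FiniteMarginals

open MeasureTheory

variable {V : Type*} {G : SimpleGraph V} {r m₀ m₁ : ℝ} {D : ℕ}

/-- Countability of `V` makes singletons measurable, so this finite combination of Dirac masses can
be evaluated on any set `A`, measurable or not. -/
theorem IsoradialEmbedding.forestMeasure_real [Countable V] (S : IsoradialEmbedding G) {k : ℝ}
    (h : BoundedWeights G (S.conductance k) (S.mass k) r m₀ m₁ D) (H : G.Subgraph)
    [Finite H.verts] (A : Set (ForestConfig G)) [DecidablePred (· ∈ A)] :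
    (S.forestMeasure k H).real A =
      (∑ᶠ ω ∈ {ω : ForestConfig G | IsRootedSpanningForest H ω},
        configWeight (S.edgeConductance k) (S.mass k) ω * if ω ∈ A then 1 else 0) /
      ∑ᶠ ω ∈ {ω : ForestConfig G | IsRootedSpanningForest H ω},
        configWeight (S.edgeConductance k) (S.mass k) ω := by
  have hmx : ∀ x, 0 < S.mass k x := fun x => h.m₀_pos.trans_le (h.le_mass x)
  have hw : ∀ ω : ForestConfig G, IsRootedSpanningForest H ω →
      0 < configWeight (S.edgeConductance k) (S.mass k) ω := fun ω hω =>
    configWeight_pos (ρ := S.edgeConductance k) h.pos hmx hω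
  have hZ : 0 < S.forestPartition k H :=
    finsum_configWeight_pos H (ρ := S.edgeConductance k) h.pos hmx
  have : Fintype {ω : ForestConfig G // IsRootedSpanningForest H ω} :=
    (finite_forests (H := H)).fintype
  let _ : Fintype {ω : ForestConfig G | IsRootedSpanningForest H ω} := this
  rw [show (∑ᶠ ω ∈ {ω : ForestConfig G | IsRootedSpanningForest H ω},
        configWeight (S.edgeConductance k) (S.mass k) ω) = S.forestPartition k H from rfl,
    ← finsum_set_coe_eq_finsum_mem, finsum_eq_sum_of_fintype, Finset.sum_div]
  rw [IsoradialEmbedding.forestMeasure, Measure.sum_fintype, Measure.real,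
    Measure.finsetSum_apply, ENNReal.toReal_sum]
  · refine Finset.sum_congr rfl fun ω _ => ?_
    have h0 : 0 ≤ S.forestWeight k ω.1 := (hw ω.1 ω.2).le
    rw [Measure.smul_apply, Measure.dirac_apply, smul_eq_mul, ENNReal.toReal_mul,
      ENNReal.toReal_ofReal (div_nonneg h0 hZ.le), Set.indicator_apply]
    split_ifs <;> simp [IsoradialEmbedding.forestWeight, configWeight]
  · intro ω _
    rw [Measure.smul_apply, smul_eq_mul, Measure.dirac_apply, Set.indicator_apply]
    split_ifs <;> simp

theorem IsoradialEmbedding.isProbabilityMeasure_forestMeasure [Countable V]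
    (S : IsoradialEmbedding G) {k : ℝ}
    (h : BoundedWeights G (S.conductance k) (S.mass k) r m₀ m₁ D) (H : G.Subgraph)
    [Finite H.verts] : IsProbabilityMeasure (S.forestMeasure k H) := by
  classical
  have h1 := S.forestMeasure_real h H Set.univ
  simp only [Set.mem_univ, if_true, mul_one] at h1
  rw [div_self (finsum_configWeight_pos H (ρ := S.edgeConductance k) h.pos
    fun x => h.m₀_pos.trans_le (h.le_mass x)).ne'] at h1
  refine ⟨?_⟩
  rwa [Measure.real, ENNReal.toReal_eq_one_iff] at h1

/-- The transfer impedance associated with a Green function `g`. -/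
def impedance (ρ : Sym2 V → ℝ) (m : V → ℝ) (o : EdgeOrientation G) (g : V → V → ℝ) :
    G.edgeSet ⊕ V → G.edgeSet ⊕ V → ℝ
  | .inl e, .inl e' => ρ e' * (g (o.src e) (o.src e') - g (o.tgt e) (o.src e')
        - g (o.src e) (o.tgt e') + g (o.tgt e) (o.tgt e'))
  | .inl e, .inr x => m x * (g (o.src e) x - g (o.tgt e) x)
  | .inr x, .inl e => ρ e * (g x (o.src e) - g x (o.tgt e))
  | .inr x, .inr x' => m x' * g x x'

theorem IsoradialEmbedding.transferImpedance_eq (S : IsoradialEmbedding G) (k : ℝ)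
    (o : EdgeOrientation G) :
    S.transferImpedance k o = impedance (S.edgeConductance k) (S.mass k) o (S.green k) := by
  funext a b
  rcases a with a | a <;> rcases b with b | b <;> rfl

theorem EdgeOrientation.src_mem (o : EdgeOrientation G) {H : G.Subgraph} {e : G.edgeSet}
    (he : (e : Sym2 V) ∈ H.edgeSet) : o.src e ∈ H.verts := by
  rw [← o.mk_src_tgt e, SimpleGraph.Subgraph.mem_edgeSet] at he
  exact he.fst_mem

theorem EdgeOrientation.tgt_mem (o : EdgeOrientation G) {H : G.Subgraph} {e : G.edgeSet}
    (he : (e : Sym2 V) ∈ H.edgeSet) : o.tgt e ∈ H.verts := by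
  rw [← o.mk_src_tgt e, SimpleGraph.Subgraph.mem_edgeSet] at he
  exact he.snd_mem

variable {ι₁ ι₂ : Type*} {e : ι₁ → G.edgeSet} {x : ι₂ → V}

theorem sum_incidence_mul {H : G.Subgraph} [Fintype H.verts] (o : EdgeOrientation G)
    (heH : ∀ i, (e i : Sym2 V) ∈ H.edgeSet) (hxH : ∀ i, x i ∈ H.verts) (f : V → ℝ) (a : ι₁ ⊕ ι₂) :
    ∑ v : H.verts, incidence e x o a v * f v =
      match a with
      | .inl i => f (o.src (e i)) - f (o.tgt (e i))
      | .inr i => f (x i) := by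
  classical
  have key : ∀ u (hu : u ∈ H.verts), ∑ v : H.verts, (if u = (v : V) then 1 else 0) * f v = f u := by
    intro u hu
    rw [Finset.sum_eq_single ⟨u, hu⟩]
    · simp
    · intro b _ hb
      rw [if_neg, zero_mul]
      exact fun h => hb (Subtype.ext h.symm)
    · simp
  rcases a with i | i
  · simp only [incidence, sub_mul, Finset.sum_sub_distrib]
    rw [← key _ (o.src_mem (heH i)), ← key _ (o.tgt_mem (heH i))]
  · refine Eq.trans ?_ (key _ (hxH i))
    simp only [incidence]

variable [Fintype ι₁] [Fintype ι₂]

/-- Multiplying by an incidence row takes a difference across an edge or evaluates at a vertex;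
doing so in both variables of the Green function yields the impedance. -/
theorem incidence_mul_inv_mul {H : G.Subgraph} [Fintype H.verts] [DecidableEq H.verts]
    [DecidableEq ι₁] [DecidableEq ι₂] (o : EdgeOrientation G) (ρ : Sym2 V → ℝ) (m : V → ℝ)
    (heH : ∀ i, (e i : Sym2 V) ∈ H.edgeSet) (hxH : ∀ i, x i ∈ H.verts) :
    (Matrix.of fun (a : ι₁ ⊕ ι₂) (v : H.verts) => incidence e x o a v) *
          (forestLaplacian H (ρ, m))⁻¹ *
          ((Matrix.of fun (a : ι₁ ⊕ ι₂) (v : H.verts) => incidence e x o a v).transpose *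
            Matrix.diagonal (familyWeight e x ρ m)) =
      Matrix.of fun a b : ι₁ ⊕ ι₂ =>
        impedance ρ m o (finiteGreen H ρ m) (Sum.map e x a) (Sum.map e x b) := by
  ext a b
  rw [Matrix.mul_apply]
  simp only [Matrix.mul_diagonal]
  simp only [Matrix.mul_apply, Matrix.transpose_apply, Matrix.of_apply,
    ← finiteGreen_coe]
  let F : V → ℝ := fun v => match a with
    | .inl i => finiteGreen H ρ m (o.src (e i)) v - finiteGreen H ρ m (o.tgt (e i)) v
    | .inr i => finiteGreen H ρ m (x i) v
  have h1 : ∀ v : H.verts, ∑ u : H.verts, incidence e x o a u * finiteGreen H ρ m u v = F v :=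
    fun v => sum_incidence_mul o heH hxH (fun u => finiteGreen H ρ m u v) a
  simp only [h1]
  have h2 : ∑ v : H.verts, F v * (incidence e x o b v * familyWeight e x ρ m b) =
      familyWeight e x ρ m b * ∑ v : H.verts, incidence e x o b v * F v := by
    rw [Finset.mul_sum]
    exact Finset.sum_congr rfl fun v _ => by ring
  rw [h2, sum_incidence_mul o heH hxH]
  rcases a with a | a <;> rcases b with b | b <;>
    simp only [F, familyWeight, impedance, Sum.map_inl, Sum.map_inr]
  ring

theorem prod_familyIndicator (ω : ForestConfig G) [Decidable (∀ a, ω (Sum.map e x a) = true)] :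
    ∏ a, familyIndicator e x ω a = if ∀ a, ω (Sum.map e x a) = true then 1 else 0 := by
  classical
  have h1 : ∀ a, familyIndicator e x ω a = if ω (Sum.map e x a) = true then 1 else 0 := by
    rintro (a | a)
    · simp only [familyIndicator, Sum.map_inl]; congr!
    · simp only [familyIndicator, Sum.map_inr]; congr!
  simp only [h1]
  rw [Finset.prod_ite_zero]
  simp

theorem IsoradialEmbedding.forestMeasure_real_cylinder [Countable V] [DecidableEq ι₁]
    [DecidableEq ι₂] (S : IsoradialEmbedding G) {k : ℝ}
    (h : BoundedWeights G (S.conductance k) (S.mass k) r m₀ m₁ D) (H : G.Subgraph)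
    [Fintype H.verts] (o : EdgeOrientation G) (he : Function.Injective e)
    (hx : Function.Injective x) (heH : ∀ i, (e i : Sym2 V) ∈ H.edgeSet)
    (hxH : ∀ i, x i ∈ H.verts) :
    (S.forestMeasure k H).real {ω | ∀ a, ω (Sum.map e x a) = true} =
      (Matrix.of fun a b : ι₁ ⊕ ι₂ => impedance (S.edgeConductance k) (S.mass k) o
        (finiteGreen H (S.edgeConductance k) (S.mass k)) (Sum.map e x a) (Sum.map e x b)).det := by
  classical
  have h' : BoundedWeights G (fun x y => S.edgeConductance k s(x, y)) (S.mass k) r m₀ m₁ D := h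
  have hdet := det_forestLaplacian_pos h' H
  have h1 := finsum_forest_familyIndicator H o (S.edgeConductance k) (S.mass k) he hx heH hdet.ne'
  rw [incidence_mul_inv_mul o _ _ heH hxH] at h1
  rw [S.forestMeasure_real h, ← det_forestLaplacian, div_eq_iff hdet.ne', mul_comm, ← h1]
  refine finsum_mem_congr rfl fun ω _ => ?_
  rw [prod_familyIndicator]
  simp only [Set.mem_ofPred_eq]

theorem IsoradialEmbedding.tendsto_forestMeasure_cylinder [Countable V] [DecidableEq ι₁]
    [DecidableEq ι₂] (S : IsoradialEmbedding G) {k : ℝ}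
    (h : BoundedWeights G (S.conductance k) (S.mass k) r m₀ m₁ D) (o : EdgeOrientation G)
    {H : ℕ → G.Subgraph} (hH : IsFiniteExhaustion G H) (he : Function.Injective e)
    (hx : Function.Injective x) :
    Filter.Tendsto (fun n => (S.forestMeasure k (H n)).real {ω | ∀ a, ω (Sum.map e x a) = true})
      Filter.atTop (nhds (Matrix.of fun a b : ι₁ ⊕ ι₂ =>
        S.transferImpedance k o (Sum.map e x a) (Sum.map e x b)).det) := by
  have hft : ∀ n, Fintype (H n).verts := fun n => (hH.finite n).fintype
  have h1 : ∀ᶠ n in Filter.atTop, ∀ i, (e i : Sym2 V) ∈ (H n).edgeSet := by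
    rw [Filter.eventually_all]
    intro i
    have hadj : G.Adj (o.src (e i)) (o.tgt (e i)) := by
      rw [← SimpleGraph.mem_edgeSet, o.mk_src_tgt]; exact (e i).2
    obtain ⟨n, hn⟩ := hH.exists_adj _ _ hadj
    filter_upwards [Filter.eventually_ge_atTop n] with k hk
    rw [← o.mk_src_tgt, SimpleGraph.Subgraph.mem_edgeSet]
    exact (hH.monotone hk).2 hn
  have h2 : ∀ᶠ n in Filter.atTop, ∀ i, x i ∈ (H n).verts := by
    rw [Filter.eventually_all]
    intro i
    obtain ⟨n, hn⟩ := hH.exists_mem_verts (x i)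
    filter_upwards [Filter.eventually_ge_atTop n] with k hk
    exact (hH.monotone hk).1 hn
  have h3 : Filter.Tendsto (fun n => (Matrix.of fun a b : ι₁ ⊕ ι₂ =>
      impedance (S.edgeConductance k) (S.mass k) o
        (finiteGreen (H n) (S.edgeConductance k) (S.mass k)) (Sum.map e x a) (Sum.map e x b)).det)
      Filter.atTop (nhds (Matrix.of fun a b : ι₁ ⊕ ι₂ =>
        S.transferImpedance k o (Sum.map e x a) (Sum.map e x b)).det) := by
    refine ((continuous_id.matrix_det).tendsto _).comp ?_
    refine tendsto_pi_nhds.2 fun a => tendsto_pi_nhds.2 fun b => ?_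
    rw [S.transferImpedance_eq]
    have hg := fun u v => S.tendsto_finiteGreen h hH u v
    simp only [Matrix.of_apply]
    rcases a with a | a <;> rcases b with b | b <;>
      simp only [Sum.map_inl, Sum.map_inr, impedance]
    · exact ((((hg _ _).sub (hg _ _)).sub (hg _ _)).add (hg _ _)).const_mul _
    · exact ((hg _ _).sub (hg _ _)).const_mul _
    · exact ((hg _ _).sub (hg _ _)).const_mul _
    · exact (hg _ _).const_mul _
  refine h3.congr' ?_
  filter_upwards [h1, h2] with n hn1 hn2
  exact (S.forestMeasure_real_cylinder h (H n) o he hx hn1 hn2).symm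

end FiniteMarginals

/-! ### Topology and measurability on the space of configurations. -/

section ConfigurationSpace

open MeasureTheory

/-- Finite measures on `{0,1}^I` are determined by the probabilities of the events that all the
elements of a finite set are present. -/
theorem MeasureTheory.Measure.ext_of_cylinders {I : Type*} {μ ν : Measure (I → Bool)} [IsFiniteMeasure μ]
    [IsFiniteMeasure ν]
    (h : ∀ T : Finset I, μ.real {ω | ∀ t ∈ T, ω t = true} = ν.real {ω | ∀ t ∈ T, ω t = true}) :
    μ = ν := by
  classical
  have h' : ∀ T : Finset I, μ {ω | ∀ t ∈ T, ω t = true} = ν {ω | ∀ t ∈ T, ω t = true} := fun T =>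
    (measureReal_eq_measureReal_iff).1 (h T)
  refine ext_of_generate_finite
    (Set.range fun T : Finset I => {ω : I → Bool | ∀ t ∈ T, ω t = true}) (le_antisymm ?_ ?_) ?_ ?_ ?_
  · refine iSup_le fun t => ?_
    rw [← measurable_iff_comap_le]
    refine @measurable_to_bool _ (_) _ ?_
    refine MeasurableSpace.measurableSet_generateFrom ⟨{t}, ?_⟩
    ext ω
    simp
  · refine MeasurableSpace.generateFrom_le ?_
    rintro _ ⟨T, rfl⟩
    simp only [Set.ofPred_forall]
    refine MeasurableSet.biInter T.countable_toSet fun t _ => ?_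
    exact measurableSet_eq_fun (measurable_pi_apply t) measurable_const
  · rintro _ ⟨T, rfl⟩ _ ⟨T', rfl⟩ -
    refine ⟨T ∪ T', ?_⟩
    ext ω
    simp only [Finset.mem_union, Set.mem_inter_iff, Set.mem_ofPred_eq]
    constructor
    · exact fun h => ⟨fun t ht => h t (Or.inl ht), fun t ht => h t (Or.inr ht)⟩
    · rintro ⟨h1, h2⟩ t (ht | ht)
      exacts [h1 t ht, h2 t ht]
  · rintro _ ⟨T, rfl⟩
    exact h' T
  · simpa using h' ∅

theorem isClopen_coordinate {I : Type*} (t : I) : IsClopen {ω : I → Bool | ω t = true} :=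
  (isClopen_discrete ({true} : Set Bool)).preimage (continuous_apply t)

theorem isClopen_const_and {X : Type*} [TopologicalSpace X] (p : Prop) {q : X → Prop}
    (hq : IsClopen {ω | q ω}) : IsClopen {ω | p ∧ q ω} := by
  by_cases hp : p
  · simpa [hp] using hq
  · simpa [hp] using isClopen_empty

theorem isClopen_cylinder {I : Type*} {ι : Type*} [Finite ι] (t : ι → I) :
    IsClopen {ω : I → Bool | ∀ a, ω (t a) = true} := by
  simp only [Set.ofPred_forall]
  exact isClopen_iInter_of_finite fun a => isClopen_coordinate (t a)

variable {V : Type*} {G : SimpleGraph V}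

/-- Local finiteness leaves finitely many paths of length at most `L` from `y`. Clopen events matter
because their probabilities pass to weak limits. -/
theorem isClopen_reachWithin (hfin : ∀ x, (G.neighborSet x).Finite)
    {base : V → Set (ForestConfig G)} (hb : ∀ z, IsClopen (base z)) (L : ℕ) (y : V) :
    IsClopen (reachWithin base L y) := by
  induction L generalizing y with
  | zero => exact hb y
  | succ L ih =>
    refine (hb y).union ?_
    have : {ω : ForestConfig G | ∃ z, ∃ h : G.Adj y z, ω (.inl ⟨s(y, z), h⟩) = true ∧
        ω ∈ reachWithin base L z} = ⋃ z ∈ G.neighborSet y, {ω | ∃ h : G.Adj y z,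
        ω (.inl ⟨s(y, z), h⟩) = true ∧ ω ∈ reachWithin base L z} := by
      ext ω
      simp only [Set.mem_ofPred_eq, Set.mem_iUnion, SimpleGraph.mem_neighborSet]
      constructor
      · rintro ⟨z, h, hz⟩
        exact ⟨z, h, h, hz⟩
      · rintro ⟨z, -, h⟩
        exact ⟨z, h⟩
    rw [this]
    refine (hfin y).isClopen_biUnion fun z hz => ?_
    have h1 := (isClopen_coordinate (I := G.edgeSet ⊕ V) (.inl ⟨s(y, z), hz⟩)).inter (ih z)
    convert h1 using 1
    ext ω
    simp only [Set.mem_ofPred_eq, Set.mem_inter_iff]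
    exact ⟨fun ⟨_, h⟩ => h, fun h => ⟨hz, h⟩⟩

theorem reachWithin_mono (base : V → Set (ForestConfig G)) (y : V) :
    Monotone fun L => reachWithin base L y := by
  refine monotone_nat_of_le_succ fun L => ?_
  induction L generalizing y with
  | zero => exact fun ω hω => Or.inl hω
  | succ L ih =>
    rintro ω (hω | ⟨z, h, h1, h2⟩)
    · exact Or.inl hω
    · exact Or.inr ⟨z, h, h1, ih z h2⟩

theorem exists_mem_reachWithin {base : V → Set (ForestConfig G)} {ω : ForestConfig G} {y : V} :
    (∃ L, ω ∈ reachWithin base L y) ↔ ∃ z, (configGraph ω).Reachable y z ∧ ω ∈ base z := by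
  constructor
  · rintro ⟨L, hL⟩
    induction L generalizing y with
    | zero => exact ⟨y, .refl _, hL⟩
    | succ L ih =>
      rcases hL with hL | ⟨z, h, h1, h2⟩
      · exact ⟨y, .refl _, hL⟩
      · obtain ⟨w, hw, hw'⟩ := ih h2
        exact ⟨w, (configGraph_adj.2 ⟨h, h1⟩).reachable.trans hw, hw'⟩
  · rintro ⟨z, ⟨p⟩, hz⟩
    induction p with
    | nil => exact ⟨0, hz⟩
    | cons h p ih =>
      obtain ⟨L, hL⟩ := ih hz
      obtain ⟨h1, h2⟩ := configGraph_adj.1 h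
      exact ⟨L + 1, Or.inr ⟨_, h1, h2, hL⟩⟩

/-- A cycle is a property of finitely many edges. -/
theorem exists_finset_of_not_isAcyclic {ω : ForestConfig G} (hω : ¬ (configGraph ω).IsAcyclic) :
    ∃ T : Finset (G.edgeSet ⊕ V), (∀ t ∈ T, ω t = true) ∧
      ∀ ω' : ForestConfig G, (∀ t ∈ T, ω' t = true) → ¬ (configGraph ω').IsAcyclic := by
  classical
  simp only [SimpleGraph.IsAcyclic, not_forall, not_not] at hω
  obtain ⟨v, p, hp⟩ := hω
  have hmem : ∀ e ∈ p.edges, ∃ h : e ∈ G.edgeSet, ω (.inl ⟨e, h⟩) = true := by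
    intro e he
    have := p.edges_subset_edgeSet he
    rw [configGraph, SimpleGraph.edgeSet_fromEdgeSet] at this
    exact this.1
  choose hG hω using hmem
  refine ⟨p.edges.toFinset.attach.image fun e => .inl ⟨e.1, hG e.1 (List.mem_toFinset.1 e.2)⟩,
    ?_, ?_⟩
  · intro t ht
    obtain ⟨e, -, rfl⟩ := Finset.mem_image.1 ht
    exact hω e.1 (List.mem_toFinset.1 e.2)
  · intro ω' hω' hac
    have h1 : ∀ e ∈ p.edges, e ∈ (configGraph ω').edgeSet := by
      intro e he
      rw [configGraph, SimpleGraph.edgeSet_fromEdgeSet]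
      refine ⟨⟨hG e he, hω' _ (Finset.mem_image.2 ⟨⟨e, List.mem_toFinset.2 he⟩,
        Finset.mem_attach _ _, rfl⟩)⟩, G.not_isDiag_of_mem_edgeSet (hG e he)⟩
    exact hac _ (hp.transfer h1)

/-- The three conditions are treated differently in the limit. Acyclicity and uniqueness of roots
each exclude a union of clopen events, whereas the existence of a root asks for some finite `L` and
is not a closed condition, so it needs the tail estimate. -/
theorem isRootedSpanningForest_top_iff {ω : ForestConfig G} :
    IsRootedSpanningForest (⊤ : G.Subgraph) ω ↔ (configGraph ω).IsAcyclic ∧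
      (∀ x, ∃ L, ω ∈ reachWithin (fun z => {ω | ω (.inr z) = true}) L x) ∧
      ∀ x z, x ≠ z → ∀ L, ω ∉ {ω | ω (.inr x) = true} ∩
        reachWithin (fun u => {ω | u = z ∧ ω (.inr z) = true}) L x := by
  have key : (∀ x z, x ≠ z → ∀ L, ω ∉ {ω | ω (.inr x) = true} ∩
      reachWithin (fun u => {ω | u = z ∧ ω (.inr z) = true}) L x) ↔
      ∀ x z, x ≠ z → ω (.inr x) = true → ω (.inr z) = true →
        ¬ (configGraph ω).Reachable x z := by
    refine forall_congr' fun x => forall_congr' fun z => imp_congr_right fun _ => ?_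
    rw [← not_exists]
    simp only [Set.mem_inter_iff, exists_and_left, exists_mem_reachWithin, Set.mem_ofPred_eq]
    constructor
    · exact fun h h1 h2 h3 => h ⟨h1, z, h3, rfl, h2⟩
    · rintro h ⟨h1, _, h3, rfl, h2⟩
      exact h h1 h2 h3
  rw [key]
  simp only [exists_mem_reachWithin, Set.mem_ofPred_eq]
  constructor
  · rintro ⟨-, -, h1, h2⟩
    refine ⟨h1, fun x => (h2 x trivial).exists, fun x z hne hx hz hr => hne ?_⟩
    exact (h2 x trivial).unique ⟨.refl _, hx⟩ ⟨hr, hz⟩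
  · rintro ⟨h1, h2, h3⟩
    refine ⟨fun e _ => by simp, fun _ _ => trivial, h1, fun x _ => ?_⟩
    obtain ⟨z, hz, hz'⟩ := h2 x
    refine ⟨z, ⟨hz, hz'⟩, fun w ⟨hw, hw'⟩ => ?_⟩
    by_contra hne
    exact h3 w z hne hw' hz' (hw.symm.trans hz)

theorem setOf_not_isAcyclic_eq : {ω : ForestConfig G | ¬ (configGraph ω).IsAcyclic} =
    ⋃ T ∈ {T : Finset (G.edgeSet ⊕ V) | ∀ ω' : ForestConfig G, (∀ t ∈ T, ω' t = true) →
      ¬ (configGraph ω').IsAcyclic}, {ω | ∀ t : T, ω t = true} := by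
  ext ω
  simp only [Set.mem_ofPred_eq, Set.mem_iUnion, Subtype.forall]
  constructor
  · intro h
    obtain ⟨T, h1, h2⟩ := exists_finset_of_not_isAcyclic h
    exact ⟨T, h2, h1⟩
  · rintro ⟨T, h1, h2⟩
    exact h1 ω h2

theorem measurableSet_forests [Countable V] (hfin : ∀ x, (G.neighborSet x).Finite) :
    MeasurableSet {ω : ForestConfig G | IsRootedSpanningForest (⊤ : G.Subgraph) ω} := by
  simp only [isRootedSpanningForest_top_iff, Set.ofPred_and, Set.ofPred_forall, Set.ofPred_exists]
  refine MeasurableSet.inter ?_ (MeasurableSet.inter ?_ ?_)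
  · rw [← MeasurableSet.compl_iff, show {ω : ForestConfig G | (configGraph ω).IsAcyclic}ᶜ =
      {ω : ForestConfig G | ¬ (configGraph ω).IsAcyclic} from rfl, setOf_not_isAcyclic_eq]
    exact MeasurableSet.biUnion (Set.to_countable _) fun T _ =>
      (isClopen_cylinder fun t : T => (t : G.edgeSet ⊕ V)).2.measurableSet
  · exact MeasurableSet.iInter fun x => MeasurableSet.iUnion fun L =>
      (isClopen_reachWithin hfin (fun z => isClopen_coordinate _) L x).2.measurableSet
  · refine MeasurableSet.iInter fun x => MeasurableSet.iInter fun z => MeasurableSet.iInter fun _ =>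
      MeasurableSet.iInter fun L => (MeasurableSet.compl ?_)
    refine ((isClopen_coordinate _).inter (isClopen_reachWithin hfin (fun u => ?_) L x)).2.measurableSet
    exact isClopen_const_and _ (isClopen_coordinate _)

end ConfigurationSpace

/-! ### The infinite-volume determinantal measure. -/

section Limit

open MeasureTheory Filter Topology

variable {V : Type*} {G : SimpleGraph V} {r m₀ m₁ : ℝ} {D : ℕ}

namespace IsoradialEmbedding

/-- The edges and roots form a determinantal process under `μ`. -/
def IsDeterminantal (S : IsoradialEmbedding G) (k : ℝ) (o : EdgeOrientation G)
    (μ : Measure (ForestConfig G)) : Prop :=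
  ∀ (j l : ℕ) (e : Fin j → G.edgeSet) (x : Fin l → V),
    Function.Injective e → Function.Injective x →
    μ.real {ω | ∀ a, ω (Sum.map e x a) = true} =
      (Matrix.of fun a b => S.transferImpedance k o (Sum.map e x a) (Sum.map e x b)).det

variable {S : IsoradialEmbedding G} {k : ℝ} {o : EdgeOrientation G}

/-- The empty family has a determinant of size zero, equal to `1`: total mass one is a consequence
of the marginals, not an extra assumption. -/
theorem IsDeterminantal.real_univ {μ : Measure (ForestConfig G)} (h : S.IsDeterminantal k o μ) :
    μ.real Set.univ = 1 := by
  have := h 0 0 Fin.elim0 Fin.elim0 (fun a => a.elim0) (fun a => a.elim0)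
  simpa using this

theorem IsDeterminantal.isProbabilityMeasure {μ : Measure (ForestConfig G)}
    (h : S.IsDeterminantal k o μ) : IsProbabilityMeasure μ := by
  refine ⟨?_⟩
  have := h.real_univ
  rwa [Measure.real, ENNReal.toReal_eq_one_iff] at this

theorem IsDeterminantal.eq {μ ν : Measure (ForestConfig G)} (hμ : S.IsDeterminantal k o μ)
    (hν : S.IsDeterminantal k o ν) : μ = ν := by
  have := hμ.isProbabilityMeasure
  have := hν.isProbabilityMeasure
  refine Measure.ext_of_cylinders fun T => ?_
  have hset : {ω : ForestConfig G | ∀ t ∈ T, ω t = true} =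
      {ω | ∀ a, ω (Sum.map (fun i => (T.toLeft.equivFin.symm i).1)
        (fun i => (T.toRight.equivFin.symm i).1) a) = true} := by
    ext ω
    simp only [Set.mem_ofPred_eq, Sum.forall, Sum.map_inl, Sum.map_inr]
    refine and_congr ?_ ?_
    · rw [T.toLeft.equivFin.symm.forall_congr_left]
      simp
    · rw [T.toRight.equivFin.symm.forall_congr_left]
      simp
  have h1 := Subtype.val_injective.comp T.toLeft.equivFin.symm.injective
  have h2 := Subtype.val_injective.comp T.toRight.equivFin.symm.injective
  rw [hset]
  exact (hμ _ _ _ _ h1 h2).trans (hν _ _ _ _ h1 h2).symm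

/-- Limits are taken in the compact space of all configurations, where the set of forests need not
be closed, so the condition is transferred there. -/
theorem hasDeterminantalMarginals_iff {P : Measure (RootedSpanningForest G)} :
    S.HasDeterminantalMarginals k o P ↔ S.IsDeterminantal k o (P.map Subtype.val) := by
  unfold HasDeterminantalMarginals IsDeterminantal
  refine forall_congr' fun j => forall_congr' fun l => forall_congr' fun e => forall_congr' fun x =>
    imp_congr_right fun _ => imp_congr_right fun _ => ?_
  have h1 : (P.map Subtype.val).real {ω : ForestConfig G | ∀ a, ω (Sum.map e x a) = true} =
      P.real {ω | (∀ i, ω.1 (.inl (e i)) = true) ∧ ∀ i, ω.1 (.inr (x i)) = true} := by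
    rw [Measure.real, Measure.real, Measure.map_apply measurable_subtype_coe]
    · congr 2
      ext ω
      simp [Sum.forall]
    · simp only [Set.ofPred_forall]
      exact MeasurableSet.iInter fun a => measurableSet_eq_fun (measurable_pi_apply _)
        measurable_const
  rw [h1]
  refine Eq.congr rfl (congrArg Matrix.det ?_)
  ext a b
  rcases a with a | a <;> rcases b with b | b <;> rfl

/-- Cylinders are clopen, so their probabilities converge under weak convergence. The filter `F` is
general because it will be an ultrafilter. -/
theorem isDeterminantal_of_tendsto [Countable V]
    (h : BoundedWeights G (S.conductance k) (S.mass k) r m₀ m₁ D) {H : ℕ → G.Subgraph}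
    (hH : IsFiniteExhaustion G H) {F : Filter ℕ} [F.NeBot] (hF : F ≤ atTop)
    {P : ℕ → ProbabilityMeasure (ForestConfig G)} (hP : ∀ n, (P n : Measure _) = S.forestMeasure k (H n))
    {μ : ProbabilityMeasure (ForestConfig G)} (hμ : Tendsto P F (𝓝 μ)) :
    S.IsDeterminantal k o (μ : Measure (ForestConfig G)) := by
  intro j l e x he hx
  have h1 := ProbabilityMeasure.tendsto_measure_of_null_frontier_of_tendsto' hμ
    (E := {ω : ForestConfig G | ∀ a, ω (Sum.map e x a) = true})
    (by rw [(isClopen_cylinder _).frontier_eq]; simp)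
  have h2 := (ENNReal.tendsto_toReal (measure_ne_top _ _)).comp h1
  refine tendsto_nhds_unique h2 (((S.tendsto_forestMeasure_cylinder h o hH he hx).mono_left hF).congr
    fun n => ?_)
  rw [← hP n]
  rfl

theorem exists_exhaustion (S : IsoradialEmbedding G) :
    ∃ H : ℕ → G.Subgraph, IsFiniteExhaustion G H := by
  refine ⟨fun n => (⊤ : G.Subgraph).induce {v | ‖S.pos v‖ ≤ n}, ?_, ?_, ?_, ?_⟩
  · intro a b hab
    refine SimpleGraph.Subgraph.induce_mono_right fun v hv => ?_
    exact (show ‖S.pos v‖ ≤ a from hv).trans (Nat.cast_le.2 hab)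
  · exact fun n => S.finite_vertices n
  · intro x
    exact exists_nat_ge ‖S.pos x‖
  · intro x y hxy
    obtain ⟨n, hn⟩ := exists_nat_ge (max ‖S.pos x‖ ‖S.pos y‖)
    exact ⟨n, (le_max_left _ _).trans hn, (le_max_right _ _).trans hn, hxy⟩

/-- The Boltzmann measures on rooted spanning forests converge along any exhaustion, to the
determinantal measure. -/
theorem exists_isDeterminantal [Countable V] (S : IsoradialEmbedding G) {k : ℝ}
    (h : BoundedWeights G (S.conductance k) (S.mass k) r m₀ m₁ D) (o : EdgeOrientation G) :
    ∃ μ : ProbabilityMeasure (ForestConfig G), S.IsDeterminantal k o (μ : Measure _) ∧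
      ∀ H : ℕ → G.Subgraph, IsFiniteExhaustion G H →
        ∀ P : ℕ → ProbabilityMeasure (ForestConfig G),
        (∀ n, (P n : Measure _) = S.forestMeasure k (H n)) → Tendsto P atTop (𝓝 μ) := by
  have hprob : ∀ H : ℕ → G.Subgraph, IsFiniteExhaustion G H → ∀ n,
      IsProbabilityMeasure (S.forestMeasure k (H n)) := fun H hH n => by
    have := (hH.finite n).to_subtype
    exact S.isProbabilityMeasure_forestMeasure h (H n)
  obtain ⟨H₀, hH₀⟩ := S.exists_exhaustion
  let P₀ : ℕ → ProbabilityMeasure (ForestConfig G) := fun n => ⟨_, hprob H₀ hH₀ n⟩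
  -- Compactness of the space of probability measures on configurations: every sequence has a limit
  -- along every ultrafilter.
  have hlim : ∀ (F : Ultrafilter ℕ) (P : ℕ → ProbabilityMeasure (ForestConfig G)),
      ∃ ν, Tendsto P F (𝓝 ν) := fun F P =>
    ⟨(F.map P).lim, (F.map P).le_nhds_lim⟩
  obtain ⟨μ, hμ⟩ := hlim (hyperfilter ℕ) P₀
  have hdet : S.IsDeterminantal k o (μ : Measure _) :=
    isDeterminantal_of_tendsto h hH₀ Nat.hyperfilter_le_atTop (fun _ => rfl) hμ
  refine ⟨μ, hdet, fun H hH P hP => ?_⟩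
  -- Each ultrafilter limit along `H` is determinantal, hence equal to `μ`; this upgrades
  -- compactness to convergence.
  rw [tendsto_iff_ultrafilter]
  intro F hF
  obtain ⟨ν, hν⟩ := hlim F P
  have : μ = ν := Subtype.ext (hdet.eq (isDeterminantal_of_tendsto h hH hF hP hν))
  rwa [this]

end IsoradialEmbedding

end Limit

/-! ### Almost sure properties of the limit. -/

section AlmostSure

open MeasureTheory Filter Topology

variable {V : Type*} {G : SimpleGraph V} {r m₀ m₁ : ℝ} {D : ℕ}

namespace IsoradialEmbedding

variable [Countable V] {S : IsoradialEmbedding G} {k : ℝ}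

theorem forestMeasure_real_eq_zero (h : BoundedWeights G (S.conductance k) (S.mass k) r m₀ m₁ D)
    (H : G.Subgraph) [Finite H.verts] {A : Set (ForestConfig G)}
    (hA : ∀ ω, IsRootedSpanningForest H ω → ω ∉ A) : (S.forestMeasure k H).real A = 0 := by
  classical
  rw [S.forestMeasure_real h, finsum_mem_eq_zero_of_forall_eq_zero, zero_div]
  intro ω hω
  rw [if_neg (hA ω hω), mul_zero]

theorem forestMeasure_real_reachWithin (h : BoundedWeights G (S.conductance k) (S.mass k) r m₀ m₁ D)
    (H : G.Subgraph) [Finite H.verts] {y : V} (hy : y ∈ H.verts) (L : ℕ) :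
    (S.forestMeasure k H).real (reachWithin (fun z => {ω | ω (.inr z) = true}) L y)ᶜ ≤
      (D * r / (D * r + m₀)) ^ (L + 1) := by
  classical
  have h' : BoundedWeights G (fun x y => S.edgeConductance k s(x, y)) (S.mass k) r m₀ m₁ D := h
  rw [S.forestMeasure_real h, div_le_iff₀ (finsum_configWeight_pos H h'.pos
    fun x => h.m₀_pos.trans_le (h.le_mass x))]
  refine le_trans (le_of_eq ?_) (sum_notMem_reachWithin_le h' H hy L)
  refine finsum_mem_congr rfl fun ω _ => ?_
  simp only [Set.mem_compl_iff, ite_not]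

/-- Paths are truncated at length `L` so that the events are clopen; the bound depends neither on
`L` nor on `H`, and so survives both limits. -/
theorem sum_forestMeasure_real_le (h : BoundedWeights G (S.conductance k) (S.mass k) r m₀ m₁ D)
    (H : G.Subgraph) [Finite H.verts] (x : V) {Y : Finset V} (hY : ∀ y ∈ Y, y ∈ H.verts) (L : ℕ) :
    ∑ y ∈ Y, (S.forestMeasure k H).real
      ({ω | ω (.inr x) = true} ∩ reachWithin (fun u => {_ω | u = y}) L x) ≤ m₁ / m₀ := by
  classical
  have h' : BoundedWeights G (fun x y => S.edgeConductance k s(x, y)) (S.mass k) r m₀ m₁ D := h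
  have hm : ∀ x, 0 < S.mass k x := fun x => h.m₀_pos.trans_le (h.le_mass x)
  simp only [S.forestMeasure_real h]
  rw [← Finset.sum_div, div_le_iff₀ (finsum_configWeight_pos H h'.pos hm)]
  refine le_trans (Finset.sum_le_sum fun y hy => ?_) (sum_reachable_root_le h' H x Y)
  simp only [finsum_mem_eq_finite_toFinset_sum _ (finite_forests (H := H))]
  refine Finset.sum_le_sum fun ω hω => ?_
  have hw : 0 ≤ configWeight (S.edgeConductance k) (S.mass k) ω :=
    (configWeight_pos h'.pos hm (by simpa using hω)).le
  refine mul_le_mul_of_nonneg_left ?_ hw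
  by_cases hr : ω ∈ {ω : ForestConfig G | ω (.inr x) = true} ∩ reachWithin (fun u => {_ω | u = y}) L x
  · obtain ⟨z, hz, rfl⟩ := exists_mem_reachWithin.1 ⟨L, hr.2⟩
    rw [if_pos hr, if_pos ⟨hr.1, hY _ hy, hz⟩]
  · rw [if_neg hr]
    split_ifs <;> simp

end IsoradialEmbedding

/-- `μ` is the limit of the Boltzmann measures along an exhaustion. -/
structure IsForestLimit (S : IsoradialEmbedding G) (k : ℝ) (H : ℕ → G.Subgraph)
    (μ : Measure (ForestConfig G)) : Prop where
  isProbabilityMeasure : IsProbabilityMeasure μ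
  exhaustion : IsFiniteExhaustion G H
  tendsto : ∀ A : Set (ForestConfig G), IsClopen A →
    Tendsto (fun n => (S.forestMeasure k (H n)).real A) atTop (𝓝 (μ.real A))

namespace IsForestLimit

variable {S : IsoradialEmbedding G} {k : ℝ} {H : ℕ → G.Subgraph} {μ : Measure (ForestConfig G)}

theorem eventually_mem (hμ : IsForestLimit S k H μ) (y : V) : ∀ᶠ n in atTop, y ∈ (H n).verts := by
  obtain ⟨n, hn⟩ := hμ.exhaustion.exists_mem_verts y
  filter_upwards [eventually_ge_atTop n] with k hk
  exact (hμ.exhaustion.monotone hk).1 hn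

variable [Countable V]

theorem measure_eq_zero (hμ : IsForestLimit S k H μ)
    (h : BoundedWeights G (S.conductance k) (S.mass k) r m₀ m₁ D) {A : Set (ForestConfig G)}
    (hA : IsClopen A) (hA' : ∀ n ω, IsRootedSpanningForest (H n) ω → ω ∉ A) : μ A = 0 := by
  have := hμ.isProbabilityMeasure
  rw [← measureReal_eq_zero_iff]
  refine tendsto_nhds_unique (hμ.tendsto A hA) ?_
  refine tendsto_const_nhds.congr fun n => ?_
  have := (hμ.exhaustion.finite n).to_subtype
  exact (IsoradialEmbedding.forestMeasure_real_eq_zero h (H n) (hA' n)).symm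

theorem ae_isAcyclic (hμ : IsForestLimit S k H μ)
    (h : BoundedWeights G (S.conductance k) (S.mass k) r m₀ m₁ D) :
    ∀ᵐ ω ∂μ, (configGraph ω).IsAcyclic := by
  rw [ae_iff, setOf_not_isAcyclic_eq, measure_biUnion_null_iff (Set.to_countable _)]
  intro T hT
  refine hμ.measure_eq_zero h (isClopen_cylinder _) fun n ω hω hωT => ?_
  exact hT ω (by simpa using hωT) hω.2.2.1

/-- For fixed `L` the event of finding no root within `L` edges is clopen, so the finite-volume tail
bound passes to `μ`; then let `L` tend to infinity. -/
theorem ae_exists_root (hμ : IsForestLimit S k H μ)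
    (h : BoundedWeights G (S.conductance k) (S.mass k) r m₀ m₁ D) :
    ∀ᵐ ω ∂μ, ∀ y, ∃ L, ω ∈ reachWithin (fun z => {ω | ω (.inr z) = true}) L y := by
  have := hμ.isProbabilityMeasure
  have hm0 := h.m₀_pos
  have hDr : 0 ≤ D * r := mul_nonneg (by positivity) h.r_nonneg
  have hq1 : D * r / (D * r + m₀) < 1 := (div_lt_one (by positivity)).2 (by linarith)
  rw [ae_all_iff]
  intro y
  rw [ae_iff, ← measureReal_eq_zero_iff]
  refine le_antisymm (ge_of_tendsto ((tendsto_pow_atTop_nhds_zero_of_lt_one (by positivity)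
    hq1).comp (tendsto_add_atTop_nat 1)) (.of_forall fun L => ?_)) measureReal_nonneg
  have hc := (isClopen_reachWithin h.finite
    (fun z => isClopen_coordinate (I := G.edgeSet ⊕ V) (.inr z)) L y).compl
  have hsub : {ω : ForestConfig G | ¬ ∃ L, ω ∈ reachWithin (fun z => {ω | ω (.inr z) = true}) L y} ⊆
      (reachWithin (fun z => {ω | ω (.inr z) = true}) L y)ᶜ := fun ω hω hω' => hω ⟨L, hω'⟩
  refine (measureReal_mono hsub).trans ?_
  refine le_of_tendsto (hμ.tendsto _ hc) ?_
  filter_upwards [hμ.eventually_mem y] with n hn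
  have := (hμ.exhaustion.finite n).to_subtype
  exact IsoradialEmbedding.forestMeasure_real_reachWithin h (H n) hn L

theorem ae_isRootedSpanningForest (hμ : IsForestLimit S k H μ)
    (h : BoundedWeights G (S.conductance k) (S.mass k) r m₀ m₁ D) :
    ∀ᵐ ω ∂μ, IsRootedSpanningForest (⊤ : G.Subgraph) ω := by
  -- Two distinct roots joined by a path of bounded length form a clopen event that no finite rooted
  -- forest realizes, and there are countably many such events.
  have huniq : ∀ᵐ ω ∂μ, ∀ x z, x ≠ z → ∀ L, ω ∉ {ω : ForestConfig G | ω (.inr x) = true} ∩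
        reachWithin (fun u => {ω | u = z ∧ ω (.inr z) = true}) L x := by
    refine ae_all_iff.2 fun x => ae_all_iff.2 fun z => ae_all_iff.2 fun hne => ae_all_iff.2 fun L =>
      measure_eq_zero_iff_ae_notMem.1 ?_
    refine hμ.measure_eq_zero h ((isClopen_coordinate _).inter (isClopen_reachWithin h.finite
      (fun u => isClopen_const_and _ (isClopen_coordinate _)) L x)) ?_
    rintro n ω hω ⟨hx, hL⟩
    obtain ⟨_, hxz, rfl, hz⟩ := exists_mem_reachWithin.1 ⟨L, hL⟩
    exact hne ((hω.2.2.2 x (hω.2.1 x hx)).unique ⟨.refl _, hx⟩ ⟨hxz, hz⟩)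
  filter_upwards [hμ.ae_isAcyclic h, hμ.ae_exists_root h, huniq] with ω h1 h2 h3
  exact isRootedSpanningForest_top_iff.2 ⟨h1, h2, h3⟩

theorem sum_measure_le (hμ : IsForestLimit S k H μ)
    (h : BoundedWeights G (S.conductance k) (S.mass k) r m₀ m₁ D) (x : V) (Y : Finset V) :
    ∑ y ∈ Y, μ.real ({ω | ω (.inr x) = true} ∩
      ⋃ L, reachWithin (fun u => {_ω | u = y}) L x) ≤ m₁ / m₀ := by
  have := hμ.isProbabilityMeasure
  have hbase : ∀ y u : V, IsClopen {_ω : ForestConfig G | u = y} := fun y u => by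
    by_cases hu : u = y
    · simpa [hu] using isClopen_univ
    · simpa [hu] using isClopen_empty
  have hlim : ∀ y, Tendsto (fun L => μ.real ({ω | ω (.inr x) = true} ∩
      reachWithin (fun u => {_ω | u = y}) L x)) atTop (𝓝 (μ.real ({ω | ω (.inr x) = true} ∩
      ⋃ L, reachWithin (fun u => {_ω | u = y}) L x))) := by
    intro y
    rw [Set.inter_iUnion]
    refine (ENNReal.tendsto_toReal (measure_ne_top _ _)).comp
      (tendsto_measure_iUnion_atTop fun a b hab => Set.inter_subset_inter_right _
        (reachWithin_mono _ x hab))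
  refine le_of_tendsto (tendsto_finsetSum Y fun y _ => hlim y) (.of_forall fun L => ?_)
  refine le_of_tendsto (tendsto_finsetSum Y fun y _ => hμ.tendsto _
    ((isClopen_coordinate _).inter (isClopen_reachWithin h.finite (hbase y) L x))) ?_
  have hY : ∀ᶠ n in atTop, ∀ y ∈ Y, y ∈ (H n).verts :=
    (Filter.eventually_all_finset Y).2 fun y _ => hμ.eventually_mem y
  filter_upwards [hY] with n hn
  have := (hμ.exhaustion.finite n).to_subtype
  exact IsoradialEmbedding.sum_forestMeasure_real_le h (H n) x hn L

/-- First Borel–Cantelli lemma: the probabilities that `y` lies in the component rooted at `x` are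
summable over `y`. -/
theorem ae_finite_reachable (hμ : IsForestLimit S k H μ)
    (h : BoundedWeights G (S.conductance k) (S.mass k) r m₀ m₁ D) :
    ∀ᵐ ω ∂μ, ∀ x, ω (.inr x) = true → {y | (configGraph ω).Reachable x y}.Finite := by
  have := hμ.isProbabilityMeasure
  rw [ae_all_iff]
  intro x
  set A : V → Set (ForestConfig G) := fun y => {ω | ω (.inr x) = true} ∩
      ⋃ L, reachWithin (fun u => {_ω | u = y}) L x with hA
  have hsum : ∑' y, μ (A y) ≠ ⊤ := by
    refine ne_top_of_le_ne_top (ENNReal.ofReal_ne_top (r := m₁ / m₀)) ?_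
    rw [ENNReal.tsum_eq_iSup_sum]
    refine iSup_le fun Y => ?_
    refine le_trans (le_of_eq ?_) (ENNReal.ofReal_le_ofReal (hμ.sum_measure_le h x Y))
    rw [ENNReal.ofReal_sum_of_nonneg fun _ _ => measureReal_nonneg]
    exact Finset.sum_congr rfl fun y _ => (ofReal_measureReal).symm
  filter_upwards [ae_finite_setOfPred_mem hsum] with ω hω hx
  refine hω.subset fun y hy => ⟨hx, Set.mem_iUnion.2 (exists_mem_reachWithin.2 ⟨y, hy, rfl⟩)⟩

theorem ae_finite_components (hμ : IsForestLimit S k H μ)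
    (h : BoundedWeights G (S.conductance k) (S.mass k) r m₀ m₁ D) :
    ∀ᵐ ω ∂μ, ∀ C : (configGraph ω).ConnectedComponent, C.supp.Finite := by
  filter_upwards [hμ.ae_exists_root h, hμ.ae_finite_reachable h] with ω h1 h2 C
  induction C using SimpleGraph.ConnectedComponent.ind with
  | h y =>
    obtain ⟨z, hz, hz'⟩ := exists_mem_reachWithin.1 (h1 y)
    refine (h2 z hz').subset fun w hw => ?_
    have hwy : (configGraph ω).Reachable w y := SimpleGraph.ConnectedComponent.exact hw
    exact (hwy.trans hz).symm

end IsForestLimit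

end AlmostSure

/-! ### Assembly of the theorem. -/

theorem theorem5p2 {V : Type*} (G : SimpleGraph V) (S : IsoradialEmbedding G)
    (hS : ∃ ε > 0, ∀ x y : V, G.Adj x y → S.halfAngle x y ∈ Set.Ioo ε (Real.pi / 2 - ε))
    (k : ℝ) (hk : k ∈ Set.Ioo (0 : ℝ) 1) (o : EdgeOrientation G) :
    -- the massive Laplacian is invertible on `ℓ²(V)`, so that the Green function is well defined
    (∃! T, S.IsGreenOperator k T) ∧
    ∃ P : MeasureTheory.Measure (RootedSpanningForest G),
      MeasureTheory.IsProbabilityMeasure P ∧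
      -- `P` is the unique measure with determinantal marginals
      S.HasDeterminantalMarginals k o P ∧
      (∀ P' : MeasureTheory.Measure (RootedSpanningForest G),
        S.HasDeterminantalMarginals k o P' → P' = P) ∧
      -- `P` is the weak limit of the Boltzmann measures along any exhaustion
      (∀ H : ℕ → G.Subgraph, IsFiniteExhaustion G H →
        (∀ n, MeasureTheory.IsProbabilityMeasure (S.forestMeasure k (H n))) ∧
        ∀ f : BoundedContinuousFunction (ForestConfig G) ℝ,
          Filter.Tendsto (fun n => ∫ ω, f ω ∂(S.forestMeasure k (H n))) Filter.atTop
            (nhds (∫ ω, f ω.1 ∂P))) ∧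
      -- the connected components are almost surely finite
      (∀ᵐ ω ∂P, ∀ C : (configGraph ω.1).ConnectedComponent, C.supp.Finite) := by

  classical
  have := S.countable_vertices
  obtain ⟨r, m₀, m₁, D, h⟩ := S.exists_boundedWeights hS hk
  refine ⟨S.existsUnique_isGreenOperator h, ?_⟩
  obtain ⟨μ, hdet, hlim⟩ := S.exists_isDeterminantal h o
  have hprob : ∀ H : ℕ → G.Subgraph, IsFiniteExhaustion G H → ∀ n,
      MeasureTheory.IsProbabilityMeasure (S.forestMeasure k (H n)) := fun H hH n => by
    have := (hH.finite n).to_subtype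
    exact S.isProbabilityMeasure_forestMeasure h (H n)
  obtain ⟨H₀, hH₀⟩ := S.exists_exhaustion
  have hμ : IsForestLimit S k H₀ (μ : MeasureTheory.Measure (ForestConfig G)) := by
    refine ⟨inferInstance, hH₀, fun A hA => ?_⟩
    have h1 := MeasureTheory.ProbabilityMeasure.tendsto_measure_of_null_frontier_of_tendsto'
      (hlim H₀ hH₀ (fun n => ⟨_, hprob H₀ hH₀ n⟩) fun _ => rfl) (E := A)
      (by rw [hA.frontier_eq]; simp)
    exact (ENNReal.tendsto_toReal (MeasureTheory.measure_ne_top _ _)).comp h1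
  have hmeas := measurableSet_forests (G := G) h.finite
  -- The forests form a measurable set of full `μ`-measure, so pulling `μ` back to them loses
  -- nothing and pushing forward again recovers `μ`.
  let P : MeasureTheory.Measure (RootedSpanningForest G) :=
    (μ : MeasureTheory.Measure (ForestConfig G)).comap Subtype.val
  have hmap : P.map Subtype.val = (μ : MeasureTheory.Measure (ForestConfig G)) := by
    refine (map_comap_subtype_coe hmeas _).trans ?_
    exact MeasureTheory.Measure.restrict_eq_self_of_ae_mem (hμ.ae_isRootedSpanningForest h)
  have hPprob : MeasureTheory.IsProbabilityMeasure P := by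
    refine ⟨?_⟩
    have h1 := MeasureTheory.Measure.map_apply (μ := P) measurable_subtype_coe MeasurableSet.univ
    rw [hmap] at h1
    simpa using h1.symm
  refine ⟨P, hPprob, ?_, fun P' hP' => ?_, fun H hH => ⟨hprob H hH, fun f => ?_⟩, ?_⟩
  · rw [IsoradialEmbedding.hasDeterminantalMarginals_iff, hmap]
    exact hdet
  · have h1 := IsoradialEmbedding.hasDeterminantalMarginals_iff.1 hP'
    have h2 := h1.eq hdet
    -- The inclusion of the forests is a measurable embedding, so a measure on forests is determined
    -- by its image, here `μ` by uniqueness among all configurations.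
    have hemb : MeasurableEmbedding (Subtype.val : RootedSpanningForest G → ForestConfig G) :=
      .subtype_coe hmeas
    rw [← hemb.comap_map P', h2]
  · have h1 := MeasureTheory.ProbabilityMeasure.tendsto_iff_forall_integral_tendsto.1
      (hlim H hH (fun n => ⟨_, hprob H hH n⟩) fun _ => rfl) f
    have h2 : ∫ ω, f ω ∂(μ : MeasureTheory.Measure (ForestConfig G)) = ∫ ω, f ω.1 ∂P := by
      rw [← hmap, MeasureTheory.integral_map measurable_subtype_coe.aemeasurable
        f.continuous.measurable.aestronglyMeasurable]
    rw [← h2]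
    exact h1
  · have h1 := hμ.ae_finite_components h
    rw [← hmap] at h1
    exact MeasureTheory.ae_of_ae_map measurable_subtype_coe.aemeasurable h1
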